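/- Logarithms written $\log$ are to base $2$, $H_2(p)=-p\log p-(1-p)\log(1-p)$ is the binary entropy function, $H_2^{-1}:[0,1]\to[0,\tfrac12]$ is the inverse of its restriction to $[0,\tfrac12]$, and for $0\le\delta<\tfrac12$ $$\kappa_Z(\delta)=\sup_{0<r<1-H_2(\delta)} r\Bigl(1-\frac{\delta}{H_2^{-1}(1-r)}\Bigr)$$ is the rate given by the Zyablov bound. Fix $0<\rho\le1$. In the Light Bulb Problem one is given $n\ge2$ bit strings of length $L$, all of whose bits are independent and uniform, except that for one unknown pair of distinct indices $a,b$ the strings $X_a,X_b$ are correlated: independently for each position $k$, $\Pr((X_a)_k=(X_b)_k)=\frac{1+\rho}{2}$ and $\Pr((X_a)_k\ne(X_b)_k)=\frac{1-\rho}{2}$. The task is to output $\{a,b\}$. Algorithms are deterministic programs of a random access machine with logarithmic cost that has random access to the input bits. A deterministic algorithm solves the problem in time $T(n)$ if there is a constant $c$ (depending on $\rho$) such that for all $n\ge2$ and all $L\ge c\log^2n$ it halts within time $T(n)$ on every input and, for every pair $a\ne b$, outputs $\{a,b\}$ with probability at least $1-1/n^2$ over the random instance. Constants and the $o(1)$ terms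 below (as $n\to\infty$) may depend on $\rho$. (1) Suppose that $\kappa_Z(\frac{1-\rho}{2})\ge\frac12$, or that $H_2\bigl(1-\kappa_Z(\frac{1-\rho}{2})\bigr)\frac{4\ln2}{\rho^2}\ge1$. Then there is a deterministic algorithm that solves the Light Bulb Problem in time $$O(n\,\mathrm{polylog}\,n)\cdot 2^{H_2\left(1-\kappa_Z\left(\frac{1-\rho}{2}\right)\right)\frac{4\ln2\,\log n}{\rho^2}(1+o(1))}.$$ (2) For every $0<\rho\le 1$, put $m=\lceil 4\ln2\,\log n/\rho^2\rceil$ and $d=\lceil(1-\rho)m/2\rceil$. There are a deterministic preprocessing program, which is given only $n,m,d$ and not the instance, and a deterministic algorithm that starts from the memory left by it, such that the preprocessing takes time $O(n^{2.773/\rho^2})$ and generates the decoding lookup table of a code of block length $m$ produced by Gilbert's greedy procedure (starting from $S=\{0,1\}^m$, repeatedly pick some $x\in S$ as a codeword and remove from $S$ all words at Hamming distance at most $d$ from $x$, until $S$ is empty); the table maps each word within distance $\lfloor(d-1)/2\rfloor$ (or $0$ if $d=0$) of a codeword to that codeword and every other word to a special symbol. After this one-time preprocessing the algorithm solves the Light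 Bulb Problem in time $$O(n\,\mathrm{polylog}\,n)\cdot 2^{H_2\left(H_2\left(\frac{1-\rho}{2}\right)\right)\frac{4\ln2\,\log n}{\rho^2}(1+o(1))}.$$ -/

import Mathlib

namespace LightBulb

/-! ### Entropy and the Zyablov rate -/

/-- The binary entropy function with logarithms to base `2`. -/
noncomputable def H2 (p : ℝ) : ℝ := Real.binEntropy p / Real.log 2

/-- The inverse of `H2`, with values in `[0, 1/2]` (used for arguments in `[0, 1]`). -/
noncomputable def H2inv (y : ℝ) : ℝ := Function.invFunOn H2 (Set.Icc 0 (1 / 2)) y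

/-- The rate given by the Zyablov bound at relative distance `δ`:
the supremum of `r (1 - δ / H2⁻¹(1 - r))` over `0 < r < 1 - H2 δ`. -/
noncomputable def kappaZ (δ : ℝ) : ℝ :=
  sSup ((fun r : ℝ => r * (1 - δ / H2inv (1 - r))) '' Set.Ioo 0 (1 - H2 δ))

/-! ### Random access machines with logarithmic cost -/

/-- The arithmetic operations of the machine; `sub` is truncated and `div` rounds down. -/
inductive Op where
  | add | sub | mul | div

def Op.eval : Op → ℕ → ℕ → ℕ
  | .add, x, y => x + y
  | .sub, x, y => x - y
  | .mul, x, y => x * y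
  | .div, x, y => x / y

/-- Programs of a random access machine. It has registers and a memory, both indexed by the
natural numbers and holding natural numbers; a register of the program text is named by its
index, memory is addressed indirectly. `read r i k` puts the `k`-th bit of the `i`-th input string
into `r`, where `i` and `k` are taken from registers. -/
inductive Cmd where
  | const (r k : ℕ)
  | arith (o : Op) (r a b : ℕ)
  | load (r a : ℕ)
  | store (a r : ℕ)
  | read (r i k : ℕ)
  | seq (c₁ c₂ : Cmd)
  | ite (r : ℕ) (c₁ c₂ : Cmd)
  | loop (r : ℕ) (c : Cmd)

structure State where
  reg : ℕ → ℕ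
  mem : ℕ → ℕ

def State.setReg (s : State) (r v : ℕ) : State := ⟨Function.update s.reg r v, s.mem⟩

def State.setMem (s : State) (a v : ℕ) : State := ⟨s.reg, Function.update s.mem a v⟩

/-- `Exec inp c s t s'`: on the input `inp`, the program `c` started in the state `s` halts
in the state `s'` at total cost `t`. Every elementary step costs one plus the binary lengths
of the numbers and addresses that it handles (the logarithmic cost criterion). -/
inductive Exec (inp : ℕ → ℕ → ℕ) : Cmd → State → ℕ → State → Prop
  | const (s : State) (r k : ℕ) : Exec inp (.const r k) s (1 + k.size) (s.setReg r k)
  | arith (s : State) (o : Op) (r a b : ℕ) :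
      Exec inp (.arith o r a b) s (1 + (s.reg a).size + (s.reg b).size)
        (s.setReg r (o.eval (s.reg a) (s.reg b)))
  | load (s : State) (r a : ℕ) :
      Exec inp (.load r a) s (1 + (s.reg a).size + (s.mem (s.reg a)).size)
        (s.setReg r (s.mem (s.reg a)))
  | store (s : State) (a r : ℕ) :
      Exec inp (.store a r) s (1 + (s.reg a).size + (s.reg r).size)
        (s.setMem (s.reg a) (s.reg r))
  | read (s : State) (r i k : ℕ) :
      Exec inp (.read r i k) s (1 + (s.reg i).size + (s.reg k).size)
        (s.setReg r (inp (s.reg i) (s.reg k)))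
  | seq {c₁ c₂ : Cmd} {s s' s'' : State} {t t' : ℕ} :
      Exec inp c₁ s t s' → Exec inp c₂ s' t' s'' → Exec inp (.seq c₁ c₂) s (t + t') s''
  | ite_true {r : ℕ} {c₁ c₂ : Cmd} {s s' : State} {t : ℕ} :
      s.reg r ≠ 0 → Exec inp c₁ s t s' →
      Exec inp (.ite r c₁ c₂) s (1 + (s.reg r).size + t) s'
  | ite_false {r : ℕ} {c₁ c₂ : Cmd} {s s' : State} {t : ℕ} :
      s.reg r = 0 → Exec inp c₂ s t s' →
      Exec inp (.ite r c₁ c₂) s (1 + (s.reg r).size + t) s'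
  | loop_done {r : ℕ} {c : Cmd} {s : State} :
      s.reg r = 0 → Exec inp (.loop r c) s (1 + (s.reg r).size) s
  | loop_step {r : ℕ} {c : Cmd} {s s' s'' : State} {t t' : ℕ} :
      s.reg r ≠ 0 → Exec inp c s t s' → Exec inp (.loop r c) s' t' s'' →
      Exec inp (.loop r c) s (1 + (s.reg r).size + t + t') s''

/-- The machine is deterministic: the final state and the cost are determined. -/
theorem Exec.det {inp : ℕ → ℕ → ℕ} {c : Cmd} {s s₁ : State} {t₁ : ℕ}
    (h : Exec inp c s t₁ s₁) : ∀ {t₂ : ℕ} {s₂ : State}, Exec inp c s t₂ s₂ →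
      t₁ = t₂ ∧ s₁ = s₂ := by
  induction h with
  | const | arith | load | store | read => intro t₂ s₂ h₂; cases h₂; exact ⟨rfl, rfl⟩
  | seq _ _ ih₁ ih₂ =>
    intro t₂ s₂ h₂
    cases h₂ with
    | seq a b =>
      obtain ⟨rfl, rfl⟩ := ih₁ a
      obtain ⟨rfl, rfl⟩ := ih₂ b
      exact ⟨rfl, rfl⟩
  | ite_true hr _ ih =>
    intro t₂ s₂ h₂
    cases h₂ with
    | ite_true _ a => obtain ⟨rfl, rfl⟩ := ih a; exact ⟨rfl, rfl⟩
    | ite_false h0 _ => exact absurd h0 hr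
  | ite_false hr _ ih =>
    intro t₂ s₂ h₂
    cases h₂ with
    | ite_true h0 _ => exact absurd hr h0
    | ite_false _ a => obtain ⟨rfl, rfl⟩ := ih a; exact ⟨rfl, rfl⟩
  | loop_done hr =>
    intro t₂ s₂ h₂
    cases h₂ with
    | loop_done _ => exact ⟨rfl, rfl⟩
    | loop_step h0 _ _ => exact absurd hr h0
  | loop_step hr _ _ ih₁ ih₂ =>
    intro t₂ s₂ h₂
    cases h₂ with
    | loop_done h0 => exact absurd h0 hr
    | loop_step _ a b =>
      obtain ⟨rfl, rfl⟩ := ih₁ a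
      obtain ⟨rfl, rfl⟩ := ih₂ b
      exact ⟨rfl, rfl⟩

/-- The initial state: the arguments stand in the registers `0, 1, …`, all other registers
are zero, and the memory is `mem`. -/
def initState (args : List ℕ) (mem : ℕ → ℕ) : State := ⟨fun r => args.getD r 0, mem⟩

/-! ### The Light Bulb Problem -/

/-- The law of one bit that is `true` with probability `(1 - ρ) / 2`; for `ρ = 0` a fair coin. -/
noncomputable def bitLaw (ρ : ℝ) : MeasureTheory.Measure Bool :=
  ENNReal.ofReal ((1 - ρ) / 2) • MeasureTheory.Measure.dirac true +
    ENNReal.ofReal ((1 + ρ) / 2) • MeasureTheory.Measure.dirac false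

/-- The joint law of the bits that `n` strings have at one position: independent fair coins,
except that the bit of the string `b` is that of the string `a`, flipped with probability
`(1 - ρ) / 2` independently of everything else. -/
noncomputable def columnLaw (ρ : ℝ) {n : ℕ} (a b : Fin n) :
    MeasureTheory.Measure (Fin n → Bool) :=
  ((MeasureTheory.Measure.pi fun _ : Fin n => bitLaw 0).prod (bitLaw ρ)).map
    fun p => Function.update p.1 b (xor (p.1 a) p.2)

/-- `n` strings of length `L`: `X k i` is the `k`-th bit of the `i`-th string. -/
abbrev Strings (n L : ℕ) : Type := Fin L → Fin n → Bool

/-- The law of a random instance with correlated pair `a`, `b`: the positions are independent. -/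
noncomputable def instanceLaw (ρ : ℝ) {n : ℕ} (a b : Fin n) (L : ℕ) :
    MeasureTheory.Measure (Strings n L) :=
  MeasureTheory.Measure.pi fun _ : Fin L => columnLaw ρ a b

/-- The input of the machine: random access to the bits of the strings. -/
def Strings.input {n L : ℕ} (X : Strings n L) (i k : ℕ) : ℕ :=
  if h : i < n ∧ k < L then (X ⟨k, h.2⟩ ⟨i, h.1⟩).toNat else 0

/-- On the instance `X`, the program `Q` started with memory `mem` halts with the (unordered)
pair `a`, `b` in the registers `0` and `1`. -/
def FindsPair (Q : Cmd) (mem : ℕ → ℕ) {n L : ℕ} (X : Strings n L) (a b : Fin n) : Prop :=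
  ∃ (t : ℕ) (s : State), Exec X.input Q (initState [n, L] mem) t s ∧
    ((s.reg 0 = a ∧ s.reg 1 = b) ∨ (s.reg 0 = b ∧ s.reg 1 = a))

/-- `Q`, started with memory `mem`, solves the Light Bulb Problem for `n` strings of length `L`
in time `T`: it halts within time `T` on every instance, and wherever the correlated pair is
placed, it finds that pair with probability at least `1 - 1 / n ^ 2` over the instance. -/
def Solves (Q : Cmd) (mem : ℕ → ℕ) (ρ : ℝ) (n L : ℕ) (T : ℝ) : Prop :=
  (∀ X : Strings n L, ∃ (t : ℕ) (s : State),
    Exec X.input Q (initState [n, L] mem) t s ∧ (t : ℝ) ≤ T) ∧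
  ∀ a b : Fin n, a ≠ b →
    1 - 1 / (n : ℝ) ^ 2 ≤ (instanceLaw ρ a b L).real {X | FindsPair Q mem X a b}

/-- `C n (log n) ^ k * 2 ^ (e (4 ln 2 log n / ρ ^ 2) (1 + ε))`, with `log` to base `2`. -/
noncomputable def timeBound (ρ e C : ℝ) (k : ℕ) (ε : ℝ) (n : ℕ) : ℝ :=
  C * (n * Real.logb 2 n ^ k) *
    (2 : ℝ) ^ (e * (4 * Real.log 2 * Real.logb 2 n / ρ ^ 2) * (1 + ε))

/-! ### Gilbert's greedy code and its decoding table -/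

/-- The pairs `(S, C)` that Gilbert's greedy procedure can reach: start with all words in `S` and
no codeword in `C`; pick any `x ∈ S`, add it to `C` and remove the ball of radius `d` around `x`
from `S`. -/
inductive GilbertRun (m d : ℕ) : Set (Fin m → Bool) → Set (Fin m → Bool) → Prop
  | start : GilbertRun m d Set.univ ∅
  | pick {S C : Set (Fin m → Bool)} (x : Fin m → Bool) : GilbertRun m d S C → x ∈ S →
      GilbertRun m d (S \ {y | hammingDist x y ≤ d}) (insert x C)

/-- A code that Gilbert's greedy procedure can produce: no word is left. -/
def IsGilbertCode (m d : ℕ) (C : Set (Fin m → Bool)) : Prop := GilbertRun m d ∅ C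

/-- The word of length `m` with binary code `v`. -/
def word (m v : ℕ) : Fin m → Bool := fun i => v.testBit i

/-- The memory cells `0, …, 2 ^ m - 1` hold the unique-decoding table of `C` with the decoding
radius `(d - 1) / 2`, rounded down (radius `0` for `d = 0`): the cell of a word within this radius
of a codeword `w` holds the code of `w` plus one, the cell of any other word holds `0`. -/
def IsDecodingTable (m d : ℕ) (C : Set (Fin m → Bool)) (mem : ℕ → ℕ) : Prop :=
  ∀ v < 2 ^ m,
    (∀ w < 2 ^ m, word m w ∈ C → hammingDist (word m v) (word m w) ≤ (d - 1) / 2 →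
      mem v = w + 1) ∧
    ((∀ c ∈ C, (d - 1) / 2 < hammingDist (word m v) c) → mem v = 0)

/-- The block length `4 ln 2 log n / ρ ^ 2`, rounded up. -/
noncomputable def blockLength (ρ : ℝ) (n : ℕ) : ℕ :=
  ⌈4 * Real.log 2 * Real.logb 2 n / ρ ^ 2⌉₊

/-- The distance `(1 - ρ) m / 2` for the block length `m`, rounded up. -/
noncomputable def codeDistance (ρ : ℝ) (n : ℕ) : ℕ :=
  ⌈(1 - ρ) * blockLength ρ n / 2⌉₊

end LightBulb

/-!
Put `δ = (1 - ρ) / 2`. Hash the strings by their bits in a block of `k = log n + O(1)` positions,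
look up every string in the hash table under all error patterns of weight at most `t ≥ 2 δ k`, and
compare the strings found in this way on `O(log n)` positions. By Markov's inequality the
correlated pair differs on a block by such a pattern with probability at least `1 / 2`, and it is
found unless another string has the same bits as one of the two, which has probability at most
`1 / 8`; so `5 log n` disjoint blocks suffice. A string is looked up at most
`O(n ^ min 1 (4 H₂(δ)))` times, and concavity of the entropy, together with `2 ≤ 4 ln 2 / ρ ^ 2`,
shows that both exponents of the theorem are at least `min 1 (4 H₂(δ))`.

The search does not use the decoding table. The preprocessing runs Gilbert's procedure on a linear
code: if `x` is far from the code `C`, so are all words of `x + C`, and a table of nearest codewords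
of `C` yields one for the span of `C` and `x` by a single comparison for each word.
-/

namespace LightBulb

/-! ### Entropy -/

theorem H2_zero : H2 0 = 0 := by simp [H2]

theorem H2_half : H2 (1 / 2) = 1 := by
  rw [H2, one_div, Real.binEntropy_two_inv, div_self (Real.log_pos one_lt_two).ne']

theorem H2_one_sub (x : ℝ) : H2 (1 - x) = H2 x := by simp [H2]

theorem H2_nonneg {x : ℝ} (h0 : 0 ≤ x) (h1 : x ≤ 1) : 0 ≤ H2 x :=
  div_nonneg (Real.binEntropy_nonneg h0 h1) (Real.log_pos one_lt_two).le

theorem H2_le_one (x : ℝ) : H2 x ≤ 1 :=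
  (div_le_one (Real.log_pos one_lt_two)).2 Real.binEntropy_le_log_two

theorem H2_mul_log_two (x : ℝ) : H2 x * Real.log 2 = Real.binEntropy x :=
  div_mul_cancel₀ _ (Real.log_pos one_lt_two).ne'

theorem concaveOn_H2 : ConcaveOn ℝ (Set.Icc 0 1) H2 := by
  have h := Real.strictConcave_binEntropy.concaveOn.smul (inv_nonneg.2 (Real.log_pos one_lt_two).le)
  exact h.congr fun x _ => inv_mul_eq_div (Real.log 2) (Real.binEntropy x)

theorem mul_H2_le_H2_mul {c x : ℝ} (hc0 : 0 ≤ c) (hc1 : c ≤ 1) (hx0 : 0 ≤ x) (hx1 : x ≤ 1) :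
    c * H2 x ≤ H2 (c * x) := by
  simpa [H2_zero] using concaveOn_H2.2 (x := 0) (by simp) ⟨hx0, hx1⟩ (sub_nonneg.2 hc1) hc0
    (sub_add_cancel 1 c)

theorem two_mul_le_H2 {x : ℝ} (h0 : 0 ≤ x) (h1 : x ≤ 1 / 2) : 2 * x ≤ H2 x := by
  have h := mul_H2_le_H2_mul (c := 2 * x) (x := 1 / 2) (by linarith) (by linarith) (by norm_num)
    (by norm_num)
  rwa [H2_half, mul_one, mul_one_div, mul_div_cancel_left₀ x two_ne_zero] at h

theorem H2_mul_le {c x : ℝ} (hc : 1 ≤ c) (hx : 0 ≤ x) (hcx : c * x ≤ 1) :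
    H2 (c * x) ≤ c * H2 x := by
  have hc0 : 0 < c := by linarith
  have h := mul_H2_le_H2_mul (inv_nonneg.2 hc0.le) (inv_le_one_of_one_le₀ hc)
    (mul_nonneg hc0.le hx) hcx
  rwa [inv_mul_cancel_left₀ hc0.ne', inv_mul_le_iff₀ hc0] at h

theorem binEntropy_half_sub_le {ρ : ℝ} (h0 : 0 ≤ ρ) (h1 : ρ ≤ 1) :
    Real.binEntropy ((1 - ρ) / 2) ≤ Real.log 2 - ρ ^ 2 / 6 := by
  have entropy_eq : Real.binEntropy ((1 - ρ) / 2) = Real.log 2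
      - ((1 - ρ) * Real.log (1 - ρ) + (1 + ρ) * Real.log (1 + ρ)) / 2 := by
    rw [Real.binEntropy_eq_negMulLog_add_negMulLog_one_sub,
      show 1 - (1 - ρ) / 2 = (1 + ρ) * 2⁻¹ by ring, div_eq_mul_inv, Real.negMulLog_mul,
      Real.negMulLog_mul, Real.negMulLog, Real.negMulLog, Real.negMulLog, Real.log_inv]
    ring
  have lower_minus : -ρ ≤ (1 - ρ) * Real.log (1 - ρ) := by
    linarith [Real.self_sub_one_le_mul_log (sub_nonneg.2 h1)]
  have lower_plus : ρ + ρ ^ 2 / 3 ≤ (1 + ρ) * Real.log (1 + ρ) := by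
    refine le_trans ?_ (mul_le_mul_of_nonneg_left (Real.le_log_one_add_of_nonneg h0)
      (by linarith))
    rw [← mul_div_assoc, le_div_iff₀ (by linarith)]
    nlinarith [mul_nonneg (sq_nonneg ρ) (sub_nonneg.2 h1)]
  linarith

theorem one_le_H2_H2_mul {ρ : ℝ} (h0 : 0 < ρ) (h1 : ρ ≤ 1) (h : 1 / 2 ≤ H2 ((1 - ρ) / 2)) :
    1 ≤ H2 (H2 ((1 - ρ) / 2)) * (4 * Real.log 2 / ρ ^ 2) := by
  have gap : ρ ^ 2 / 6 ≤ (1 - H2 ((1 - ρ) / 2)) * Real.log 2 := by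
    rw [sub_mul, H2_mul_log_two]
    linarith [binEntropy_half_sub_le h0.le h1]
  have outer := two_mul_le_H2 (sub_nonneg.2 (H2_le_one ((1 - ρ) / 2))) (by linarith)
  rw [H2_one_sub] at outer
  rw [← mul_div_assoc, le_div_iff₀ (by positivity)]
  nlinarith [Real.log_pos one_lt_two]

theorem H2inv_nonneg {y : ℝ} (h0 : 0 ≤ y) (h1 : y ≤ 1) : 0 ≤ H2inv y := by
  have hcont : ContinuousOn H2 (Set.Icc 0 (1 / 2)) :=
    (Real.binEntropy_continuous.div_const _).continuousOn
  have h := intermediate_value_Icc (by norm_num) hcont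
  rw [H2_zero, H2_half] at h
  exact (Function.invFunOn_mem (h ⟨h0, h1⟩)).1

theorem kappaZ_le_one_sub_H2 {δ : ℝ} (h0 : 0 ≤ δ) (h1 : δ ≤ 1) : kappaZ δ ≤ 1 - H2 δ := by
  refine Real.sSup_le ?_ (sub_nonneg.2 (H2_le_one δ))
  rintro _ ⟨r, ⟨hr0, hr1⟩, rfl⟩
  have hH := H2_nonneg h0 h1
  have hquot := div_nonneg h0 (H2inv_nonneg (y := 1 - r) (by linarith) (by linarith))
  calc r * (1 - δ / H2inv (1 - r)) ≤ r * 1 := by gcongr; linarith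
    _ ≤ 1 - H2 δ := by linarith

/-! ### Binary lengths and logarithms -/

theorem one_le_logb {n : ℕ} (hn : 2 ≤ n) : 1 ≤ Real.logb 2 n := by
  rw [Real.le_logb_iff_rpow_le one_lt_two (by positivity), Real.rpow_one]
  exact_mod_cast hn

theorem logb_le_size {n : ℕ} (hn : n ≠ 0) : Real.logb 2 n ≤ n.size := by
  rw [Real.logb_le_iff_le_rpow one_lt_two (by positivity), Real.rpow_natCast]
  exact_mod_cast (Nat.lt_size_self n).le

theorem two_pow_size_le {n : ℕ} (hn : n ≠ 0) : 2 ^ n.size ≤ 2 * n := by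
  obtain ⟨j, hj⟩ := Nat.exists_eq_succ_of_ne_zero (Nat.size_pos.2 (Nat.pos_of_ne_zero hn)).ne'
  have h : 2 ^ j ≤ n := Nat.lt_size.1 (hj ▸ j.lt_succ_self)
  rw [hj, pow_succ']
  exact Nat.mul_le_mul_left 2 h

theorem size_le_logb_add_one {n : ℕ} (hn : n ≠ 0) : (n.size : ℝ) ≤ Real.logb 2 n + 1 := by
  have h : (2 : ℝ) ^ n.size ≤ 2 * n := by exact_mod_cast two_pow_size_le hn
  have := Real.logb_le_logb_of_le one_lt_two (by positivity) h
  rw [Real.logb_pow, Real.logb_mul two_ne_zero (by positivity),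
    Real.logb_self_eq_one one_lt_two] at this
  linarith

theorem two_rpow_mul_size_add_three_le {θ : ℝ} (h0 : 0 ≤ θ) (h1 : θ ≤ 1) {n : ℕ} (hn : n ≠ 0) :
    (2 : ℝ) ^ (θ * (n.size + 3)) ≤ 16 * (2 : ℝ) ^ (θ * Real.logb 2 n) := by
  rw [show (16 : ℝ) = (2 : ℝ) ^ (4 : ℝ) by norm_num, ← Real.rpow_add two_pos]
  refine Real.rpow_le_rpow_of_exponent_le one_le_two ?_
  calc θ * (n.size + 3) ≤ θ * (Real.logb 2 n + 4) :=
        mul_le_mul_of_nonneg_left (by linarith [size_le_logb_add_one hn]) h0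
    _ ≤ 4 + θ * Real.logb 2 n := by linarith

/-! ### Bit words -/

/-- The Hamming weight of the word that consists of the lowest `m` binary digits of `v`. -/
def wt (m v : ℕ) : ℕ := ((Finset.range m).filter fun i => v.testBit i).card

theorem wt_le (m v : ℕ) : wt m v ≤ m := by
  simpa only [wt, Finset.card_range] using
    Finset.card_filter_le (Finset.range m) fun i => v.testBit i

theorem wt_zero_right (m : ℕ) : wt m 0 = 0 := by simp [wt]

theorem wt_succ (m v : ℕ) : wt (m + 1) v = wt m v + v / 2 ^ m % 2 := by
  have digit : v.testBit m = decide (v / 2 ^ m % 2 = 1) := Nat.testBit_eq_decide_div_mod_eq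
  rw [wt, Finset.range_add_one, Finset.filter_insert]
  rcases Nat.mod_two_eq_zero_or_one (v / 2 ^ m) with h | h <;> rw [h] at digit ⊢ <;>
    simp [digit, wt]

theorem wt_succ_of_lt {m v : ℕ} (hv : v < 2 ^ m) : wt (m + 1) v = wt m v := by
  rw [wt_succ, Nat.div_eq_of_lt hv, Nat.zero_mod, add_zero]

theorem wt_succ_two_pow_add {m v : ℕ} (hv : v < 2 ^ m) : wt (m + 1) (2 ^ m + v) = wt m v + 1 := by
  have low : wt m (2 ^ m + v) = wt m v := congrArg Finset.card <| Finset.filter_congr fun i hi => by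
    rw [Nat.testBit_two_pow_add_gt (Finset.mem_range.1 hi)]
  rw [wt_succ, low, Nat.add_div_left _ (Nat.two_pow_pos m), Nat.div_eq_of_lt hv]

theorem hammingDist_word (m v w : ℕ) :
    hammingDist (word m v) (word m w) = wt m (v ^^^ w) := by
  rw [hammingDist, wt, Finset.card_filter, Finset.card_filter,
    ← Fin.sum_univ_eq_sum_range (fun i => if (v ^^^ w).testBit i = true then 1 else 0)]
  refine Finset.sum_congr rfl fun i _ => ?_
  by_cases h : v.testBit i = w.testBit i <;> simp [word, h]

theorem wt_xor_triangle (m u v w : ℕ) : wt m (u ^^^ w) ≤ wt m (v ^^^ u) + wt m (v ^^^ w) := by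
  simpa only [hammingDist_word] using hammingDist_triangle_left (word m u) (word m w) (word m v)

theorem word_injOn {m v w : ℕ} (hv : v < 2 ^ m) (hw : w < 2 ^ m) (h : word m v = word m w) :
    v = w := by
  refine Nat.eq_of_testBit_eq fun i => ?_
  by_cases hi : i < m
  · exact congrFun h ⟨i, hi⟩
  · have hi' : 2 ^ m ≤ 2 ^ i := Nat.pow_le_pow_right two_pos (not_lt.1 hi)
    rw [Nat.testBit_lt_two_pow (hv.trans_le hi'), Nat.testBit_lt_two_pow (hw.trans_le hi')]

theorem exists_word (m : ℕ) (y : Fin m → Bool) : ∃ v < 2 ^ m, word m v = y := by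
  have hinj : Function.Injective (fun v : Fin (2 ^ m) => word m v) :=
    fun v w h => Fin.ext (word_injOn v.2 w.2 h)
  have hbij := (Fintype.bijective_iff_injective_and_card _).2 ⟨hinj, by simp⟩
  obtain ⟨v, hv⟩ := hbij.2 y
  exact ⟨v, v.2, hv⟩

theorem xor_mod_two_pow_succ (x y j : ℕ) :
    (x ^^^ y) % 2 ^ (j + 1) = (x ^^^ y) % 2 ^ j + (x ^^^ y) / 2 ^ j % 2 * 2 ^ j := by
  rw [pow_succ, Nat.mod_mul, mul_comm (2 ^ j)]

theorem xor_div_two_pow_mod_two (x y j : ℕ) :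
    (x ^^^ y) / 2 ^ j % 2 = (x / 2 ^ j + y / 2 ^ j) % 2 := by
  rw [← Nat.xor_mod_two_eq]
  simp only [← Nat.shiftRight_eq_div_pow, Nat.shiftRight_xor_distrib]

/-- The number whose binary digits are the bits `off, …, off + K - 1` of the string `i`. -/
def readBits (inp : ℕ → ℕ → ℕ) (i off : ℕ) : ℕ → ℕ
  | 0 => 0
  | K + 1 => inp i off + 2 * readBits inp i (off + 1) K

section

variable {inp : ℕ → ℕ → ℕ} (hinp : ∀ i k, inp i k ≤ 1) (i j off K : ℕ)
include hinp

theorem readBits_lt : readBits inp i off K < 2 ^ K := by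
  induction K generalizing off with
  | zero => exact zero_lt_one
  | succ K ih =>
    have := hinp i off
    have := ih (off + 1)
    rw [readBits, pow_succ]
    omega

theorem testBit_readBits (p : ℕ) :
    (readBits inp i off K).testBit p = decide (p < K ∧ inp i (off + p) = 1) := by
  induction K generalizing off p with
  | zero => simp [readBits]
  | succ K ih =>
    have digit_le := hinp i off
    cases p with
    | zero =>
      rcases Nat.le_one_iff_eq_zero_or_eq_one.1 digit_le with h | h <;> simp [readBits, h]
    | succ p =>
      have tail : (inp i off + 2 * readBits inp i (off + 1) K) / 2 =
          readBits inp i (off + 1) K := by omega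
      simp only [readBits, Nat.testBit_succ, tail, ih, add_assoc, add_comm 1 p,
        Nat.succ_lt_succ_iff]

end

/-- The number of positions among `off, …, off + K - 1` where the strings `i` and `j` differ. -/
def mismatches (inp : ℕ → ℕ → ℕ) (i j off K : ℕ) : ℕ :=
  ((Finset.range K).filter fun p => inp i (off + p) ≠ inp j (off + p)).card

theorem wt_xor_readBits {inp : ℕ → ℕ → ℕ} (hinp : ∀ i k, inp i k ≤ 1) (i j off K : ℕ) :
    wt K (readBits inp i off K ^^^ readBits inp j off K) = mismatches inp i j off K := by
  unfold wt mismatches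
  congr 1
  refine Finset.filter_congr fun p hp => ?_
  have hi := hinp i (off + p)
  have hj := hinp j (off + p)
  simp only [Nat.testBit_xor, testBit_readBits hinp, Finset.mem_range.1 hp, true_and,
    bne_iff_ne, ne_eq, decide_eq_decide]
  omega

/-! ### Counting words of small weight -/

/-- The words of length `k` and weight at most `t`: the Hamming ball around zero. -/
def lightWords (k t : ℕ) : Finset ℕ := (Finset.range (2 ^ k)).filter fun e => wt k e ≤ t

theorem mem_lightWords {k t e : ℕ} : e ∈ lightWords k t ↔ e < 2 ^ k ∧ wt k e ≤ t := by
  rw [lightWords, Finset.mem_filter, Finset.mem_range]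

theorem card_lightWords_le_two_pow (k t : ℕ) : (lightWords k t).card ≤ 2 ^ k := by
  simpa only [lightWords, Finset.card_range] using
    Finset.card_filter_le (Finset.range (2 ^ k)) fun e => wt k e ≤ t

theorem sum_pow_wt_mul_pow {R : Type*} [CommSemiring R] (x y : R) (k : ℕ) :
    ∑ e ∈ Finset.range (2 ^ k), x ^ wt k e * y ^ (k - wt k e) = (x + y) ^ k := by
  induction k with
  | zero => simp [wt]
  | succ k ih =>
    rw [pow_succ 2, mul_two, Finset.sum_range_add, pow_succ, add_comm x y, mul_add,
      add_comm y x, ← ih, Finset.sum_mul, Finset.sum_mul]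
    congr 1 <;> refine Finset.sum_congr rfl fun e he => ?_
    · rw [wt_succ_of_lt (Finset.mem_range.1 he), Nat.succ_sub (wt_le k e), pow_succ, mul_assoc]
    · rw [wt_succ_two_pow_add (Finset.mem_range.1 he), Nat.add_sub_add_right, pow_succ]
      ring

theorem two_rpow_neg_H2_mul_le {x : ℝ} (h0 : 0 ≤ x) (h1 : x ≤ 1 / 2) {k w : ℕ} (hwk : w ≤ k)
    (hw : (w : ℝ) ≤ x * k) : (2 : ℝ) ^ (-(H2 x * k)) ≤ x ^ w * (1 - x) ^ (k - w) := by
  rcases h0.eq_or_lt with rfl | h0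
  · obtain rfl : w = 0 := by
      rw [zero_mul] at hw
      exact_mod_cast le_antisymm hw w.cast_nonneg
    simp [H2_zero]
  have hx1 : 0 < 1 - x := by linarith
  have hlog : Real.log x ≤ Real.log (1 - x) := Real.log_le_log h0 (by linarith)
  have hH : Real.log 2 * -(H2 x * k) = k * (x * Real.log x + (1 - x) * Real.log (1 - x)) := by
    rw [show Real.log 2 * -(H2 x * k) = -(k * (H2 x * Real.log 2)) by ring, H2_mul_log_two,
      Real.binEntropy_eq_negMulLog_add_negMulLog_one_sub, Real.negMulLog, Real.negMulLog]
    ring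
  rw [Real.rpow_def_of_pos two_pos, hH,
    ← Real.exp_log (show 0 < x ^ w * (1 - x) ^ (k - w) by positivity), Real.exp_le_exp,
    Real.log_mul (by positivity) (by positivity), Real.log_pow, Real.log_pow, Nat.cast_sub hwk]
  nlinarith

theorem card_lightWords_le_two_rpow {x : ℝ} (h0 : 0 ≤ x) (h1 : x ≤ 1 / 2) {k t : ℕ}
    (ht : (t : ℝ) ≤ x * k) : ((lightWords k t).card : ℝ) ≤ (2 : ℝ) ^ (H2 x * k) := by
  have hx1 : 0 ≤ 1 - x := by linarith
  have hsum : ((lightWords k t).card : ℝ) * (2 : ℝ) ^ (-(H2 x * k)) ≤ 1 := by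
    calc ((lightWords k t).card : ℝ) * (2 : ℝ) ^ (-(H2 x * k))
        = ∑ _e ∈ lightWords k t, (2 : ℝ) ^ (-(H2 x * k)) := by
          rw [Finset.sum_const, nsmul_eq_mul]
      _ ≤ ∑ e ∈ lightWords k t, x ^ wt k e * (1 - x) ^ (k - wt k e) := by
          refine Finset.sum_le_sum fun e he => two_rpow_neg_H2_mul_le h0 h1 (wt_le k e) ?_
          exact le_trans (by exact_mod_cast (mem_lightWords.1 he).2) ht
      _ ≤ ∑ e ∈ Finset.range (2 ^ k), x ^ wt k e * (1 - x) ^ (k - wt k e) :=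
          Finset.sum_le_sum_of_subset_of_nonneg (Finset.filter_subset _ _) fun e _ _ =>
            mul_nonneg (pow_nonneg h0 _) (pow_nonneg hx1 _)
      _ = 1 := by rw [sum_pow_wt_mul_pow, add_sub_cancel, one_pow]
  rwa [Real.rpow_neg two_pos.le, ← div_eq_mul_inv, div_le_one (Real.rpow_pos_of_pos two_pos _)]
    at hsum

theorem card_lightWords_le_two_rpow_min {c δ : ℝ} (hc : 1 ≤ c) (h0 : 0 ≤ δ) (h1 : δ ≤ 1 / 2)
    {k t : ℕ} (ht : (t : ℝ) ≤ c * δ * k) :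
    ((lightWords k t).card : ℝ) ≤ (2 : ℝ) ^ (min 1 (c * H2 δ) * k) := by
  have trivial_bound : ((lightWords k t).card : ℝ) ≤ (2 : ℝ) ^ ((1 : ℝ) * k) := by
    rw [one_mul, Real.rpow_natCast]
    exact_mod_cast card_lightWords_le_two_pow k t
  rcases le_total 1 (c * H2 δ) with h | h
  · rwa [min_eq_left h]
  have hcδ : c * δ ≤ 1 / 2 := by nlinarith [two_mul_le_H2 h0 h1]
  rw [min_eq_right h]
  refine (card_lightWords_le_two_rpow (by positivity) hcδ ht).trans ?_
  gcongr
  · exact one_le_two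
  · exact H2_mul_le hc h0 (by linarith)

open MeasureTheory ProbabilityTheory

/-! ### Independent samples -/

section Independent

variable {ι α : Type*}

open Classical in
/-- The number of coordinates in `S` at which the sample `X` lies in `E`. -/
noncomputable def hits (S : Finset ι) (E : Set α) (X : ι → α) : ℕ :=
  (S.filter fun q => X q ∈ E).card

theorem hits_eq_zero_iff {S : Finset ι} {E : Set α} {X : ι → α} :
    hits S E X = 0 ↔ ∀ q ∈ S, X q ∈ Eᶜ := by
  simp only [hits, Finset.card_eq_zero, Finset.filter_eq_empty_iff, Set.mem_compl_iff]

theorem hits_add_hits_compl (S : Finset ι) (E : Set α) (X : ι → α) :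
    hits S E X + hits S Eᶜ X = S.card := by
  classical
  simp only [hits, Set.mem_compl_iff]
  convert Finset.card_filter_add_card_filter_not (s := S) fun q => X q ∈ E

theorem hits_congr {S : Finset ι} {X Y : ι → α} (h : ∀ q ∈ S, X q = Y q) (E : Set α) :
    hits S E X = hits S E Y := by
  classical exact congrArg Finset.card (Finset.filter_congr fun q hq => by rw [h q hq])

theorem cast_hits (S : Finset ι) (E : Set α) (X : ι → α) :
    (hits S E X : ℝ) = ∑ q ∈ S, E.indicator (fun _ => 1) (X q) := by
  classical simp only [hits, Set.indicator_apply, Finset.sum_boole]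

theorem exists_measurableSet_restrict_preimage [MeasurableSpace α] [Nonempty α] {S : Finset ι}
    {E : Set (ι → α)} (hE : MeasurableSet E) (hS : DependsOn (· ∈ E) S) :
    ∃ E' : Set (S → α), MeasurableSet E' ∧ (fun X i => X i) ⁻¹' E' = E := by
  classical
  obtain ⟨x₀⟩ := ‹Nonempty α›
  let extend : (S → α) → ι → α := fun z q => if h : q ∈ S then z ⟨q, h⟩ else x₀
  have extend_measurable : Measurable extend := by
    refine measurable_pi_lambda _ fun q => ?_
    by_cases h : q ∈ S <;> simp only [extend, h, dite_true, dite_false] <;> fun_prop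
  refine ⟨extend ⁻¹' E, extend_measurable hE, Set.ext fun X => ?_⟩
  have agree : ∀ q ∈ (S : Set ι), extend (fun i => X i) q = X q := fun q hq => dif_pos hq
  exact (hS agree).to_iff

variable [MeasurableSpace α] (ν : Measure α) [IsProbabilityMeasure ν] [Fintype ι]

theorem measureReal_pi_forall_mem (S : Finset ι) (E : Set α) :
    (Measure.pi fun _ : ι => ν).real {X | ∀ q ∈ S, X q ∈ E} = ν.real E ^ S.card := by
  classical
  have hset : {X : ι → α | ∀ q ∈ S, X q ∈ E} =
      Set.univ.pi fun q => if q ∈ S then E else Set.univ := by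
    ext X
    simp only [Set.mem_ofPred_eq, Set.mem_pi, Set.mem_univ, true_imp_iff]
    refine forall_congr' fun q => ?_
    split_ifs with hq <;> simp [hq]
  have factor (q : ι) : (ν (if q ∈ S then E else Set.univ)).toReal =
      if q ∈ S then ν.real E else 1 := by
    split <;> simp [measureReal_def]
  rw [hset, measureReal_def, Measure.pi_pi, ENNReal.toReal_prod]
  simp only [factor, Finset.prod_ite_mem, Finset.univ_inter, Finset.prod_const]

theorem measureReal_pi_inter_of_disjoint {S T : Finset ι} (hST : Disjoint S T)
    {E F : Set (ι → α)} (hE : MeasurableSet E) (hF : MeasurableSet F)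
    (hES : DependsOn (· ∈ E) S) (hFT : DependsOn (· ∈ F) T) :
    (Measure.pi fun _ : ι => ν).real (E ∩ F) =
      (Measure.pi fun _ : ι => ν).real E * (Measure.pi fun _ : ι => ν).real F := by
  have := ν.nonempty_of_neZero
  obtain ⟨E', hE', rfl⟩ := exists_measurableSet_restrict_preimage hE hES
  obtain ⟨F', hF', rfl⟩ := exists_measurableSet_restrict_preimage hF hFT
  have indep := (iIndepFun_pi (μ := fun _ : ι => ν) (X := fun _ x => x)
    fun _ => aemeasurable_id).indepFun_finset S T hST fun i => measurable_pi_apply i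
  simpa only [measureReal_def, ENNReal.toReal_mul] using
    congrArg ENNReal.toReal (indep.measure_inter_preimage_eq_mul E' F' hE' hF')

variable {E : Set α} (hE : MeasurableSet E)
include hE

theorem integrable_indicator_eval (q : ι) :
    Integrable (fun X : ι → α => E.indicator (fun _ => (1 : ℝ)) (X q))
      (Measure.pi fun _ => ν) :=
  (integrable_const (1 : ℝ)).indicator (measurable_pi_apply q hE)

theorem integral_indicator_eval (q : ι) :
    ∫ X, E.indicator (fun _ => (1 : ℝ)) (X q) ∂(Measure.pi fun _ : ι => ν) = ν.real E := by
  have h := (measurePreserving_eval (fun _ : ι => ν) q).measureReal_preimage hE.nullMeasurableSet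
  rw [← h, ← integral_indicator_one (measurable_pi_apply q hE)]
  rfl

theorem mul_measureReal_le_hits_le (S : Finset ι) (c : ℝ) :
    c * (Measure.pi fun _ : ι => ν).real {X | c ≤ hits S E X} ≤ S.card * ν.real E := by
  have markov := mul_meas_ge_le_integral_of_nonneg (μ := Measure.pi fun _ : ι => ν)
    (f := fun X => ∑ q ∈ S, E.indicator (fun _ => (1 : ℝ)) (X q))
    (Filter.Eventually.of_forall fun X => Finset.sum_nonneg fun q _ =>
      Set.indicator_nonneg (fun _ _ => zero_le_one) _)
    (integrable_finsetSum _ fun q _ => integrable_indicator_eval ν hE q) c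
  rw [integral_finsetSum _ fun q _ => integrable_indicator_eval ν hE q] at markov
  simpa only [← cast_hits, integral_indicator_eval ν hE, Finset.sum_const, nsmul_eq_mul]
    using markov

theorem measureReal_add_le_hits_le_exp (S : Finset ι) {ε : ℝ} (hε : 0 ≤ ε) :
    (Measure.pi fun _ : ι => ν).real {X | S.card * ν.real E + ε ≤ hits S E X}
      ≤ Real.exp (-2 * ε ^ 2 / S.card) := by
  set μ := Measure.pi fun _ : ι => ν
  set Y : ι → (ι → α) → ℝ := fun q X => E.indicator (fun _ => (1 : ℝ)) (X q) - ν.real E with hY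
  have indicator_measurable : Measurable (E.indicator fun _ => (1 : ℝ)) :=
    measurable_const.indicator hE
  have indep : iIndepFun Y μ :=
    iIndepFun_pi (μ := fun _ : ι => ν)
      (X := fun _ x => E.indicator (fun _ => (1 : ℝ)) x - ν.real E)
      fun _ => (indicator_measurable.sub_const _).aemeasurable
  have subgaussian : ∀ q ∈ S, HasSubgaussianMGF (Y q) ((‖(1 : ℝ) - 0‖₊ / 2) ^ 2) μ := by
    intro q _
    have := hasSubgaussianMGF_of_mem_Icc (μ := μ) (a := 0) (b := 1)
      (X := fun X => E.indicator (fun _ => (1 : ℝ)) (X q))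
      (indicator_measurable.comp (measurable_pi_apply q)).aemeasurable
      (Filter.Eventually.of_forall fun X => by by_cases h : X q ∈ E <;> simp [h])
    simpa only [μ, integral_indicator_eval ν hE] using this
  have hset : {X | S.card * ν.real E + ε ≤ hits S E X} = {X | ε ≤ ∑ q ∈ S, Y q X} := by
    ext X
    simp only [hY, Finset.sum_sub_distrib, ← cast_hits, Finset.sum_const, nsmul_eq_mul,
      Set.mem_ofPred_eq, le_sub_iff_add_le']
  rw [hset]
  refine (HasSubgaussianMGF.measure_sum_ge_le_of_iIndepFun indep subgaussian hε).trans_eq ?_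
  congr 1
  simp only [sub_zero, nnnorm_one, Finset.sum_const, nsmul_eq_mul, NNReal.coe_mul,
    NNReal.coe_natCast, NNReal.coe_pow, NNReal.coe_div, NNReal.coe_one, NNReal.coe_ofNat]
  rcases eq_or_ne (S.card : ℝ) 0 with h0 | h0
  · simp [h0]
  · field_simp

theorem measureReal_hits_add_le_le_exp (S : Finset ι) {ε : ℝ} (hε : 0 ≤ ε) :
    (Measure.pi fun _ : ι => ν).real {X | hits S E X + ε ≤ S.card * ν.real E}
      ≤ Real.exp (-2 * ε ^ 2 / S.card) := by
  refine le_of_eq_of_le ?_ (measureReal_add_le_hits_le_exp ν hE.compl S hε)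
  congr 1
  ext X
  have split : (hits S E X : ℝ) + hits S Eᶜ X = S.card := by
    exact_mod_cast hits_add_hits_compl S E X
  simp only [Set.mem_ofPred_eq, probReal_compl_eq_one_sub hE]
  constructor <;> intro h <;> linarith

end Independent

/-! ### The law of an instance -/

theorem isProbabilityMeasure_bitLaw {ρ : ℝ} (h0 : 0 ≤ ρ) (h1 : ρ ≤ 1) :
    IsProbabilityMeasure (bitLaw ρ) := by
  refine ⟨?_⟩
  simp only [bitLaw, Measure.coe_add, Measure.coe_smul, Pi.add_apply, Pi.smul_apply,
    measure_univ, smul_eq_mul, mul_one]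
  rw [← ENNReal.ofReal_add (by linarith) (by linarith), ENNReal.ofReal_eq_one]
  ring

instance : IsProbabilityMeasure (bitLaw 0) := isProbabilityMeasure_bitLaw le_rfl zero_le_one

theorem isProbabilityMeasure_columnLaw {ρ : ℝ} (h0 : 0 ≤ ρ) (h1 : ρ ≤ 1) {n : ℕ} (a b : Fin n) :
    IsProbabilityMeasure (columnLaw ρ a b) := by
  have := isProbabilityMeasure_bitLaw h0 h1
  exact Measure.isProbabilityMeasure_map Measurable.of_discrete.aemeasurable

theorem isProbabilityMeasure_instanceLaw {ρ : ℝ} (h0 : 0 ≤ ρ) (h1 : ρ ≤ 1) {n : ℕ} (a b : Fin n)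
    (L : ℕ) : IsProbabilityMeasure (instanceLaw ρ a b L) := by
  have := isProbabilityMeasure_columnLaw h0 h1 a b
  unfold instanceLaw
  infer_instance

/-- The event that the bits of the strings `i` and `j` at one position differ. -/
def differ {n : ℕ} (i j : Fin n) : Set (Fin n → Bool) := {x | x i ≠ x j}

theorem differ_comm {n : ℕ} (i j : Fin n) : differ i j = differ j i :=
  Set.ext fun _ => ne_comm

theorem columnLaw_real_differ_pair {ρ : ℝ} (h0 : 0 ≤ ρ) (h1 : ρ ≤ 1) {n : ℕ} {a b : Fin n}
    (hab : a ≠ b) : (columnLaw ρ a b).real (differ a b) = (1 - ρ) / 2 := by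
  have := isProbabilityMeasure_bitLaw h0 h1
  have flipped : (fun p : (Fin n → Bool) × Bool => Function.update p.1 b (xor (p.1 a) p.2)) ⁻¹'
      differ a b = Set.univ ×ˢ {true} := by
    ext ⟨x, y⟩
    cases hx : x a <;> cases y <;> simp [differ, hab, hx]
  rw [columnLaw, map_measureReal_apply .of_discrete .of_discrete, flipped, measureReal_def,
    Measure.prod_prod, measure_univ, one_mul]
  simp [bitLaw, ENNReal.toReal_ofReal (show 0 ≤ (1 - ρ) / 2 by linarith)]

theorem measurePreserving_not : MeasurePreserving Bool.not (bitLaw 0) (bitLaw 0) := by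
  refine ⟨Measurable.of_discrete, ?_⟩
  simp [bitLaw, Measure.map_add _ _ Measurable.of_discrete, Measure.map_dirac, add_comm]

theorem measurePreserving_flip {n : ℕ} (j : Fin n) :
    MeasurePreserving (fun x : Fin n → Bool => Function.update x j (!x j))
      (Measure.pi fun _ => bitLaw 0) (Measure.pi fun _ => bitLaw 0) := by
  have h := measurePreserving_pi (fun _ : Fin n => bitLaw 0) (fun _ => bitLaw 0)
    (f := fun l => if l = j then Bool.not else id) fun l => by
      split_ifs
      exacts [measurePreserving_not, MeasurePreserving.id _]
  convert h using 1
  funext x l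
  by_cases hl : l = j
  · subst hl; simp
  · simp [hl]

theorem measureReal_eq_half_of_preimage_eq_compl {Ω : Type*} [MeasurableSpace Ω] {μ : Measure Ω}
    [IsProbabilityMeasure μ] {T : Ω → Ω} (hT : MeasurePreserving T μ μ) {E : Set Ω}
    (hE : MeasurableSet E) (h : T ⁻¹' E = Eᶜ) : μ.real E = 1 / 2 := by
  have compl := probReal_compl_eq_one_sub (μ := μ) hE
  rw [← h, hT.measureReal_preimage hE.nullMeasurableSet] at compl
  linarith

theorem columnLaw_real_differ_of_ne {ρ : ℝ} (h0 : 0 ≤ ρ) (h1 : ρ ≤ 1) {n : ℕ} {a b i j : Fin n}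
    (hij : i ≠ j) (hjb : j ≠ b) (hib : i = b → j ≠ a) :
    (columnLaw ρ a b).real (differ i j) = 1 / 2 := by
  have := isProbabilityMeasure_bitLaw h0 h1
  rw [columnLaw, map_measureReal_apply .of_discrete .of_discrete]
  refine measureReal_eq_half_of_preimage_eq_compl
    ((measurePreserving_flip j).prod (MeasurePreserving.id (bitLaw ρ))) .of_discrete ?_
  ext ⟨x, y⟩
  simp only [differ, Set.mem_preimage, Prod.map_apply, Set.mem_ofPred_eq, id_eq,
    Set.mem_compl_iff, Function.update_apply, hjb, if_false, if_true]
  by_cases hi : i = b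
  · simp only [hi, if_true, (hib hi).symm, if_false]
    cases x a <;> cases x j <;> cases y <;> decide
  · simp only [hi, if_false, hij]
    cases x i <;> cases x j <;> decide

theorem columnLaw_real_differ_other {ρ : ℝ} (h0 : 0 ≤ ρ) (h1 : ρ ≤ 1) {n : ℕ} {a b i j : Fin n}
    (hij : i ≠ j) (h : ¬ (i = a ∧ j = b ∨ i = b ∧ j = a)) :
    (columnLaw ρ a b).real (differ i j) = 1 / 2 := by
  by_cases hjb : j = b
  · rw [differ_comm]
    exact columnLaw_real_differ_of_ne h0 h1 hij.symm (fun h' => hij (h'.trans hjb.symm))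
      fun _ h' => h (Or.inl ⟨h', hjb⟩)
  · exact columnLaw_real_differ_of_ne h0 h1 hij hjb fun hi hj => h (Or.inr ⟨hi, hj⟩)

/-! ### A program logic with costs -/

infixr:60 ";;" => Cmd.seq

@[simp] theorem State.reg_setReg (s : State) (r v x : ℕ) :
    (s.setReg r v).reg x = if x = r then v else s.reg x := by
  simp only [State.setReg, Function.update_apply]

@[simp] theorem State.mem_setReg (s : State) (r v : ℕ) : (s.setReg r v).mem = s.mem := rfl

@[simp] theorem State.reg_setMem (s : State) (a v : ℕ) : (s.setMem a v).reg = s.reg := rfl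

theorem State.mem_setMem (s : State) (a v x : ℕ) :
    (s.setMem a v).mem x = if x = a then v else s.mem x := by
  simp only [State.setMem, Function.update_apply]

/-- Whether `c` contains an instruction that writes to the register `x`. -/
def Cmd.writes (x : ℕ) : Cmd → Bool
  | .const r _ | .arith _ r _ _ | .load r _ | .read r _ _ => x == r
  | .store _ _ => false
  | .seq c₁ c₂ | .ite _ c₁ c₂ => c₁.writes x || c₂.writes x
  | .loop _ c => c.writes x

/-- Whether `c` contains an instruction that writes to the memory. -/
def Cmd.stores : Cmd → Bool
  | .const _ _ | .arith _ _ _ _ | .load _ _ | .read _ _ _ => false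
  | .store _ _ => true
  | .seq c₁ c₂ | .ite _ c₁ c₂ => c₁.stores || c₂.stores
  | .loop _ c => c.stores

/-- `s'` differs from `s` only where `c` can write. -/
structure Frame (c : Cmd) (s s' : State) : Prop where
  reg : ∀ x, c.writes x = false → s'.reg x = s.reg x
  mem : c.stores = false → s'.mem = s.mem

/-- All registers and memory cells hold numbers of at most `B` bits. -/
structure Bounded (B : ℕ) (s : State) : Prop where
  reg : ∀ r, s.reg r < 2 ^ B
  mem : ∀ a, s.mem a < 2 ^ B

/-- From the state `s`, if it is `B`-bounded, the program `c` halts after at most `T` elementary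
steps on numbers of at most `B` bits, in a `B`-bounded state that satisfies `Q`. -/
def Runs (B : ℕ) (inp : ℕ → ℕ → ℕ) (c : Cmd) (s : State) (T : ℕ) (Q : State → Prop) : Prop :=
  Bounded B s → ∃ (t : ℕ) (s' : State),
    Exec inp c s t s' ∧ t ≤ T * (2 * B + 1) ∧ Bounded B s' ∧ Q s'

section

variable {B : ℕ} {inp : ℕ → ℕ → ℕ} {c c₁ c₂ : Cmd} {s s' s'' : State} {T T' T₁ T₂ : ℕ}
  {Q Q' R : State → Prop}

theorem Bounded.setReg (h : Bounded B s) (r : ℕ) {v : ℕ} (hv : v < 2 ^ B) :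
    Bounded B (s.setReg r v) :=
  ⟨fun x => by rw [State.reg_setReg]; split <;> [exact hv; exact h.reg x], h.mem⟩

theorem Bounded.setMem (h : Bounded B s) (a : ℕ) {v : ℕ} (hv : v < 2 ^ B) :
    Bounded B (s.setMem a v) :=
  ⟨h.reg, fun x => by rw [State.mem_setMem]; split <;> [exact hv; exact h.mem x]⟩

theorem Frame.refl (c : Cmd) (s : State) : Frame c s s := ⟨fun _ _ => rfl, fun _ => rfl⟩

theorem Frame.trans (h : Frame c s s') (h' : Frame c s' s'') : Frame c s s'' :=
  ⟨fun x hx => (h'.reg x hx).trans (h.reg x hx), fun hc => (h'.mem hc).trans (h.mem hc)⟩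

theorem Frame.seq_left (h : Frame c₁ s s') : Frame (c₁ ;; c₂) s s' :=
  ⟨fun x hx => h.reg x (Bool.or_eq_false_iff.1 hx).1,
    fun hc => h.mem (Bool.or_eq_false_iff.1 hc).1⟩

theorem Frame.seq_right (h : Frame c₂ s s') : Frame (c₁ ;; c₂) s s' :=
  ⟨fun x hx => h.reg x (Bool.or_eq_false_iff.1 hx).2,
    fun hc => h.mem (Bool.or_eq_false_iff.1 hc).2⟩

theorem Frame.ite_left {r : ℕ} (h : Frame c₁ s s') : Frame (.ite r c₁ c₂) s s' :=
  ⟨h.seq_left (c₂ := c₂).reg, h.seq_left (c₂ := c₂).mem⟩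

theorem Frame.ite_right {r : ℕ} (h : Frame c₂ s s') : Frame (.ite r c₁ c₂) s s' :=
  ⟨h.seq_right (c₁ := c₁).reg, h.seq_right (c₁ := c₁).mem⟩

theorem Frame.loop {r : ℕ} (h : Frame c s s') : Frame (.loop r c) s s' := ⟨h.reg, h.mem⟩

theorem Exec.frame {t : ℕ} (h : Exec inp c s t s') : Frame c s s' := by
  induction h with
  | const | arith | load | read => exact ⟨fun x hx => by simp_all [Cmd.writes], fun _ => rfl⟩
  | store => exact ⟨fun _ _ => rfl, fun h => by simp [Cmd.stores] at h⟩
  | seq _ _ ih₁ ih₂ => exact ih₁.seq_left.trans ih₂.seq_right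
  | ite_true _ _ ih => exact ih.ite_left
  | ite_false _ _ ih => exact ih.ite_right
  | loop_done => exact .refl _ _
  | loop_step _ _ _ ih₁ ih₂ => exact ih₁.loop.trans ih₂

theorem Runs.mono (h : Runs B inp c s T Q) (hT : T ≤ T')
    (hQ : ∀ s', Frame c s s' → Q s' → Q' s') : Runs B inp c s T' Q' := fun hs => by
  obtain ⟨t, s', he, ht, hb, hq⟩ := h hs
  exact ⟨t, s', he, ht.trans (Nat.mul_le_mul_right _ hT), hb, hQ s' he.frame hq⟩

theorem Runs.mono_steps (h : Runs B inp c s T Q) (hT : T ≤ T') : Runs B inp c s T' Q :=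
  h.mono hT fun _ _ hQ => hQ

theorem Runs.seq (h₁ : Runs B inp c₁ s T₁ R)
    (h₂ : ∀ s', Frame c₁ s s' → R s' → Runs B inp c₂ s' T₂ Q) :
    Runs B inp (c₁ ;; c₂) s (T₁ + T₂) Q := fun hs => by
  obtain ⟨t, s', he, ht, hb, hq⟩ := h₁ hs
  obtain ⟨t', s'', he', ht', hb', hq'⟩ := h₂ s' he.frame hq hb
  exact ⟨t + t', s'', .seq he he', by rw [add_mul]; omega, hb', hq'⟩

theorem Runs.ite {r : ℕ} (h₁ : s.reg r ≠ 0 → Runs B inp c₁ s T Q)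
    (h₂ : s.reg r = 0 → Runs B inp c₂ s T Q) :
    Runs B inp (.ite r c₁ c₂) s (T + 1) Q := fun hs => by
  have hsize : (s.reg r).size ≤ B := Nat.size_le.2 (hs.reg r)
  by_cases h : s.reg r = 0
  · obtain ⟨t, s', he, ht, hb, hq⟩ := h₂ h hs
    exact ⟨_, s', .ite_false h he, by rw [add_mul]; omega, hb, hq⟩
  · obtain ⟨t, s', he, ht, hb, hq⟩ := h₁ h hs
    exact ⟨_, s', .ite_true h he, by rw [add_mul]; omega, hb, hq⟩

theorem Runs.loop {r : ℕ} (I : ℕ → State → Prop) (h0 : ∀ s, I 0 s → s.reg r = 0)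
    (hstep : ∀ v s, I (v + 1) s → s.reg r ≠ 0 ∧ Runs B inp c s T (I v)) (N : ℕ) :
    ∀ s, I N s → Runs B inp (.loop r c) s (N * (T + 1) + 1) (I 0) := by
  induction N with
  | zero =>
    intro s hI hs
    have hsize : (s.reg r).size ≤ B := Nat.size_le.2 (hs.reg r)
    exact ⟨_, s, .loop_done (h0 s hI), by omega, hs, hI⟩
  | succ N ih =>
    intro s hI hs
    have hsize : (s.reg r).size ≤ B := Nat.size_le.2 (hs.reg r)
    obtain ⟨hr, h⟩ := hstep N s hI
    obtain ⟨t, s', he, ht, hb, hq⟩ := h hs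
    obtain ⟨t', s'', he', ht', hb', hq'⟩ := ih s' hq hb
    refine ⟨_, s'', .loop_step hr he he', ?_, hb', hq'⟩
    have : ((N + 1) * (T + 1) + 1) * (2 * B + 1)
        = (N * (T + 1) + 1) * (2 * B + 1) + T * (2 * B + 1) + (2 * B + 1) := by ring
    omega

/-- The effect of a loop-free program. -/
def Cmd.eval (inp : ℕ → ℕ → ℕ) : Cmd → State → State
  | .const r k, s => s.setReg r k
  | .arith o r a b, s => s.setReg r (o.eval (s.reg a) (s.reg b))
  | .load r a, s => s.setReg r (s.mem (s.reg a))
  | .store a r, s => s.setMem (s.reg a) (s.reg r)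
  | .read r i k, s => s.setReg r (inp (s.reg i) (s.reg k))
  | .seq c₁ c₂, s => c₂.eval inp (c₁.eval inp s)
  | .ite r c₁ c₂, s => if s.reg r = 0 then c₂.eval inp s else c₁.eval inp s
  | .loop _ _, s => s

/-- The number of steps of a loop-free program. -/
def Cmd.steps : Cmd → ℕ
  | .seq c₁ c₂ => c₁.steps + c₂.steps
  | .ite _ c₁ c₂ => max c₁.steps c₂.steps + 1
  | .loop _ _ => 0
  | _ => 1

/-- The program is loop-free and keeps every number below `2 ^ B`. -/
def Cmd.Safe (B : ℕ) (inp : ℕ → ℕ → ℕ) : Cmd → State → Prop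
  | .const _ k, _ => k < 2 ^ B
  | .arith .add _ a b, s => s.reg a + s.reg b < 2 ^ B
  | .arith .mul _ a b, s => s.reg a * s.reg b < 2 ^ B
  | .read _ i k, s => inp (s.reg i) (s.reg k) < 2 ^ B
  | .seq c₁ c₂, s => c₁.Safe B inp s ∧ c₂.Safe B inp (c₁.eval inp s)
  | .ite r c₁ c₂, s => (s.reg r ≠ 0 → c₁.Safe B inp s) ∧ (s.reg r = 0 → c₂.Safe B inp s)
  | .loop _ _, _ => False
  | _, _ => True

theorem runs_eval (c : Cmd) : ∀ s, c.Safe B inp s →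
    Runs B inp c s c.steps fun s' => s' = c.eval inp s := by
  induction c with
  | const r k =>
    intro s h hs
    have := Nat.size_le.2 h
    exact ⟨_, _, .const s r k, by simp only [Cmd.steps]; omega, hs.setReg r h, rfl⟩
  | arith o r a b =>
    intro s h hs
    have ha := Nat.size_le.2 (hs.reg a)
    have hb := Nat.size_le.2 (hs.reg b)
    refine ⟨_, _, .arith s o r a b, by simp only [Cmd.steps]; omega, hs.setReg r ?_, rfl⟩
    cases o with
    | add => exact h
    | mul => exact h
    | sub => exact (Nat.sub_le _ _).trans_lt (hs.reg a)
    | div => exact (Nat.div_le_self _ _).trans_lt (hs.reg a)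
  | load r a =>
    intro s _ hs
    have ha := Nat.size_le.2 (hs.reg a)
    have hb := Nat.size_le.2 (hs.mem (s.reg a))
    exact ⟨_, _, .load s r a, by simp only [Cmd.steps]; omega, hs.setReg r (hs.mem _), rfl⟩
  | store a r =>
    intro s _ hs
    have ha := Nat.size_le.2 (hs.reg a)
    have hb := Nat.size_le.2 (hs.reg r)
    exact ⟨_, _, .store s a r, by simp only [Cmd.steps]; omega, hs.setMem _ (hs.reg _), rfl⟩
  | read r i k =>
    intro s h hs
    have ha := Nat.size_le.2 (hs.reg i)
    have hb := Nat.size_le.2 (hs.reg k)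
    exact ⟨_, _, .read s r i k, by simp only [Cmd.steps]; omega, hs.setReg _ h, rfl⟩
  | seq c₁ c₂ ih₁ ih₂ =>
    rintro s ⟨h₁, h₂⟩
    exact (ih₁ s h₁).seq fun s' _ hs' => hs' ▸ ih₂ _ h₂
  | ite r c₁ c₂ ih₁ ih₂ =>
    rintro s ⟨h₁, h₂⟩
    refine Runs.ite (fun h0 => ?_) (fun h0 => ?_)
    · exact (ih₁ s (h₁ h0)).mono (le_max_left _ _) fun s' _ hs' => by simp [Cmd.eval, h0, hs']
    · exact (ih₂ s (h₂ h0)).mono (le_max_right _ _) fun s' _ hs' => by simp [Cmd.eval, h0, hs']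
  | loop r c => exact fun s h => h.elim

theorem Runs.of_eval (hT : c.steps ≤ T) (hsafe : Bounded B s → c.Safe B inp s)
    (hQ : Q (c.eval inp s)) : Runs B inp c s T Q :=
  fun hs => (runs_eval c s (hsafe hs)).mono hT (fun _ _ h => h ▸ hQ) hs

theorem Runs.eval_seq (hT : c₁.steps ≤ T₁) (hsafe : Bounded B s → c₁.Safe B inp s)
    (h : Frame c₁ s (c₁.eval inp s) → Runs B inp c₂ (c₁.eval inp s) T₂ Q) :
    Runs B inp (c₁ ;; c₂) s (T₁ + T₂) Q :=
  (Runs.of_eval (Q := (· = c₁.eval inp s)) hT hsafe rfl).seq fun _ hF hs => hs ▸ h (hs ▸ hF)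

end

/-! ### Counting loops -/

namespace Reg

/-- The register that holds constants for a moment. -/
@[simp] abbrev tmp : ℕ := 99

end Reg

/-- Decrement the register `r`, or leave it at zero. -/
def decr (r : ℕ) : Cmd := .const Reg.tmp 1 ;; .arith .sub r r Reg.tmp

/-- Increment the register `r`. -/
def incr (r : ℕ) : Cmd := .const Reg.tmp 1 ;; .arith .add r r Reg.tmp

/-- Copy the register `a` to the register `r`. -/
def move (r a : ℕ) : Cmd := .const Reg.tmp 0 ;; .arith .add r a Reg.tmp

/-- Run `c` with the values `N - 1, …, 0` in the register `r`, which holds `N` at first. -/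
def countdown (r : ℕ) (c : Cmd) : Cmd := .loop r (decr r ;; c)

section

variable {B : ℕ} {inp : ℕ → ℕ → ℕ} {c c₁ : Cmd} {s : State} {T T₁ : ℕ}

theorem runs_decr {r v : ℕ} (hB : B ≠ 0) (hr : r ≠ Reg.tmp) (hv : s.reg r = v + 1) :
    Runs B inp (decr r) s 2 fun s' => s' = (s.setReg Reg.tmp 1).setReg r v :=
  Runs.of_eval le_rfl (fun _ => ⟨Nat.one_lt_two_pow hB, trivial⟩)
    (by simp_all [decr, Cmd.eval, Op.eval])

theorem Runs.countdown {r N : ℕ} (I : ℕ → State → Prop) (hB : B ≠ 0)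
    (hw : c.writes r = false) (hr : r ≠ Reg.tmp) (hN : s.reg r = N) (h0 : I 0 s)
    (hI : ∀ j s u, I j s → I j ((s.setReg Reg.tmp 1).setReg r u))
    (hc : ∀ j < N, ∀ s', Frame (countdown r c) s s' → s'.reg r = N - (j + 1) → I j s' →
      Runs B inp c s' T (I (j + 1))) :
    Runs B inp (countdown r c) s (N * (T + 3) + 1) (I N) := by
  refine (Runs.loop (T := 2 + T) (fun v s' => v ≤ N ∧ s'.reg r = v ∧ I (N - v) s' ∧
    Frame (LightBulb.countdown r c) s s') (fun _ h => h.2.1) ?_ N s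
    ⟨le_rfl, hN, by rwa [Nat.sub_self], .refl _ _⟩).mono (by ring_nf; omega)
    fun s' _ h => h.2.2.1
  rintro v s' ⟨hv, hrv, hIv, hF⟩
  refine ⟨by omega, (runs_decr hB hr hrv).seq ?_⟩
  rintro _ hF₁ rfl
  have hF' := hF.trans hF₁.seq_left.loop
  refine (hc (N - (v + 1)) (by omega) _ hF' (by rw [State.reg_setReg, if_pos rfl]; omega)
    (hI _ _ _ hIv)).mono le_rfl fun s'' hF₂ h => ⟨by omega, ?_, ?_, hF'.trans hF₂.seq_right.loop⟩
  · rw [hF₂.reg r hw, State.reg_setReg, if_pos rfl]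
  · rwa [show N - v = N - (v + 1) + 1 by omega]

theorem Runs.eval_countdown {r N : ℕ} (I : ℕ → State → Prop) (hB : B ≠ 0)
    (hT : c₁.steps ≤ T₁) (hsafe : Bounded B s → c₁.Safe B inp s)
    (hw : c.writes r = false) (hr : r ≠ Reg.tmp) (hN : (c₁.eval inp s).reg r = N)
    (h0 : I 0 (c₁.eval inp s)) (hI : ∀ j s u, I j s → I j ((s.setReg Reg.tmp 1).setReg r u))
    (hc : ∀ j < N, ∀ s', Frame (c₁ ;; LightBulb.countdown r c) s s' → s'.reg r = N - (j + 1) →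
      I j s' → Runs B inp c s' T (I (j + 1))) :
    Runs B inp (c₁ ;; LightBulb.countdown r c) s (T₁ + (N * (T + 3) + 1)) (I N) :=
  Runs.eval_seq hT hsafe fun hF => Runs.countdown I hB hw hr hN h0 hI fun j hj s' hF' =>
    hc j hj s' (hF.seq_left.trans hF'.seq_right)

end

/-! ### Subroutines -/

namespace Reg

/-! The subroutines work in registers from `40` on; their arguments stand below. -/

@[simp] abbrev xorLeft : ℕ := 40
@[simp] abbrev xorRight : ℕ := 41
@[simp] abbrev xorCount : ℕ := 42
@[simp] abbrev xor : ℕ := 43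
@[simp] abbrev weight : ℕ := 44
@[simp] abbrev place : ℕ := 45
@[simp] abbrev digit : ℕ := 46
@[simp] abbrev twiceHalf : ℕ := 47
@[simp] abbrev position : ℕ := 51
@[simp] abbrev bits : ℕ := 52
@[simp] abbrev bit : ℕ := 54
@[simp] abbrev bitCount : ℕ := 55
@[simp] abbrev powCount : ℕ := 60

end Reg

theorem four_mul_two_pow_le {K B : ℕ} (h : K + 2 ≤ B) : 4 * 2 ^ K ≤ 2 ^ B := by
  exact (pow_add 2 2 K).symm.trans_le (Nat.pow_le_pow_right two_pos (by omega))

/-- Process the last binary digits of the words in `Reg.xorLeft` and `Reg.xorRight`, and remove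
them. -/
def xorStep : Cmd :=
  .arith .add Reg.digit Reg.xorLeft Reg.xorRight ;; .const Reg.tmp 2 ;;
  .arith .div Reg.twiceHalf Reg.digit Reg.tmp ;;
  .arith .add Reg.twiceHalf Reg.twiceHalf Reg.twiceHalf ;;
  .arith .sub Reg.digit Reg.digit Reg.twiceHalf ;;
  .arith .add Reg.weight Reg.weight Reg.digit ;;
  .arith .mul Reg.digit Reg.digit Reg.place ;; .arith .add Reg.xor Reg.xor Reg.digit ;;
  .arith .add Reg.place Reg.place Reg.place ;;
  .arith .div Reg.xorLeft Reg.xorLeft Reg.tmp ;; .arith .div Reg.xorRight Reg.xorRight Reg.tmp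

/-- The exclusive or of the words of length `k` in the registers `a` and `b` is put into `Reg.xor`,
and its weight into `Reg.weight`; the length is read from the register `k`. -/
def xorWeight (a b k : ℕ) : Cmd :=
  (move Reg.xorLeft a ;; move Reg.xorRight b ;; move Reg.xorCount k ;; .const Reg.xor 0 ;;
    .const Reg.weight 0 ;; .const Reg.place 1) ;;
  countdown Reg.xorCount xorStep

/-- The invariant of `xorWeight`: the last `j` digits of `x` and `y` have been processed. -/
def XorInvariant (x y j : ℕ) (s : State) : Prop :=
  s.reg Reg.xorLeft = x / 2 ^ j ∧ s.reg Reg.xorRight = y / 2 ^ j ∧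
    s.reg Reg.xor = (x ^^^ y) % 2 ^ j ∧ s.reg Reg.weight = wt j (x ^^^ y) ∧
    s.reg Reg.place = 2 ^ j

/-- Put the bit of the string in the register `a` at the position `o + Reg.bitCount` in front of
the binary digits in `Reg.bits`. -/
def readStep (a o : ℕ) : Cmd :=
  .arith .add Reg.position o Reg.bitCount ;; .read Reg.bit a Reg.position ;;
  .arith .add Reg.bits Reg.bits Reg.bits ;; .arith .add Reg.bits Reg.bits Reg.bit

/-- Read the `k` bits from the position `o` on of the string `a`, all given by registers, and put
the number with these binary digits into `Reg.bits`. -/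
def readWord (a o k : ℕ) : Cmd :=
  (move Reg.bitCount k ;; .const Reg.bits 0) ;; countdown Reg.bitCount (readStep a o)

/-- Put two to the power that the register `a` holds into the register `r`. -/
def powTwo (r a : ℕ) : Cmd :=
  (move Reg.powCount a ;; .const r 1) ;; countdown Reg.powCount (.arith .add r r r)

section

variable {B : ℕ} {inp : ℕ → ℕ → ℕ} {s : State}

theorem runs_xorStep {x y j K : ℕ} (hj : j < K) (hx : x < 2 ^ K) (hy : y < 2 ^ K)
    (hB : K + 2 ≤ B) (h : XorInvariant x y j s) :
    Runs B inp xorStep s 11 (XorInvariant x y (j + 1)) := by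
  obtain ⟨h_left, h_right, h_xor, h_weight, h_place⟩ := h
  have digit_eq : (x / 2 ^ j + y / 2 ^ j) -
      ((x / 2 ^ j + y / 2 ^ j) / 2 + (x / 2 ^ j + y / 2 ^ j) / 2) = (x ^^^ y) / 2 ^ j % 2 := by
    rw [xor_div_two_pow_mod_two]
    omega
  refine Runs.of_eval le_rfl (fun _ => ?_) ?_
  · have hx' := (Nat.div_le_self x (2 ^ j)).trans_lt hx
    have hy' := (Nat.div_le_self y (2 ^ j)).trans_lt hy
    have hpow : 2 * 2 ^ j ≤ 2 ^ K := (pow_succ' 2 j).ge.trans (Nat.pow_le_pow_right two_pos hj)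
    have hdigit : (x ^^^ y) / 2 ^ j % 2 ≤ 1 := by omega
    have := Nat.mul_le_mul_right (2 ^ j) hdigit
    have := Nat.mod_lt (x ^^^ y) (Nat.two_pow_pos j)
    have := wt_le j (x ^^^ y)
    have := four_mul_two_pow_le hB
    have := Nat.lt_two_pow_self (n := K)
    simp [Cmd.Safe, xorStep, Cmd.eval, Op.eval, h_left, h_right, h_xor, h_weight, h_place,
      digit_eq]
    omega
  · have xor_succ := xor_mod_two_pow_succ x y j
    rw [pow_succ, mul_two] at xor_succ
    simp [XorInvariant, xorStep, Cmd.eval, Op.eval, h_left, h_right, h_xor, h_weight, h_place,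
      digit_eq, xor_succ, wt_succ, pow_succ, Nat.div_div_eq_div_mul, mul_two]

theorem runs_xorWeight {a b k K : ℕ} (ha : a < 40) (hb : b < 40) (hk : k < 40)
    (hK : s.reg k = K) (hx : s.reg a < 2 ^ K) (hy : s.reg b < 2 ^ K) (hB : K + 2 ≤ B) :
    Runs B inp (xorWeight a b k) s (14 * K + 10) fun s' =>
      s'.reg Reg.xor = s.reg a ^^^ s.reg b ∧ s'.reg Reg.weight = wt K (s.reg a ^^^ s.reg b) := by
  have ha' : a ≠ 99 ∧ a ≠ 40 ∧ a ≠ 41 ∧ a ≠ 42 := by omega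
  have hb' : b ≠ 99 ∧ b ≠ 40 ∧ b ≠ 41 ∧ b ≠ 42 := by omega
  have hk' : k ≠ 99 ∧ k ≠ 40 ∧ k ≠ 41 ∧ k ≠ 42 := by omega
  have := four_mul_two_pow_le hB
  have := Nat.lt_two_pow_self (n := K)
  refine (Runs.eval_countdown (T := 11) (N := K) (XorInvariant (s.reg a) (s.reg b)) (by omega)
    (le_refl 9) (fun _ => ?_) rfl (by decide) ?_ ?_ (fun j s u h => ?_)
    fun j hj s' _ _ h => runs_xorStep hj hx hy hB h).mono (by omega) ?_
  · simp [Cmd.Safe, move, Cmd.eval, Op.eval, ha', hb', hk', hK]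
    omega
  · simp [move, Cmd.eval, Op.eval, hk', hK]
  · simp [XorInvariant, move, Cmd.eval, Op.eval, ha', hb', Nat.mod_one, wt]
  · simpa [XorInvariant] using h
  · rintro s' - ⟨-, -, h_xor, h_weight, -⟩
    exact ⟨by rw [h_xor, Nat.mod_eq_of_lt (Nat.xor_lt_two_pow hx hy)], h_weight⟩

theorem runs_readStep {a o i off K j : ℕ} (hinp : ∀ i k, inp i k ≤ 1) (ha : a < 40)
    (hj : j < K) (hB : K + 2 ≤ B) (hoff : off + K < 2 ^ B) (hi : s.reg a = i)
    (ho' : s.reg o = off) (hcount : s.reg Reg.bitCount = K - (j + 1))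
    (h : s.reg Reg.bits = readBits inp i (off + (K - j)) j) :
    Runs B inp (readStep a o) s 4 fun s' =>
      s'.reg Reg.bits = readBits inp i (off + (K - (j + 1))) (j + 1) := by
  have ha' : a ≠ 51 ∧ a ≠ 52 ∧ a ≠ 54 := by omega
  have next : off + (K - (j + 1)) + 1 = off + (K - j) := by omega
  refine Runs.of_eval le_rfl (fun _ => ?_) ?_
  · have := hinp i (off + (K - (j + 1)))
    have hpow : 2 * 2 ^ j ≤ 2 ^ K := (pow_succ' 2 j).ge.trans (Nat.pow_le_pow_right two_pos hj)
    have := readBits_lt hinp i (off + (K - j)) j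
    have := four_mul_two_pow_le hB
    simp [Cmd.Safe, readStep, Cmd.eval, Op.eval, hi, ho', hcount, h, ha']
    omega
  · simp [readStep, Cmd.eval, Op.eval, readBits, hi, ho', hcount, h, ha', next]
    omega

theorem runs_readWord {a o k K : ℕ} (hinp : ∀ i k, inp i k ≤ 1)
    (ha : a < 40) (ho : o < 40) (hk : k < 40)
    (hK : s.reg k = K) (hB : K + 2 ≤ B) (hoB : s.reg o + K < 2 ^ B) :
    Runs B inp (readWord a o k) s (7 * K + 4) fun s' =>
      s'.reg Reg.bits = readBits inp (s.reg a) (s.reg o) K := by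
  have hk' : k ≠ 99 := by omega
  have frame : ∀ x < 40, (readWord a o k).writes x = false := fun x hx => by
    simp [readWord, move, countdown, decr, readStep, Cmd.writes]
    omega
  refine (Runs.eval_countdown (T := 4) (N := K)
    (fun j s' => s'.reg Reg.bits = readBits inp (s.reg a) (s.reg o + (K - j)) j) (by omega)
    (le_refl 3) (fun _ => ?_) rfl (by decide) ?_ ?_ (fun j s' u h => ?_) ?_).mono
    (by omega) fun s' _ h => by simpa using h
  · simp [Cmd.Safe, move, Cmd.eval, hk', hK]
    omega
  · simp [move, Cmd.eval, Op.eval, hk', hK]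
  · simp [move, Cmd.eval, readBits]
  · simpa using h
  · exact fun j hj s' hF hcount h => runs_readStep hinp ha hj hB hoB (hF.reg a (frame a ha))
      (hF.reg o (frame o ho)) hcount h

theorem runs_powTwo {r a K : ℕ} (ha : a < 40) (hr : r < 40) (hK : s.reg a = K) (hB : K + 2 ≤ B) :
    Runs B inp (powTwo r a) s (4 * K + 4) fun s' => s'.reg r = 2 ^ K := by
  have ha' : a ≠ 99 ∧ a ≠ 60 := by omega
  have hr' : r ≠ 99 ∧ r ≠ 60 ∧ 60 ≠ r := by omega
  have := four_mul_two_pow_le hB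
  have := Nat.lt_two_pow_self (n := K)
  refine (Runs.eval_countdown (T := 1) (N := K) (fun j s' => s'.reg r = 2 ^ j) (by omega)
    (le_refl 3) (fun _ => ?_) ?_ (by decide) ?_ ?_ (fun j s' u h => ?_) ?_).mono_steps
    (by omega)
  · simp [Cmd.Safe, move, Cmd.eval, ha', hK]
    omega
  · simp [Cmd.writes, hr']
  · simp [move, Cmd.eval, Op.eval, ha', hr', hK]
  · simp [move, Cmd.eval]
  · simpa [hr'] using h
  · intro j hj s' _ _ h
    have hpow : 2 * 2 ^ j ≤ 2 ^ K := (pow_succ' 2 j).ge.trans (Nat.pow_le_pow_right two_pos hj)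
    refine Runs.of_eval le_rfl (fun _ => ?_) ?_
    · simp only [Cmd.Safe, h]
      omega
    · simp [Cmd.eval, Op.eval, h, pow_succ, mul_two]

end

/-! ### Linear codes and Gilbert's greedy procedure -/

/-- The words at distance more than `d` from the code `C`, whose words are given by their binary
codes. -/
def farWords (m d : ℕ) (C : Finset ℕ) : Set (Fin m → Bool) :=
  {y | ∀ c ∈ C, d < hammingDist (word m c) y}

/-- A linear code of block length `m` and minimum distance more than `d`, whose words are given by
their binary codes; addition of words is the exclusive or. -/
structure IsLinearCode (m d : ℕ) (C : Finset ℕ) : Prop where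
  zero_mem : 0 ∈ C
  lt : ∀ c ∈ C, c < 2 ^ m
  xor_mem : ∀ b ∈ C, ∀ c ∈ C, b ^^^ c ∈ C
  lt_wt : ∀ c ∈ C, c ≠ 0 → d < wt m c

/-- The code spanned by the linear code `C` and the word `x`. -/
def adjoin (C : Finset ℕ) (x : ℕ) : Finset ℕ := C ∪ C.image (· ^^^ x)

/-- `N v` is a word of the code `C` that is nearest to `v`. -/
def NearestIn (m : ℕ) (C : Finset ℕ) (N : ℕ → ℕ) (v : ℕ) : Prop :=
  N v ∈ C ∧ ∀ c ∈ C, wt m (v ^^^ N v) ≤ wt m (v ^^^ c)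

section

variable {m d x : ℕ} {C : Finset ℕ}

theorem farWords_insert (m d c : ℕ) (C : Finset ℕ) :
    farWords m d (insert c C) = farWords m d C \ {y | hammingDist (word m c) y ≤ d} := by
  ext y
  simp only [farWords, Finset.forall_mem_insert, Set.mem_ofPred_eq, Set.mem_sdiff, not_le,
    and_comm]

/-- The greedy procedure may pick the words of a code of large distance in any order. -/
theorem gilbertRun_farWords (hC : ∀ b ∈ C, ∀ c ∈ C, b ≠ c → d < wt m (b ^^^ c)) :
    GilbertRun m d (farWords m d C) (word m '' (C : Set ℕ)) := by
  induction C using Finset.induction_on with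
  | empty => simpa [farWords] using GilbertRun.start
  | insert c C hc ih =>
    simp only [Finset.forall_mem_insert] at hC
    have far : word m c ∈ farWords m d C := fun b hb => by
      rw [hammingDist_word]
      exact (hC.2 b hb).1 fun h => hc (h ▸ hb)
    rw [farWords_insert, Finset.coe_insert, Set.image_insert_eq]
    exact .pick _ (ih fun b hb => (hC.2 b hb).2) far

theorem isLinearCode_zero (m d : ℕ) : IsLinearCode m d {0} := by
  constructor <;> simp

theorem adjoin_zero (C : Finset ℕ) : adjoin C 0 = C := by simp [adjoin]

theorem mem_adjoin {c : ℕ} : c ∈ adjoin C x ↔ c ∈ C ∨ c ^^^ x ∈ C := by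
  simp only [adjoin, Finset.mem_union, Finset.mem_image]
  refine or_congr_right ⟨?_, fun hc => ⟨_, hc, Nat.xor_xor_cancel_right c x⟩⟩
  rintro ⟨b, hb, rfl⟩
  rwa [Nat.xor_xor_cancel_right]

namespace IsLinearCode

protected theorem adjoin (h : IsLinearCode m d C) (hx : x < 2 ^ m)
    (hfar : ∀ c ∈ C, d < wt m (x ^^^ c)) : IsLinearCode m d (adjoin C x) where
  zero_mem := mem_adjoin.2 (.inl h.zero_mem)
  lt c hc := by
    rcases mem_adjoin.1 hc with hc | hc
    · exact h.lt c hc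
    · simpa only [Nat.xor_xor_cancel_right] using Nat.xor_lt_two_pow (h.lt _ hc) hx
  xor_mem b hb c hc := by
    rw [mem_adjoin]
    rcases mem_adjoin.1 hb with hb | hb <;> rcases mem_adjoin.1 hc with hc | hc
    · exact .inl (h.xor_mem _ hb _ hc)
    · exact .inr (by simpa only [Nat.xor_assoc] using h.xor_mem _ hb _ hc)
    · exact .inr (by
        simpa only [Nat.xor_assoc, Nat.xor_comm c x] using h.xor_mem _ hb _ hc)
    · exact .inl (by
        rw [← Nat.xor_xor_cancel_right b x, Nat.xor_assoc, Nat.xor_comm x c]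
        exact h.xor_mem _ hb _ hc)
  lt_wt c hc hc0 := by
    rcases mem_adjoin.1 hc with hc | hc
    · exact h.lt_wt c hc hc0
    · have := hfar _ hc
      rwa [Nat.xor_comm c x, Nat.xor_xor_cancel_left] at this

theorem card_adjoin (h : IsLinearCode m d C) (hfar : ∀ c ∈ C, d < wt m (x ^^^ c)) :
    (adjoin C x).card = 2 * C.card := by
  have disjoint : Disjoint C (C.image (· ^^^ x)) := by
    rw [Finset.disjoint_left]
    rintro _ hc hc'
    obtain ⟨b, hb, rfl⟩ := Finset.mem_image.1 hc'
    have hxC := h.xor_mem _ hb _ hc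
    rw [Nat.xor_xor_cancel_left] at hxC
    simpa [wt_zero_right] using hfar x hxC
  rw [adjoin, Finset.card_union_of_disjoint disjoint,
    Finset.card_image_of_injective _ Nat.xor_left_injective, two_mul]

theorem isGilbertCode {N : ℕ → ℕ} (h : IsLinearCode m d C)
    (hN : ∀ v < 2 ^ m, NearestIn m C N v) (hcov : ∀ v < 2 ^ m, wt m (v ^^^ N v) ≤ d) :
    IsGilbertCode m d (word m '' (C : Set ℕ)) := by
  have no_far : farWords m d C = ∅ := by
    refine Set.eq_empty_of_forall_notMem fun y hy => ?_
    obtain ⟨v, hv, rfl⟩ := exists_word m y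
    have := hy _ (hN v hv).1
    rw [hammingDist_word, Nat.xor_comm] at this
    exact this.not_ge (hcov v hv)
  have run := gilbertRun_farWords fun b hb c hc hbc =>
    h.lt_wt _ (h.xor_mem b hb c hc) (Nat.xor_ne_zero_iff.2 hbc)
  rwa [no_far] at run

theorem isDecodingTable {N mem : ℕ → ℕ} (h : IsLinearCode m d C)
    (hN : ∀ v < 2 ^ m, NearestIn m C N v)
    (hmem : ∀ v < 2 ^ m, mem v = if wt m (v ^^^ N v) ≤ (d - 1) / 2 then N v + 1 else 0) :
    IsDecodingTable m d (word m '' (C : Set ℕ)) mem := by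
  refine fun v hv => ⟨fun w hw hwC hvw => ?_, fun hfar => ?_⟩
  · obtain ⟨c, hc, hcw⟩ := hwC
    obtain rfl := word_injOn (h.lt c hc) hw hcw
    rw [hammingDist_word] at hvw
    obtain ⟨hNv, nearest⟩ := hN v hv
    have closer := (nearest c hc).trans hvw
    suffices N v = c by rw [hmem v hv, if_pos closer, this]
    by_contra hne
    have := h.lt_wt _ (h.xor_mem _ hNv _ hc) (Nat.xor_ne_zero_iff.2 hne)
    have := wt_xor_triangle m (N v) v c
    omega
  · have := hfar _ ⟨N v, (hN v hv).1, rfl⟩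
    rw [hammingDist_word] at this
    rw [hmem v hv, if_neg this.not_ge]

end IsLinearCode

end

/-! ### The preprocessing program -/

/-- The language has no empty program; this one writes only to the scratch register. -/
def skip : Cmd := .const Reg.tmp 0

namespace PreReg

@[simp] abbrev length : ℕ := 1
@[simp] abbrev dist : ℕ := 2
@[simp] abbrev total : ℕ := 3
@[simp] abbrev round : ℕ := 4
@[simp] abbrev cur : ℕ := 5
@[simp] abbrev far : ℕ := 6
@[simp] abbrev near : ℕ := 7
@[simp] abbrev gap : ℕ := 8
@[simp] abbrev cand : ℕ := 9
@[simp] abbrev radius : ℕ := 10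

end PreReg

section

open PreReg

/-- The registers hold the block length `m`, the distance `d` and the number of words. During the
search for a code, the memory cell `v` holds the codeword nearest to `v`. -/
structure PreState (m d : ℕ) (s : State) : Prop where
  length : s.reg length = m
  dist : s.reg dist = d
  total : s.reg total = 2 ^ m

/-- Load the nearest codeword of the current word, and compute their distance. -/
def loadNearest : Cmd := .load near cur ;; xorWeight cur near length

/-- If the current word is far from the code, remember it. -/
def findFarStep : Cmd :=
  loadNearest ;; .arith .sub gap Reg.weight dist ;; .ite gap (move far cur) skip

/-- Put a word at distance more than `d` from the code into `PreReg.far`, or zero if there is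
none. -/
def findFar : Cmd := (.const far 0 ;; move cur total) ;; countdown cur findFarStep

/-- Translate the nearest codeword of `v ^^^ x` back by `x`, where `x` stands in `PreReg.far`. -/
def candidate : Cmd :=
  (xorWeight cur far length ;; .load near Reg.xor) ;;
  xorWeight near far length ;; move cand Reg.xor

/-- By how much the candidate is nearer to the current word than its old nearest codeword. -/
def gain : Cmd :=
  (xorWeight cur cand length ;; move gap Reg.weight) ;;
  loadNearest ;; .arith .sub gap Reg.weight gap

/-- Update the nearest codeword of the current word for the code enlarged by `PreReg.far`. -/
def updateStep : Cmd := candidate ;; gain ;; .ite gap (.store cur cand) skip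

/-- Pass to the code spanned by the old code and the word in `PreReg.far`. -/
def updateCode : Cmd := move cur total ;; countdown cur updateStep

/-- Replace the nearest codeword of the current word by the entry of the decoding table. -/
def decodeStep : Cmd :=
  loadNearest ;; .arith .sub gap Reg.weight radius ;; .ite gap (.const near 0) (incr near) ;;
  .store cur near

/-- Replace the nearest codewords by the entries of the decoding table. -/
def finishTable : Cmd :=
  (.const Reg.tmp 1 ;; .arith .sub radius dist Reg.tmp ;; .const Reg.tmp 2 ;;
    .arith .div radius radius Reg.tmp ;; move cur total) ;;
  countdown cur decodeStep

/-- The preprocessing program: a linear code is enlarged by far words until none is left, and its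
decoding table is tabulated. Every round doubles the code, so that `m + 1` rounds suffice. -/
def preprocess : Cmd :=
  powTwo total length ;; (move round length ;; incr round) ;;
  countdown round (findFar ;; updateCode) ;; finishTable

/-- The new nearest codewords after `updateStep` has treated the word `v`. -/
def improve (m x : ℕ) (N : ℕ → ℕ) (v : ℕ) : ℕ → ℕ :=
  if wt m (v ^^^ (N (v ^^^ x) ^^^ x)) < wt m (v ^^^ N v) then
    Function.update N v (N (v ^^^ x) ^^^ x)
  else N

/-- The entry for `v` in the decoding table with decoding radius `r`. -/
def tableEntry (m r : ℕ) (N : ℕ → ℕ) (v : ℕ) : ℕ :=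
  if wt m (v ^^^ N v) ≤ r then N v + 1 else 0

/-- The invariant of `findFar`: the last `j` words have been searched. -/
def FarInvariant (m d : ℕ) (N : ℕ → ℕ) (j : ℕ) (s : State) : Prop :=
  s.reg far < 2 ^ m ∧ (d < wt m (s.reg far ^^^ N (s.reg far)) ∨
    s.reg far = 0 ∧ ∀ v < 2 ^ m, 2 ^ m - j ≤ v → wt m (v ^^^ N v) ≤ d)

/-- The invariant of `updateCode`: for the last `j` words, `N` gives the nearest word in the
enlarged code. -/
def UpdateInvariant (m : ℕ) (C : Finset ℕ) (x j : ℕ) (N : ℕ → ℕ) : Prop :=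
  ∀ v < 2 ^ m, N v ∈ adjoin C x ∧ (∀ c ∈ C, wt m (v ^^^ N v) ≤ wt m (v ^^^ c)) ∧
    (2 ^ m - j ≤ v → ∀ c ∈ adjoin C x, wt m (v ^^^ N v) ≤ wt m (v ^^^ c))

/-- The invariant of the main loop: after `j` rounds the code is maximal or has `2 ^ j` words. -/
def GreedyInvariant (m d j : ℕ) (s : State) : Prop :=
  ∃ C, IsLinearCode m d C ∧ (∀ v < 2 ^ m, NearestIn m C s.mem v) ∧
    ((∀ v < 2 ^ m, wt m (v ^^^ s.mem v) ≤ d) ∨ 2 ^ j ≤ C.card)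

/-- A nearest word of the code spanned by `C` and `x` is nearest in `C`, or the translate by `x` of
a word of `C` that is nearest to the translate of `v`. -/
theorem UpdateInvariant.improve {m x j : ℕ} {C : Finset ℕ} {N : ℕ → ℕ} (hx : x < 2 ^ m)
    (hj : j < 2 ^ m) (h : UpdateInvariant m C x j N) :
    UpdateInvariant m C x (j + 1) (improve m x N (2 ^ m - (j + 1))) := by
  set v := 2 ^ m - (j + 1)
  have hvm : v < 2 ^ m := by omega
  obtain ⟨mem_v, near_v, -⟩ := h v hvm
  obtain ⟨mem_u, near_u, -⟩ := h _ (Nat.xor_lt_two_pow hvm hx)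
  have translate (c : ℕ) : v ^^^ (c ^^^ x) = v ^^^ x ^^^ c := by
    rw [Nat.xor_comm c, Nat.xor_assoc]
  have cand_mem : N (v ^^^ x) ^^^ x ∈ adjoin C x := by
    rw [mem_adjoin, Nat.xor_xor_cancel_right]
    exact (mem_adjoin.1 mem_u).symm
  have best {a : ℕ} (ha : wt m (v ^^^ a) ≤ wt m (v ^^^ N v))
      (ha' : wt m (v ^^^ a) ≤ wt m (v ^^^ (N (v ^^^ x) ^^^ x))) :
      ∀ c ∈ adjoin C x, wt m (v ^^^ a) ≤ wt m (v ^^^ c) := by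
    intro c hc
    rcases mem_adjoin.1 hc with hc | hc
    · exact ha.trans (near_v c hc)
    · have := near_u _ hc
      rw [← translate, ← translate, Nat.xor_xor_cancel_right] at this
      exact ha'.trans this
  intro w hw
  obtain ⟨mem_w, near_w, done_w⟩ := h w hw
  unfold LightBulb.improve
  by_cases hwv : w = v
  · subst hwv
    split_ifs with hlt
    · simp only [Function.update_self]
      exact ⟨cand_mem, fun c hc => hlt.le.trans (near_v c hc), fun _ => best hlt.le le_rfl⟩
    · exact ⟨mem_v, near_v, fun _ => best le_rfl (not_lt.1 hlt)⟩
  · have : (if wt m (v ^^^ (N (v ^^^ x) ^^^ x)) < wt m (v ^^^ N v) then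
        Function.update N v (N (v ^^^ x) ^^^ x) else N) w = N w := by
      split_ifs
      · exact Function.update_of_ne hwv _ _
      · rfl
    rw [this]
    exact ⟨mem_w, near_w, fun hle => done_w (by omega)⟩

variable {B m d : ℕ} {inp : ℕ → ℕ → ℕ} {s s' : State} {C : Finset ℕ}

theorem PreState.frame {c : Cmd} (h : PreState m d s) (hF : Frame c s s')
    (hc : ∀ x ∈ [PreReg.length, PreReg.dist, PreReg.total], c.writes x = false) :
    PreState m d s' where
  length := (hF.reg _ (hc _ (by simp))).trans h.length
  dist := (hF.reg _ (hc _ (by simp))).trans h.dist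
  total := (hF.reg _ (hc _ (by simp))).trans h.total

theorem runs_loadNearest {v : ℕ} (hB : m + 2 ≤ B) (hm : s.reg length = m) (hv : s.reg cur = v)
    (hvm : v < 2 ^ m) (hN : s.mem v < 2 ^ m) :
    Runs B inp loadNearest s (14 * m + 11) fun s' =>
      s'.reg near = s.mem v ∧ s'.reg Reg.weight = wt m (v ^^^ s.mem v) := by
  refine (Runs.eval_seq (T₁ := 1) le_rfl (fun _ => by trivial) fun _ =>
    (runs_xorWeight (K := m) (by decide) (by decide) (by decide) ?_ ?_ ?_ hB).mono le_rfl
      fun s' hF h => ⟨(hF.reg near rfl).trans ?_, ?_⟩).mono_steps (by omega)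
  all_goals simp_all [Cmd.eval]

theorem runs_findFarStep {N : ℕ → ℕ} {j : ℕ} (hB : m + 2 ≤ B) (hs : PreState m d s)
    (hmem : s.mem = N) (hN : ∀ v < 2 ^ m, N v < 2 ^ m) (hj : j < 2 ^ m)
    (hword : s.reg cur = 2 ^ m - (j + 1)) (h : FarInvariant m d N j s) :
    Runs B inp findFarStep s (14 * m + 15) (FarInvariant m d N (j + 1)) := by
  subst hmem
  set v := 2 ^ m - (j + 1)
  have hvm : v < 2 ^ m := by omega
  refine ((runs_loadNearest hB hs.length hword hvm (hN v hvm)).seq (T₂ := 4)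
    fun t hF ⟨_, h_weight⟩ => ?_).mono_steps (by omega)
  have h_dist := (hs.frame hF (by decide)).dist
  have h_word := (hF.reg cur rfl).trans hword
  have h_far := hF.reg far rfl
  have := four_mul_two_pow_le hB
  refine Runs.of_eval le_rfl (fun _ => ?_) ?_
  · simp [Cmd.Safe, skip, move, Cmd.eval, Op.eval, h_word]
    omega
  · by_cases hd : d < wt m (v ^^^ s.mem v)
    · have : wt m (v ^^^ s.mem v) - d ≠ 0 := by omega
      simp [FarInvariant, Cmd.eval, Op.eval, move, h_weight, h_dist, h_word, this, hd, hvm]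
    · have : wt m (v ^^^ s.mem v) - d = 0 := by omega
      simp only [FarInvariant, Cmd.eval, Op.eval, skip, h_weight, h_dist, this, ↓reduceIte,
        State.reg_setReg, Reg.tmp, far, gap, Nat.reduceEqDiff, h_far]
      refine ⟨h.1, h.2.imp_right fun ⟨far_eq, near⟩ => ⟨far_eq, fun w hw hle => ?_⟩⟩
      rcases hle.eq_or_lt with rfl | hlt
      · exact not_lt.1 hd
      · exact near w hw (by omega)

theorem runs_findFar (hB : m + 2 ≤ B) (hs : PreState m d s)
    (hN : ∀ v < 2 ^ m, s.mem v < 2 ^ m) :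
    Runs B inp findFar s (2 ^ m * (14 * m + 18) + 4) fun s' =>
      s'.reg far < 2 ^ m ∧ (d < wt m (s'.reg far ^^^ s.mem (s'.reg far)) ∨
        s'.reg far = 0 ∧ ∀ v < 2 ^ m, wt m (v ^^^ s.mem v) ≤ d) := by
  have := four_mul_two_pow_le hB
  have := Nat.two_pow_pos m
  refine (Runs.eval_countdown (N := 2 ^ m) (T := 14 * m + 15) (FarInvariant m d s.mem) (by omega)
    (le_refl 3) (fun _ => ?_) rfl (by decide) ?_ ?_ (fun j s u h => ?_)
    fun j hj s' hF hword h => runs_findFarStep hB (hs.frame hF (by decide)) (hF.mem rfl) hN hj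
      hword h).mono (by ring_nf; omega) fun s' _ h => ?_
  · simp [Cmd.Safe, move, Cmd.eval, hs.total]
    omega
  · simp [move, Cmd.eval, Op.eval, hs.total]
  · refine ⟨by simp [move, Cmd.eval], .inr ⟨by simp [move, Cmd.eval], by omega⟩⟩
  · simpa [FarInvariant] using h
  · simpa [FarInvariant] using h

theorem runs_candidate {v x : ℕ} (hB : m + 2 ≤ B) (hm : s.reg length = m) (hv : s.reg cur = v)
    (hvm : v < 2 ^ m) (hx : s.reg far = x) (hxm : x < 2 ^ m) (hN : s.mem (v ^^^ x) < 2 ^ m) :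
    Runs B inp candidate s (28 * m + 23) fun s' => s'.reg cand = s.mem (v ^^^ x) ^^^ x := by
  have := four_mul_two_pow_le hB
  refine Runs.mono_steps (Runs.seq (T₁ := 14 * m + 10 + 1) (T₂ := 14 * m + 10 + 2)
    (R := fun t => t.reg near = s.mem (v ^^^ x)) ?_ fun t hF h_near => ?_) (by omega)
  · refine Runs.seq (runs_xorWeight (K := m) (by decide) (by decide) (by decide) hm (by rwa [hv])
      (by rwa [hx]) hB) fun t hF h => Runs.of_eval le_rfl (fun _ => by trivial) ?_
    simp [Cmd.eval, h.1, hv, hx, hF.mem rfl]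
  · have h_far := (hF.reg far rfl).trans hx
    refine Runs.seq (runs_xorWeight (K := m) (by decide) (by decide) (by decide)
      ((hF.reg length rfl).trans hm) (by rwa [h_near]) (by rwa [h_far]) hB) fun t' _ h => ?_
    rw [h_near, h_far] at h
    have := Nat.xor_lt_two_pow hN hxm
    refine Runs.of_eval le_rfl (fun _ => ?_) ?_
    · simp [Cmd.Safe, move, Cmd.eval, h.1]
      omega
    · simp [move, Cmd.eval, Op.eval, h.1]

theorem runs_gain {v c : ℕ} (hB : m + 2 ≤ B) (hm : s.reg length = m) (hv : s.reg cur = v)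
    (hvm : v < 2 ^ m) (hc : s.reg cand = c) (hcm : c < 2 ^ m) (hN : s.mem v < 2 ^ m) :
    Runs B inp gain s (28 * m + 24) fun s' =>
      s'.reg gap = wt m (v ^^^ s.mem v) - wt m (v ^^^ c) := by
  have := four_mul_two_pow_le hB
  refine Runs.mono_steps (Runs.seq (T₁ := 14 * m + 10 + 2) (T₂ := 14 * m + 11 + 1)
    (R := fun t => t.reg gap = wt m (v ^^^ c)) ?_ fun t hF h_gap => ?_) (by omega)
  · refine Runs.seq (runs_xorWeight (K := m) (by decide) (by decide) (by decide) hm (by rwa [hv])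
      (by rwa [hc]) hB) fun t _ h => ?_
    rw [hv, hc] at h
    have := wt_le m (v ^^^ c)
    have := Nat.lt_two_pow_self (n := m)
    refine Runs.of_eval le_rfl (fun _ => ?_) ?_
    · simp [Cmd.Safe, move, Cmd.eval, h.2]
      omega
    · simp [move, Cmd.eval, Op.eval, h.2]
  · have h_mem := hF.mem rfl
    refine Runs.seq (runs_loadNearest hB ((hF.reg length rfl).trans hm) ((hF.reg cur rfl).trans hv)
      hvm (by rwa [h_mem])) fun t' hF' h => Runs.of_eval le_rfl (fun _ => by trivial) ?_
    simp [Cmd.eval, Op.eval, h.2, h_mem, (hF'.reg gap rfl).trans h_gap]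

theorem runs_updateStep {v x : ℕ} (hB : m + 2 ≤ B) (hm : s.reg length = m) (hv : s.reg cur = v)
    (hvm : v < 2 ^ m) (hx : s.reg far = x) (hxm : x < 2 ^ m) (hN : ∀ v < 2 ^ m, s.mem v < 2 ^ m) :
    Runs B inp updateStep s (56 * m + 49) fun s' => s'.mem = improve m x s.mem v := by
  have hNu := hN _ (Nat.xor_lt_two_pow hvm hxm)
  refine Runs.mono_steps ((runs_candidate hB hm hv hvm hx hxm hNu).seq fun t hF h_cand =>
    (runs_gain hB ((hF.reg length rfl).trans hm) ((hF.reg cur rfl).trans hv) hvm h_cand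
      (Nat.xor_lt_two_pow hNu hxm) (by rw [hF.mem rfl]; exact hN v hvm)).seq (T₂ := 2)
      fun t' hF' h_gap => Runs.of_eval le_rfl (fun _ => ?_) ?_) (by omega)
  · simp [Cmd.Safe, skip]
  · have h_mem : t'.mem = s.mem := (hF'.mem rfl).trans (hF.mem rfl)
    simp only [Cmd.eval, skip, h_gap, hF.mem rfl, Nat.sub_eq_zero_iff_le, improve,
      (hF'.reg cur rfl).trans ((hF.reg cur rfl).trans hv), (hF'.reg cand rfl).trans h_cand,
      ← not_lt]
    split_ifs <;> simp_all [State.setMem]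

theorem runs_updateCode {x : ℕ} (hB : m + 2 ≤ B) (hC : ∀ c ∈ adjoin C x, c < 2 ^ m)
    (hs : PreState m d s) (hx : s.reg far = x) (hxm : x < 2 ^ m)
    (hN : ∀ v < 2 ^ m, NearestIn m C s.mem v) :
    Runs B inp updateCode s (2 ^ m * (56 * m + 52) + 3) fun s' =>
      ∀ v < 2 ^ m, NearestIn m (adjoin C x) s'.mem v := by
  have := four_mul_two_pow_le hB
  refine (Runs.eval_countdown (N := 2 ^ m) (T := 56 * m + 49)
    (fun j s' => UpdateInvariant m C x j s'.mem) (by omega)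
    (le_refl 2) (fun _ => ?_) rfl (by decide) ?_ ?_ (fun _ _ _ h => h)
    fun j hj s' hF hword h => ?_).mono (by ring_nf; omega) fun s' _ h v hv => ?_
  · simp [Cmd.Safe, move, Cmd.eval, hs.total]
    omega
  · simp [move, Cmd.eval, Op.eval, hs.total]
  · exact fun v hv => ⟨Finset.mem_union_left _ (hN v hv).1, (hN v hv).2, by omega⟩
  · refine (runs_updateStep hB (hs.frame hF (by decide)).length hword (by omega)
      ((hF.reg far rfl).trans hx) hxm fun v hv => hC _ (h v hv).1).mono le_rfl fun t _ ht => ?_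
    rw [ht]
    exact h.improve hxm hj
  · exact ⟨(h v hv).1, (h v hv).2.2 (by omega)⟩

theorem runs_decodeStep {v r : ℕ} (hB : m + 2 ≤ B) (hm : s.reg length = m) (hv : s.reg cur = v)
    (hvm : v < 2 ^ m) (hN : s.mem v < 2 ^ m) (hr : s.reg radius = r) :
    Runs B inp decodeStep s (14 * m + 16) fun s' =>
      s'.mem = Function.update s.mem v (tableEntry m r s.mem v) := by
  have := four_mul_two_pow_le hB
  refine Runs.mono_steps ((runs_loadNearest hB hm hv hvm hN).seq (T₂ := 5)
    fun t hF ⟨h_near, h_weight⟩ => Runs.of_eval le_rfl (fun _ => ?_) ?_) (by omega)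
  · simp [Cmd.Safe, Cmd.eval, incr, Op.eval, h_near]
    omega
  · simp only [Cmd.eval, Op.eval, incr, h_weight, tableEntry, State.reg_setReg, ↓reduceIte,
      (hF.reg radius rfl).trans hr, Nat.sub_eq_zero_iff_le, Nat.reduceEqDiff, Reg.tmp, near, gap]
    split_ifs <;>
      simp [State.setMem, hF.mem rfl, (hF.reg cur rfl).trans hv, h_near]

theorem runs_finishTable (hB : m + 2 ≤ B) (hs : PreState m d s)
    (hN : ∀ v < 2 ^ m, s.mem v < 2 ^ m) :
    Runs B inp finishTable s (2 ^ m * (14 * m + 19) + 10) fun s' =>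
      ∀ v < 2 ^ m, s'.mem v = tableEntry m ((d - 1) / 2) s.mem v := by
  have := four_mul_two_pow_le hB
  refine (Runs.eval_countdown (N := 2 ^ m) (T := 14 * m + 16)
    (fun j s' => s'.reg radius = (d - 1) / 2 ∧ ∀ v < 2 ^ m,
      s'.mem v = if 2 ^ m - j ≤ v then tableEntry m ((d - 1) / 2) s.mem v else s.mem v)
    (by omega) (le_refl 6) (fun _ => ?_) rfl (by decide) ?_ ?_ (fun j s u h => by simpa using h)
    fun j hj s' hF h_cur ⟨h_radius, h_mem⟩ => ?_).mono (by ring_nf; omega)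
    fun s' _ h v hv => by simpa using h.2 v hv
  · have := Nat.one_le_two_pow (n := m)
    simp [Cmd.Safe, move, Cmd.eval, hs.total]
    omega
  · simp [move, Cmd.eval, Op.eval, hs.total]
  · simp [move, Cmd.eval, Op.eval, hs.dist]
    omega
  · set v := 2 ^ m - (j + 1)
    have hvm : v < 2 ^ m := by omega
    have h_v : s'.mem v = s.mem v := by rw [h_mem v hvm, if_neg (by omega)]
    refine (runs_decodeStep hB (hs.frame hF (by decide)).length h_cur hvm
      (by rw [h_v]; exact hN v hvm) h_radius).mono le_rfl fun t hF' ht =>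
        ⟨(hF'.reg radius rfl).trans h_radius, fun w hw => ?_⟩
    rw [ht, Function.update_apply]
    split_ifs with hwv hle hle
    · simp only [hwv, tableEntry, h_v]
    · omega
    · rw [h_mem w hw, if_pos (by omega)]
    · rw [h_mem w hw, if_neg (by omega)]

theorem runs_greedyRound {j : ℕ} (hB : m + 2 ≤ B) (hs : PreState m d s)
    (h : GreedyInvariant m d j s) :
    Runs B inp (findFar ;; updateCode) s
      ((2 ^ m * (14 * m + 18) + 4) + (2 ^ m * (56 * m + 52) + 3))
      (GreedyInvariant m d (j + 1)) := by
  obtain ⟨C, hC, hN, hcov⟩ := h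
  refine (runs_findFar hB hs fun v hv => hC.lt _ (hN v hv).1).seq fun t hF ⟨hx, h_far⟩ => ?_
  have hs' := hs.frame hF (by decide)
  have h_mem : t.mem = s.mem := hF.mem rfl
  rw [← h_mem] at hN hcov h_far
  set x := t.reg far with hxt
  rcases h_far with h_far | ⟨x_zero, covered⟩
  · have far_C (c) (hc : c ∈ C) : d < wt m (x ^^^ c) := h_far.trans_le ((hN x hx).2 c hc)
    have hC' := hC.adjoin hx far_C
    refine (runs_updateCode hB hC'.lt hs' rfl hx hN).mono le_rfl
      fun t' _ hN' => ⟨_, hC', hN', .inr ?_⟩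
    have := hcov.resolve_left fun covered => h_far.not_ge (covered x hx)
    rw [hC.card_adjoin far_C, pow_succ']
    omega
  · have same : adjoin C x = C := by rw [x_zero, adjoin_zero]
    refine (runs_updateCode hB (by rw [same]; exact hC.lt) hs' hxt.symm hx hN).mono le_rfl
      fun t' _ hN' => ⟨C, hC, same ▸ hN', .inl fun v hv => ?_⟩
    rw [same] at hN'
    exact ((hN' v hv).2 _ (hN v hv).1).trans (covered v hv)

theorem runs_preprocess (hB : m + 2 ≤ B) (h1 : s.reg 1 = m) (h2 : s.reg 2 = d)
    (hm : ∀ a, s.mem a = 0) :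
    Runs B inp preprocess s (2 ^ m * (300 * (m + 1) ^ 2)) fun s' =>
      ∃ K, IsGilbertCode m d K ∧ IsDecodingTable m d K s'.mem := by
  have := four_mul_two_pow_le hB
  have := Nat.lt_two_pow_self (n := m)
  refine Runs.mono_steps ((runs_powTwo (K := m) (by decide) (by decide) h1 hB).seq
    fun t hF h_total => ?_) (T := (4 * m + 4) + (4 + (((m + 1) *
      (((2 ^ m * (14 * m + 18) + 4) + (2 ^ m * (56 * m + 52) + 3)) + 3) + 1) +
        (2 ^ m * (14 * m + 19) + 10)))) ?_
  · have ht : PreState m d t := ⟨(hF.reg 1 rfl).trans h1, (hF.reg 2 rfl).trans h2, h_total⟩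
    refine Runs.eval_seq le_rfl (fun _ => ?_) fun hF₁ => (Runs.countdown (N := m + 1)
      (GreedyInvariant m d) (by omega) rfl (by decide) ?_ ?_ (fun _ _ _ h => h)
      fun j _ s' hF' _ h => runs_greedyRound hB
        ((ht.frame hF₁ (by decide)).frame hF' (by decide)) h).seq fun t' hF' h => ?_
    · simp [Cmd.Safe, move, incr, Cmd.eval, Op.eval, ht.length]
      omega
    · simp [move, incr, Cmd.eval, Op.eval, ht.length]
    · have h_mem (a) : t.mem a = 0 := by rw [hF.mem rfl, hm]
      refine ⟨{0}, isLinearCode_zero m d, fun v _ => ?_, .inr (by simp)⟩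
      simp [NearestIn, move, incr, Cmd.eval, h_mem]
    · obtain ⟨C, hC, hN, h⟩ := h
      have covered := h.resolve_right fun hcard => by
        have := Finset.card_le_card fun c hc => Finset.mem_range.2 (hC.lt c hc)
        rw [Finset.card_range] at this
        exact (hcard.trans this).not_gt (Nat.pow_lt_pow_right one_lt_two (by omega))
      refine (runs_finishTable hB ((ht.frame hF₁ (by decide)).frame hF' (by decide))
        fun v hv => hC.lt _ (hN v hv).1).mono le_rfl fun t'' _ ht'' => ?_
      exact ⟨_, hC.isGilbertCode hN covered, hC.isDecodingTable hN ht''⟩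
  · generalize 2 ^ m = M at *
    nlinarith [Nat.zero_le (M * m), Nat.zero_le (M * m ^ 2)]

end

/-! ### The search program -/

section

namespace SearchReg

@[simp] abbrev strings : ℕ := 2
@[simp] abbrev logStrings : ℕ := 3
@[simp] abbrev half : ℕ := 4
@[simp] abbrev len : ℕ := 5
@[simp] abbrev base : ℕ := 6
@[simp] abbrev compared : ℕ := 7
@[simp] abbrev allowed : ℕ := 8
@[simp] abbrev blocks : ℕ := 9
@[simp] abbrev radius : ℕ := 10
@[simp] abbrev patterns : ℕ := 12
@[simp] abbrev pattern : ℕ := 13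
@[simp] abbrev block : ℕ := 14
@[simp] abbrev offset : ℕ := 16
@[simp] abbrev left : ℕ := 17
@[simp] abbrev key : ℕ := 18
@[simp] abbrev probe : ℕ := 19
@[simp] abbrev slot : ℕ := 20
@[simp] abbrev right : ℕ := 21
@[simp] abbrev leftBits : ℕ := 22
@[simp] abbrev rightBits : ℕ := 23
@[simp] abbrev excess : ℕ := 24
@[simp] abbrev distance : ℕ := 25
@[simp] abbrev distance' : ℕ := 26
@[simp] abbrev zero : ℕ := 30

/-- The registers that all parts of the main loop share. -/
abbrev shared : List ℕ := [strings, len, base, compared, allowed, patterns, zero]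

end SearchReg

open SearchReg

/-- Copy the word that `readWord a o k` reads to the register `r`. -/
def readInto (r a o k : ℕ) : Cmd := readWord a o k ;; move r Reg.bits

/-- Count the mismatches of the strings `left` and `right` on the compared positions, in
`Reg.weight`. -/
def countMismatches : Cmd :=
  readInto leftBits left zero compared ;; readInto rightBits right zero compared ;;
  xorWeight leftBits rightBits compared

/-- Compare the strings `left` and `right`, and output them if they are similar. -/
def compareStrings : Cmd :=
  countMismatches ;; .arith .sub excess Reg.weight allowed ;;
  .ite excess skip (move 0 left ;; move 1 right)

/-- Decrement `right`, after checking whether it exceeds the number of strings, and compute its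
distance from `left`. -/
def decodeSlot : Cmd :=
  .arith .sub excess right strings ;; decr right ;; .arith .sub distance left right ;;
  .arith .sub distance' right left ;; .arith .add distance distance distance'

/-- Compare the string `left` with the string `right - 1`, if this is a different string. -/
def tryPair : Cmd := decodeSlot ;; .ite excess skip (.ite distance compareStrings skip)

/-- Look up the key, changed by the error pattern in the cell `probe`, in the hash table. -/
def probeStep : Cmd :=
  .load slot probe ;; xorWeight key slot len ;;
  (.arith .add slot base Reg.xor ;; .load right slot) ;; tryPair

/-- Look up the block of the string `left` with all error patterns. -/
def probeString : Cmd :=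
  readInto key left offset len ;; move probe patterns ;; countdown probe probeStep

/-- Enter the string `left` into the hash table: the cell `2 ^ k + h` receives `j + 1` for a
string `j` whose current block is `h`. -/
def insertString : Cmd :=
  readWord left offset len ;; .arith .add slot base Reg.bits ;; move right left ;; incr right ;;
  .store slot right

/-- Enter all strings into the hash table. -/
def fillTable : Cmd := move left strings ;; countdown left insertString

/-- Look up all strings in the hash table. -/
def probeTable : Cmd := move left strings ;; countdown left probeString

/-- Process the block with the number in the register `block`. -/
def searchBlock : Cmd := .arith .mul offset block len ;; fillTable ;; probeTable

/-- Append the current pattern to the list of error patterns, if it is light. -/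
def patternStep : Cmd :=
  xorWeight pattern zero len ;; .arith .sub excess Reg.weight radius ;;
  .ite excess skip (.store patterns pattern ;; incr patterns)

/-- List the error patterns in the first memory cells. -/
def listPatterns : Cmd := move pattern base ;; countdown pattern patternStep

/-- Compute the number of binary digits of the number in `half`. -/
def sizeLoop : Cmd :=
  .loop half (.const Reg.tmp 2 ;; .arith .div half half Reg.tmp ;; incr logStrings)

/-- Set the parameters, with `ℓ` for the number of binary digits of `n`: `A * ℓ` positions are
compared, `D * ℓ` mismatches are allowed, and the error patterns have relative weight `p / q`. -/
def setParams (A D p q : ℕ) : Cmd :=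
  (.const Reg.tmp 3 ;; .arith .add len logStrings Reg.tmp) ;;
  (.const Reg.tmp A ;; .arith .mul compared logStrings Reg.tmp) ;;
  (.const Reg.tmp D ;; .arith .mul allowed logStrings Reg.tmp) ;;
  (.const Reg.tmp 5 ;; .arith .mul blocks logStrings Reg.tmp) ;;
  (.const Reg.tmp p ;; .arith .mul radius len Reg.tmp) ;;
  (.const Reg.tmp q ;; .arith .div radius radius Reg.tmp) ;;
  .const patterns 0 ;; .const zero 0

/-- The part of the search program before its main loop. -/
def setUp (A D p q : ℕ) : Cmd :=
  (move strings 0 ;; move half 0) ;; sizeLoop ;; setParams A D p q ;; powTwo base len ;;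
  listPatterns

/-- The search program. It hashes the strings by `5 * ℓ` of their blocks, and compares two strings
completely if they differ in one of these blocks by one of the error patterns. The second output
register is cleared first because the length of the strings in it is unbounded. -/
def search (A D p q : ℕ) : Cmd :=
  .const 1 0 ;; setUp A D p q ;; move block blocks ;; countdown block searchBlock

/-- The strings `i`, `j` are different and have at most `thr` mismatches on the first `V`
positions. -/
def Similar (inp : ℕ → ℕ → ℕ) (n V thr i j : ℕ) : Prop :=
  i < n ∧ j < n ∧ i ≠ j ∧ mismatches inp i j 0 V ≤ thr

/-- The output registers hold a pair of similar strings. -/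
def Found (inp : ℕ → ℕ → ℕ) (n V thr : ℕ) (s : State) : Prop :=
  Similar inp n V thr (s.reg 0) (s.reg 1)

/-- `T` is a hash table for the blocks at the position `off` of the strings from `m` on; its
entries are numbers of strings, increased by one. -/
def IsHashTable (inp : ℕ → ℕ → ℕ) (n k off m : ℕ) (T : ℕ → ℕ) : Prop :=
  ∀ i, m ≤ i → i < n →
    ∃ j < n, T (readBits inp i off k) = j + 1 ∧ readBits inp j off k = readBits inp i off k

/-- The search has found a similar pair if there is one that a hash table of the block at `off`
and the light error patterns point to. -/
def BlockDone (inp : ℕ → ℕ → ℕ) (n k V thr t off : ℕ) (s : State) : Prop :=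
  ∃ T, IsHashTable inp n k off 0 T ∧ ∀ i < n, ∀ e ∈ lightWords k t,
    Similar inp n V thr i (T (readBits inp i off k ^^^ e) - 1) → Found inp n V thr s

/-- The first values of `N` are the elements of `S`, without repetitions. -/
def Enumerates (N : ℕ → ℕ) (S : Finset ℕ) : Prop := (Finset.range S.card).image N = S

/-- The values of the registers `SearchReg.shared`. -/
structure SearchState (n k V thr cnt : ℕ) (s : State) : Prop where
  strings : s.reg strings = n
  len : s.reg len = k
  base : s.reg base = 2 ^ k
  compared : s.reg compared = V
  allowed : s.reg allowed = thr
  patterns : s.reg patterns = cnt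
  zero : s.reg zero = 0

variable {B : ℕ} {inp : ℕ → ℕ → ℕ} {s s' : State} {n k V thr cnt : ℕ}

theorem Enumerates.mem_iff {N : ℕ → ℕ} {S : Finset ℕ} (h : Enumerates N S) {x : ℕ} :
    x ∈ S ↔ ∃ a < S.card, N a = x := by
  conv_lhs => rw [← h]
  simp only [Finset.mem_image, Finset.mem_range]

theorem Enumerates.congr {N N' : ℕ → ℕ} {S : Finset ℕ} (h : Enumerates N S)
    (hN : ∀ a < S.card, N' a = N a) : Enumerates N' S :=
  (Finset.image_congr fun a ha => hN a (by simpa using ha)).trans h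

theorem Enumerates.insert {N : ℕ → ℕ} {S : Finset ℕ} (h : Enumerates N S) {x : ℕ} (hx : x ∉ S) :
    Enumerates (Function.update N S.card x) (insert x S) := by
  rw [Enumerates, Finset.card_insert_of_notMem hx, Finset.range_add_one, Finset.image_insert,
    Function.update_self]
  congr 1
  exact h.congr fun a ha => Function.update_of_ne ha.ne _ _

theorem SearchState.frame {c : Cmd} (h : SearchState n k V thr cnt s) (hF : Frame c s s')
    (hc : ∀ x ∈ shared, c.writes x = false) :
    SearchState n k V thr cnt s' := by
  simp only [List.mem_cons, List.not_mem_nil, or_false, forall_eq_or_imp, forall_eq] at hc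
  obtain ⟨h2, h5, h6, h7, h8, h12, h30⟩ := hc
  exact ⟨(hF.reg _ h2).trans h.strings, (hF.reg _ h5).trans h.len, (hF.reg _ h6).trans h.base,
    (hF.reg _ h7).trans h.compared, (hF.reg _ h8).trans h.allowed,
    (hF.reg _ h12).trans h.patterns, (hF.reg _ h30).trans h.zero⟩

theorem Found.frame {c : Cmd} (hF : Frame c s s') (h0 : c.writes 0 = false)
    (h1 : c.writes 1 = false) (h : Found inp n V thr s) : Found inp n V thr s' := by
  rwa [Found, hF.reg 0 h0, hF.reg 1 h1]

theorem runs_countdown_found {r N T : ℕ} {c : Cmd} {P : ℕ → Prop} (hB : B ≠ 0)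
    (hw : c.writes r = false) (h0 : 0 ≠ r) (h1 : 1 ≠ r) (hr : r ≠ Reg.tmp) (hN : s.reg r = N)
    (hc : ∀ a < N, ∀ s', Frame (countdown r c) s s' → s'.reg r = a →
      Runs B inp c s' T fun t => Found inp n V thr s' ∨ P a → Found inp n V thr t) :
    Runs B inp (countdown r c) s (N * (T + 3) + 1) fun t =>
      (Found inp n V thr s ∨ ∃ a < N, P a) → Found inp n V thr t := by
  refine (Runs.countdown (fun j t => (Found inp n V thr s ∨ ∃ a, N - j ≤ a ∧ a < N ∧ P a) →
    Found inp n V thr t) hB hw hr hN ?_ ?_ fun j hj s' hF ha h => ?_).mono le_rfl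
    fun t _ h h' => h (h'.imp_right fun ⟨a, ha, hP⟩ => ⟨a, by omega, ha, hP⟩)
  · rintro (h | ⟨a, h, h', -⟩)
    · exact h
    · omega
  · intro j s u h
    simpa [Found, h0, h1] using h
  · refine (hc _ (by omega) s' hF ha).mono le_rfl fun t _ ht => ?_
    rintro (h' | ⟨a, ha', haN, hP⟩)
    · exact ht (.inl (h (.inl h')))
    · rcases Nat.eq_or_lt_of_le ha' with rfl | hlt
      · exact ht (.inr hP)
      · exact ht (.inl (h (.inr ⟨a, by omega, haN, hP⟩)))

theorem runs_readInto {r a o k K : ℕ} (hinp : ∀ i k, inp i k ≤ 1)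
    (ha : a < 40) (ho : o < 40) (hk : k < 40)
    (hK : s.reg k = K) (hB : K + 2 ≤ B) (hoB : s.reg o + K < 2 ^ B) :
    Runs B inp (readInto r a o k) s (7 * K + 6) fun s' =>
      s'.reg r = readBits inp (s.reg a) (s.reg o) K := by
  refine Runs.mono_steps ((runs_readWord hinp ha ho hk hK hB hoB).seq (T₂ := 2) fun t _ h =>
    Runs.of_eval le_rfl (fun hbd => ?_) ?_) (by omega)
  · have := hbd.reg Reg.bits
    simp only [Reg.bits] at this
    simp [move, Cmd.Safe, Cmd.eval, this]
  · simp [move, Cmd.eval, Op.eval, h]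

theorem runs_countMismatches {i j : ℕ} (hinp : ∀ i k, inp i k ≤ 1) (hB : V + 2 ≤ B)
    (hs : SearchState n k V thr cnt s) (hi : s.reg left = i) (hj : s.reg right = j) :
    Runs B inp countMismatches s (28 * V + 22) fun s' =>
      s'.reg Reg.weight = mismatches inp i j 0 V := by
  have hVB : V < 2 ^ B := (Nat.lt_two_pow_self).trans_le (Nat.pow_le_pow_right two_pos (by omega))
  refine Runs.mono_steps (Runs.seq (runs_readInto (K := V) hinp (by decide) (by decide) (by decide)
    hs.compared hB (by rwa [hs.zero, zero_add])) fun t hF h => ?_)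
    (T := (7 * V + 6) + ((7 * V + 6) + (14 * V + 10))) (by omega)
  have ht := hs.frame hF (by decide)
  refine Runs.seq (runs_readInto (K := V) hinp (by decide) (by decide) (by decide) ht.compared hB
    (by rwa [ht.zero, zero_add])) fun t' hF' h' => ?_
  have h_left : t'.reg leftBits = readBits inp i 0 V := by
    rw [hF'.reg leftBits rfl, h, hi, hs.zero]
  have h_right : t'.reg rightBits = readBits inp j 0 V := by
    rw [h', hF.reg right rfl, hj, ht.zero]
  refine (runs_xorWeight (by decide) (by decide) (by decide) (ht.frame hF' (by decide)).compared
    (h_left ▸ readBits_lt hinp i 0 V) (h_right ▸ readBits_lt hinp j 0 V) hB).mono le_rfl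
    fun t'' _ h'' => ?_
  rw [h''.2, h_left, h_right, wt_xor_readBits hinp]

theorem runs_compareStrings {i j : ℕ} (hinp : ∀ i k, inp i k ≤ 1) (hB : V + 2 ≤ B)
    (hs : SearchState n k V thr cnt s) (hi : s.reg left = i) (hj : s.reg right = j)
    (hin : i < n) (hjn : j < n) (hij : i ≠ j) :
    Runs B inp compareStrings s (28 * V + 28) fun s' =>
      Found inp n V thr s ∨ Similar inp n V thr i j → Found inp n V thr s' := by
  refine Runs.seq (T₂ := 6) (runs_countMismatches hinp hB hs hi hj) fun t hF h_weight => ?_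
  have h_left := (hF.reg left rfl).trans hi
  have h_right := (hF.reg right rfl).trans hj
  have h_allowed := (hs.frame hF (by decide)).allowed
  refine Runs.of_eval le_rfl (fun hbd => ?_) ?_
  · have := hbd.reg left
    have := hbd.reg right
    simp_all [Cmd.Safe, move, skip, Cmd.eval, Op.eval]
  · by_cases h : mismatches inp i j 0 V ≤ thr
    · have sim : Similar inp n V thr i j := ⟨hin, hjn, hij, h⟩
      simp [Cmd.eval, Op.eval, move, h_weight, h_allowed, Nat.sub_eq_zero_of_le h, Found, h_left,
        h_right, sim]
    · rintro (h' | h')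
      · simpa [Cmd.eval, Op.eval, skip, h_weight, h_allowed, Nat.sub_eq_zero_iff_le, h, Found]
          using h'.frame hF rfl rfl
      · exact absurd h'.2.2.2 h

theorem runs_tryPair {i y : ℕ} (hinp : ∀ i k, inp i k ≤ 1) (hB : V + 2 ≤ B)
    (hs : SearchState n k V thr cnt s) (hi : s.reg left = i) (hy : s.reg right = y)
    (hin : i < n) :
    Runs B inp tryPair s (28 * V + 36) fun s' =>
      Found inp n V thr s ∨ Similar inp n V thr i (y - 1) → Found inp n V thr s' := by
  have runs_skip {t : State} (hF : Found inp n V thr s → Found inp n V thr t)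
      (h : ¬ Similar inp n V thr i (y - 1)) : Runs B inp skip t (28 * V + 28) fun s' =>
      Found inp n V thr s ∨ Similar inp n V thr i (y - 1) → Found inp n V thr s' := by
    refine Runs.of_eval (Nat.le_add_left 1 _) (fun _ => by simp [skip, Cmd.Safe]) ?_
    simpa [h, skip, Cmd.eval, Found] using hF
  refine Runs.mono_steps (T := 6 + ((28 * V + 28) + 1 + 1))
    (Runs.eval_seq le_rfl (fun hbd => ?_) fun hF => ?_) (by omega)
  · have := hbd.reg left
    have := hbd.reg right
    have := Nat.one_lt_two_pow (n := B) (by omega)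
    simp only [left, right] at *
    simp [Cmd.Safe, decodeSlot, decr, Cmd.eval, Op.eval]
    omega
  · set t := Cmd.eval inp decodeSlot s with ht
    have h_excess : t.reg excess = y - n := by
      simp [ht, decodeSlot, decr, Cmd.eval, Op.eval, hy, hs.strings]
    have h_distance : t.reg distance = (i - (y - 1)) + ((y - 1) - i) := by
      simp [ht, decodeSlot, decr, Cmd.eval, Op.eval, hy, hi]
    have h_right : t.reg right = y - 1 := by
      simp [ht, decodeSlot, decr, Cmd.eval, Op.eval, hy]
    have found : Found inp n V thr s → Found inp n V thr t := Found.frame hF rfl rfl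
    refine Runs.ite (fun h => ?_) (fun h => Runs.ite (fun h' => ?_) (fun h' => ?_))
    · exact (runs_skip found fun hS => by have := hS.2.1; omega).mono_steps (by omega)
    · exact (runs_compareStrings hinp hB (hs.frame hF (by decide)) ((hF.reg left rfl).trans hi)
        h_right hin (by omega) (by omega)).mono le_rfl fun _ _ h => h ∘ Or.imp_left found
    · exact runs_skip found fun hS => hS.2.2.1 (by omega)

end

section

open SearchReg

variable {B : ℕ} {inp : ℕ → ℕ → ℕ} {s : State} {n k V thr cnt : ℕ}

theorem runs_probeStep {i h e : ℕ} (hinp : ∀ i k, inp i k ≤ 1) (hVB : V + 2 ≤ B)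
    (hkB : k + 2 ≤ B) (hs : SearchState n k V thr cnt s) (hi : s.reg left = i) (hin : i < n)
    (hkey : s.reg key = h) (hk : h < 2 ^ k) (he : s.mem (s.reg probe) = e) (hek : e < 2 ^ k) :
    Runs B inp probeStep s (28 * V + 14 * k + 49) fun s' =>
      Found inp n V thr s ∨ Similar inp n V thr i (s.mem (2 ^ k + (h ^^^ e)) - 1) →
      Found inp n V thr s' := by
  have := four_mul_two_pow_le hkB
  refine Runs.mono_steps (T := 1 + ((14 * k + 10) + (2 + (28 * V + 36)))) (Runs.eval_seq le_rfl
    (fun _ => by trivial) fun hF => ?_) (by omega)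
  set t := (Cmd.load slot probe).eval inp s
  have h_slot : t.reg slot = e := by simp [t, Cmd.eval, he]
  have h_key : t.reg key = h := (hF.reg key rfl).trans hkey
  have ht := hs.frame hF (by decide)
  refine Runs.seq (runs_xorWeight (by decide) (by decide) (by decide) ht.len (by rwa [h_key])
    (by rwa [h_slot]) hkB) fun t₁ hF₁ h_xor => ?_
  rw [h_key, h_slot] at h_xor
  have ht₁ := ht.frame hF₁ (by decide)
  refine Runs.eval_seq le_rfl (fun _ => ?_) fun hF₂ => ?_
  · have := Nat.xor_lt_two_pow hk hek
    have := ht₁.base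
    simp_all [Cmd.Safe]
    omega
  refine (runs_tryPair hinp hVB (ht₁.frame hF₂ (by decide))
    (y := s.mem (2 ^ k + (h ^^^ e))) ((hF₂.reg left rfl).trans ((hF₁.reg left rfl).trans
    ((hF.reg left rfl).trans hi))) ?_ hin).mono le_rfl fun _ _ h => h ∘ Or.imp_left fun hs =>
    ((hs.frame hF rfl rfl).frame hF₁ rfl rfl).frame hF₂ rfl rfl
  simp [Cmd.eval, Op.eval, h_xor.1, ht₁.base, hF₁.mem rfl, hF.mem rfl]

theorem runs_probeString {i off t : ℕ} (hinp : ∀ i k, inp i k ≤ 1) (hVB : V + 2 ≤ B)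
    (hkB : k + 2 ≤ B) (hoffB : off + k < 2 ^ B)
    (hs : SearchState n k V thr (lightWords k t).card s) (hoff : s.reg offset = off)
    (hi : s.reg left = i) (hin : i < n) (hmem : Enumerates s.mem (lightWords k t)) :
    Runs B inp probeString s ((lightWords k t).card * (28 * V + 14 * k + 52) + 7 * k + 9)
      fun s' => (Found inp n V thr s ∨ ∃ e ∈ lightWords k t,
        Similar inp n V thr i (s.mem (2 ^ k + (readBits inp i off k ^^^ e)) - 1)) →
      Found inp n V thr s' := by
  refine Runs.mono_steps (T := (7 * k + 6) + (2 + ((lightWords k t).card *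
    ((28 * V + 14 * k + 49) + 3) + 1))) (Runs.seq (runs_readInto hinp (by decide) (by decide)
    (by decide) hs.len hkB (by rwa [hoff])) fun t₁ hF h_key => ?_) (by ring_nf; omega)
  rw [hi, hoff] at h_key
  have ht₁ := hs.frame hF (by decide)
  refine Runs.eval_seq le_rfl (fun hbd => ?_) fun hF₁ => ?_
  · have := hbd.reg patterns
    simp only [patterns] at this
    simp [move, Cmd.Safe, Cmd.eval, this]
  set t₂ := (move probe patterns).eval inp t₁
  have h_key₂ := (hF₁.reg key rfl).trans h_key
  have h_mem₂ : t₂.mem = s.mem := (hF₁.mem rfl).trans (hF.mem rfl)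
  refine (runs_countdown_found (N := (lightWords k t).card) (n := n) (V := V) (thr := thr)
    (P := fun a => Similar inp n V thr i
      (s.mem (2 ^ k + (readBits inp i off k ^^^ s.mem a)) - 1))
    (by omega) rfl (by decide) (by decide) (by decide) ?_
    fun a ha t₃ hF₂ h_probe => ?_).mono le_rfl fun _ _ h => ?_
  · simp [t₂, move, Cmd.eval, Op.eval, ht₁.patterns]
  · have h_mem : t₃.mem = s.mem := (hF₂.mem rfl).trans h_mem₂
    have h_light := (mem_lightWords.1 (hmem.mem_iff.2 ⟨a, ha, rfl⟩)).1
    have h := runs_probeStep (e := s.mem a) hinp hVB hkB ((ht₁.frame hF₁ (by decide)).frame hF₂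
      (by decide)) ((hF₂.reg left rfl).trans ((hF₁.reg left rfl).trans ((hF.reg left rfl).trans
      hi))) hin ((hF₂.reg key rfl).trans h_key₂) (readBits_lt hinp i off k)
      (by rw [h_probe, h_mem]) h_light
    rwa [h_mem] at h
  · rintro (h' | ⟨e, he, hS⟩)
    · exact h (.inl ((h'.frame hF rfl rfl).frame hF₁ rfl rfl))
    · obtain ⟨a, ha, rfl⟩ := hmem.mem_iff.1 he
      exact h (.inr ⟨a, ha, hS⟩)

theorem runs_insertString {j off : ℕ} (hinp : ∀ i k, inp i k ≤ 1)
    (hkB : k + 2 ≤ B) (hoffB : off + k < 2 ^ B) (hs : SearchState n k V thr cnt s)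
    (hoff : s.reg offset = off) (hj : s.reg left = j) (hjn : j < n) :
    Runs B inp insertString s (7 * k + 10) fun s' =>
      s'.mem = Function.update s.mem (2 ^ k + readBits inp j off k) (j + 1) := by
  have := four_mul_two_pow_le hkB
  refine Runs.seq (T₂ := 6) (runs_readWord hinp (by decide) (by decide) (by decide) hs.len hkB
    (by rwa [hoff])) fun t hF h => Runs.of_eval le_rfl (fun hbd => ?_) ?_
  · have := hbd.reg strings
    have := readBits_lt hinp j off k
    have ht := hs.frame hF (by decide)
    have h_left := (hF.reg left rfl).trans hj
    have h_strings := ht.strings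
    have h_base := ht.base
    simp_all [Cmd.Safe, move, incr, Cmd.eval, Op.eval]
    omega
  · have ht := hs.frame hF (by decide)
    simp [move, incr, Cmd.eval, Op.eval, State.setMem, h, ht.base, hF.mem rfl,
      (hF.reg left rfl).trans hj, hj, hoff]

theorem IsHashTable.update {off m : ℕ} {T : ℕ → ℕ} (h : IsHashTable inp n k off (m + 1) T)
    (hm : m < n) :
    IsHashTable inp n k off m (Function.update T (readBits inp m off k) (m + 1)) := by
  intro i hmi hin
  by_cases he : readBits inp i off k = readBits inp m off k
  · exact ⟨m, hm, by rw [he, Function.update_self], he.symm⟩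
  · obtain ⟨j, hj, hT, hbits⟩ := h i (Nat.lt_of_le_of_ne hmi fun h => he (by rw [h])) hin
    exact ⟨j, hj, by rw [Function.update_of_ne he, hT], hbits⟩

theorem runs_fillTable {off : ℕ} (hinp : ∀ i k, inp i k ≤ 1) (hkB : k + 2 ≤ B)
    (hoffB : off + k < 2 ^ B) (hs : SearchState n k V thr cnt s) (hoff : s.reg offset = off) :
    Runs B inp fillTable s (n * (7 * k + 13) + 3) fun s' =>
      (∀ a < 2 ^ k, s'.mem a = s.mem a) ∧
      IsHashTable inp n k off 0 fun h => s'.mem (2 ^ k + h) := by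
  refine (Runs.eval_countdown (N := n) (T := 7 * k + 10) (fun j s' =>
    (∀ a < 2 ^ k, s'.mem a = s.mem a) ∧ IsHashTable inp n k off (n - j) fun h =>
    s'.mem (2 ^ k + h)) (by omega) (le_refl 2) (fun hbd => ?_) rfl (by decide) ?_ ?_
    (fun _ _ _ h => h) fun j hj s' hF h_left ⟨h_low, h_table⟩ => ?_).mono
    (by ring_nf; omega) fun s' _ h => by rwa [Nat.sub_self] at h
  · have := hbd.reg strings
    simp only [strings] at this
    simp [move, Cmd.Safe, Cmd.eval, this]
  · simp [move, Cmd.eval, Op.eval, hs.strings]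
  · exact ⟨fun _ _ => rfl, fun i hi hi' => by omega⟩
  · rw [show n - j = n - (j + 1) + 1 by omega] at h_table
    refine (runs_insertString hinp hkB hoffB (hs.frame hF (by decide))
      ((hF.reg offset rfl).trans hoff) h_left (by omega)).mono le_rfl
      fun t _ ht => ⟨fun a ha => ?_, ?_⟩
    · rw [ht, Function.update_of_ne (by omega), h_low a ha]
    · convert h_table.update (by omega) using 2 with h
      simp only [ht, Function.update_apply, Nat.add_left_cancel_iff]

theorem runs_probeTable {off t : ℕ} (hinp : ∀ i k, inp i k ≤ 1) (hVB : V + 2 ≤ B)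
    (hkB : k + 2 ≤ B) (hoffB : off + k < 2 ^ B)
    (hs : SearchState n k V thr (lightWords k t).card s) (hoff : s.reg offset = off)
    (hmem : Enumerates s.mem (lightWords k t)) :
    Runs B inp probeTable s
      (n * ((lightWords k t).card * (28 * V + 14 * k + 52) + 7 * k + 12) + 3) fun s' =>
      (Found inp n V thr s ∨ ∃ i < n, ∃ e ∈ lightWords k t,
        Similar inp n V thr i (s.mem (2 ^ k + (readBits inp i off k ^^^ e)) - 1)) →
      Found inp n V thr s' := by
  refine Runs.mono_steps (T := 2 + (n * (((lightWords k t).card * (28 * V + 14 * k + 52) + 7 * k +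
    9) + 3) + 1)) (Runs.eval_seq le_rfl (fun hbd => ?_) fun hF => ?_) (by ring_nf; omega)
  · have := hbd.reg strings
    simp only [strings] at this
    simp [move, Cmd.Safe, Cmd.eval, this]
  refine (runs_countdown_found (N := n) (P := fun i => ∃ e ∈ lightWords k t, Similar inp n V thr i
    (s.mem (2 ^ k + (readBits inp i off k ^^^ e)) - 1)) (by omega) rfl (by decide)
    (by decide) (by decide) ?_ fun i hi s' hF' h_left => ?_).mono le_rfl
    fun _ _ h h' => h (h'.imp_left fun h => h.frame hF rfl rfl)
  · simp [move, Cmd.eval, Op.eval, hs.strings]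
  · have h_mem : s'.mem = s.mem := (hF'.mem rfl).trans (hF.mem rfl)
    have h := runs_probeString hinp hVB hkB hoffB ((hs.frame hF (by decide)).frame hF' (by decide))
      ((hF'.reg offset rfl).trans ((hF.reg offset rfl).trans hoff)) h_left hi (by rwa [h_mem])
    rwa [h_mem] at h

theorem runs_searchBlock {b t : ℕ} (hinp : ∀ i k, inp i k ≤ 1) (hVB : V + 2 ≤ B)
    (hkB : k + 2 ≤ B) (hoffB : b * k + k < 2 ^ B)
    (hs : SearchState n k V thr (lightWords k t).card s) (hb : s.reg block = b)
    (hmem : Enumerates s.mem (lightWords k t)) :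
    Runs B inp searchBlock s (n * (7 * k + 13) +
      n * ((lightWords k t).card * (28 * V + 14 * k + 52) + 7 * k + 12) + 7) fun s' =>
      (Found inp n V thr s → Found inp n V thr s') ∧ Enumerates s'.mem (lightWords k t) ∧
      BlockDone inp n k V thr t (b * k) s' := by
  refine Runs.mono_steps (T := 1 + ((n * (7 * k + 13) + 3) +
    (n * ((lightWords k t).card * (28 * V + 14 * k + 52) + 7 * k + 12) + 3)))
    (Runs.eval_seq le_rfl (fun _ => ?_) fun hF => ?_) (by omega)
  · have := hs.len
    simp_all [Cmd.Safe]
    omega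
  have h_offset : ((Cmd.arith .mul offset block len).eval inp s).reg offset = b * k := by
    have := hs.len
    simp_all [Cmd.eval, Op.eval]
  have h₁ := hs.frame hF (by decide)
  refine (runs_fillTable hinp hkB hoffB h₁ h_offset).seq fun s₂ hF₂ ⟨h_low, h_table⟩ => ?_
  have h_mem : Enumerates s₂.mem (lightWords k t) :=
    hmem.congr fun a ha => h_low a (ha.trans_le (card_lightWords_le_two_pow k t))
  refine (runs_probeTable hinp hVB hkB hoffB (h₁.frame hF₂ (by decide))
    ((hF₂.reg offset rfl).trans h_offset) h_mem).mono le_rfl fun s₃ hF₃ h => ⟨fun h' =>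
    h (.inl ((h'.frame hF rfl rfl).frame hF₂ rfl rfl)), by rwa [hF₃.mem rfl],
    _, h_table, fun i hi e he hS => h (.inr ⟨i, hi, e, he, hS⟩)⟩

end

section

open SearchReg

/-- The light patterns from `m` on are listed in the first memory cells, and `patterns` holds
their number. -/
def PatternsListed (k t m : ℕ) (s : State) : Prop :=
  s.reg patterns = ((lightWords k t).filter (m ≤ ·)).card ∧
    Enumerates s.mem ((lightWords k t).filter (m ≤ ·))

variable {B : ℕ} {inp : ℕ → ℕ → ℕ} {s s' : State} {n k V thr cnt t : ℕ}

theorem filter_le_lightWords_of_mem {v : ℕ} (hv : v ∈ lightWords k t) :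
    (lightWords k t).filter (v ≤ ·) = insert v ((lightWords k t).filter (v + 1 ≤ ·)) := by
  ext e
  simp only [Finset.mem_filter, Finset.mem_insert]
  grind

theorem filter_le_lightWords_of_notMem {v : ℕ} (hv : v ∉ lightWords k t) :
    (lightWords k t).filter (v ≤ ·) = (lightWords k t).filter (v + 1 ≤ ·) := by
  ext e
  simp only [Finset.mem_filter]
  grind

theorem runs_patternStep {v : ℕ} (hB : k + 2 ≤ B) (h_len : s.reg len = k)
    (h_radius : s.reg radius = t) (h_zero : s.reg zero = 0) (h_pattern : s.reg pattern = v)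
    (hv : v < 2 ^ k) (h : PatternsListed k t (v + 1) s) :
    Runs B inp patternStep s (14 * k + 15) (PatternsListed k t v) := by
  have := four_mul_two_pow_le hB
  have := Nat.two_pow_pos k
  refine Runs.seq (T₂ := 5) (runs_xorWeight (by decide) (by decide) (by decide) h_len
    (by rwa [h_pattern]) (by rwa [h_zero]) hB) fun u hF hw => ?_
  rw [h_pattern, h_zero, Nat.xor_zero] at hw
  have h_radius := (hF.reg radius rfl).trans h_radius
  have h_pattern := (hF.reg pattern rfl).trans h_pattern
  have h_patterns := (hF.reg patterns rfl).trans h.1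
  have h_card := (Finset.card_filter_le (lightWords k t) (v + 1 ≤ ·)).trans
    (card_lightWords_le_two_pow k t)
  refine Runs.of_eval le_rfl (fun _ => ?_) ?_
  · simp_all [Cmd.Safe, skip, incr, Cmd.eval, Op.eval]
    omega
  by_cases hwt : wt k v ≤ t
  · have h_new : v ∉ (lightWords k t).filter (v + 1 ≤ ·) := by simp
    rw [PatternsListed, filter_le_lightWords_of_mem (mem_lightWords.2 ⟨hv, hwt⟩),
      Finset.card_insert_of_notMem h_new]
    convert And.intro rfl (h.2.insert h_new) using 2 <;>
    simp [incr, Cmd.eval, Op.eval, hw.2, h_radius, h_patterns, h_pattern,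
      Nat.sub_eq_zero_of_le hwt, State.setMem, hF.mem rfl]
  · rw [PatternsListed, filter_le_lightWords_of_notMem fun h => hwt (mem_lightWords.1 h).2]
    simpa [skip, Cmd.eval, Op.eval, hw.2, h_radius, h_patterns, Nat.sub_eq_zero_iff_le, hwt,
      hF.mem rfl] using h.2

theorem runs_listPatterns (hB : k + 2 ≤ B) (h_len : s.reg len = k) (h_base : s.reg base = 2 ^ k)
    (h_radius : s.reg radius = t) (h_zero : s.reg zero = 0) (h_patterns : s.reg patterns = 0) :
    Runs B inp listPatterns s (2 ^ k * (14 * k + 18) + 3) fun s' =>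
      s'.reg patterns = (lightWords k t).card ∧ Enumerates s'.mem (lightWords k t) := by
  have h_none : (lightWords k t).filter (2 ^ k ≤ ·) = ∅ :=
    Finset.filter_false_of_mem fun e he => not_le.2 (mem_lightWords.1 he).1
  refine (Runs.eval_countdown (N := 2 ^ k) (T := 14 * k + 15)
    (fun j => PatternsListed k t (2 ^ k - j)) (by omega) (le_refl 2) (fun hbd => ?_) rfl
    (by decide) ?_ ?_ (fun _ s u h => ?_) fun j hj s' hF h_pattern h => ?_).mono
    (by ring_nf; omega) fun s' _ h => by simpa [PatternsListed] using h
  · have := hbd.reg base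
    simp only [base] at this
    simp [move, Cmd.Safe, Cmd.eval, this]
  · simp [move, Cmd.eval, Op.eval, h_base]
  · rw [PatternsListed, Nat.sub_zero, h_none]
    simp [move, Cmd.eval, Op.eval, h_patterns, Enumerates]
  · simpa [PatternsListed] using h
  · rw [show 2 ^ k - j = 2 ^ k - (j + 1) + 1 by omega] at h
    exact runs_patternStep hB ((hF.reg len rfl).trans h_len) ((hF.reg radius rfl).trans h_radius)
      ((hF.reg zero rfl).trans h_zero) h_pattern (by omega) h

theorem size_div_two {m v : ℕ} (h : m.size = v + 1) : (m / 2).size = v := by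
  have hm : Nat.bit m.bodd (m / 2) = m := by rw [← Nat.div2_val, Nat.bit_bodd_div2]
  have := Nat.size_bit (b := m.bodd) (n := m / 2) (by rw [hm]; rintro rfl; simp at h)
  rw [hm] at this
  omega

theorem runs_sizeLoop (hB : n.size + 2 ≤ B) (h_half : s.reg half = n)
    (h_log : s.reg logStrings = 0) :
    Runs B inp sizeLoop s (5 * n.size + 1) fun s' => s'.reg logStrings = n.size := by
  have := four_mul_two_pow_le hB
  have := Nat.lt_two_pow_self (n := n.size)
  refine (Runs.loop (T := 4) (fun v s' => (s'.reg half).size = v ∧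
    s'.reg logStrings + v = n.size) (fun _ h => Nat.size_eq_zero.1 h.1) (fun v s' h => ?_)
    n.size s ⟨by rw [h_half], by omega⟩).mono (by omega) fun _ _ h => h.2
  obtain ⟨h_size, h_sum⟩ := h
  have h_half := size_div_two h_size
  refine ⟨fun h => by simp [h] at h_size, Runs.of_eval le_rfl (fun _ => ?_) ?_⟩
  · simp only [logStrings] at h_sum
    simp [Cmd.Safe, incr, Cmd.eval]
    omega
  · simp only [half, logStrings] at h_half h_sum
    simp [incr, Cmd.eval, Op.eval, h_half]
    omega

end

section

open SearchReg

variable {B : ℕ} {inp : ℕ → ℕ → ℕ} {s s' : State} {n k V thr t off A D p q : ℕ}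

theorem BlockDone.mono (h : BlockDone inp n k V thr t off s)
    (hs : Found inp n V thr s → Found inp n V thr s') : BlockDone inp n k V thr t off s' := by
  obtain ⟨T, h_table, h_done⟩ := h
  exact ⟨T, h_table, fun i hi e he hS => hs (h_done i hi e he hS)⟩

theorem searchParameters_le {ℓ : ℕ} (hB : (A + D + p + q + 10) * (ℓ + 3) ^ 2 ≤ B) :
    (A + A * ℓ) + (D + D * ℓ) + (p + (ℓ + 3) * p) + q + 10 * (ℓ + 3) ^ 2 ≤ B := by
  have h₁ : ℓ + 1 ≤ (ℓ + 3) ^ 2 := by nlinarith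
  have h₂ : ℓ + 4 ≤ (ℓ + 3) ^ 2 := by nlinarith
  calc (A + A * ℓ) + (D + D * ℓ) + (p + (ℓ + 3) * p) + q + 10 * (ℓ + 3) ^ 2
      = A * (ℓ + 1) + D * (ℓ + 1) + p * (ℓ + 4) + q * 1 + 10 * (ℓ + 3) ^ 2 := by ring
    _ ≤ A * (ℓ + 3) ^ 2 + D * (ℓ + 3) ^ 2 + p * (ℓ + 3) ^ 2 + q * (ℓ + 3) ^ 2 +
          10 * (ℓ + 3) ^ 2 := by gcongr; omega
    _ = (A + D + p + q + 10) * (ℓ + 3) ^ 2 := by ring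
    _ ≤ B := hB

theorem runs_setParams {ℓ : ℕ} (hB : (A + D + p + q + 10) * (ℓ + 3) ^ 2 ≤ B)
    (h_log : s.reg logStrings = ℓ) :
    Runs B inp (setParams A D p q) s 14 fun s' =>
      (s'.reg len = ℓ + 3 ∧ s'.reg compared = A * ℓ ∧ s'.reg allowed = D * ℓ) ∧
      s'.reg blocks = 5 * ℓ ∧ s'.reg radius = (ℓ + 3) * p / q ∧ s'.reg patterns = 0 ∧
      s'.reg zero = 0 := by
  have := searchParameters_le hB
  have := Nat.le_self_pow two_ne_zero (ℓ + 3)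
  have := Nat.lt_two_pow_self (n := B)
  refine Runs.of_eval le_rfl (fun _ => ?_) ?_
  · simp only [logStrings] at h_log
    simp only [Cmd.Safe, setParams, Cmd.eval, Op.eval, State.reg_setReg, ↓reduceIte, Reg.tmp,
      logStrings, len, compared, allowed, blocks, radius, Nat.reduceEqDiff, h_log, mul_comm ℓ]
    refine ⟨⟨?_, ?_⟩, ⟨?_, ?_⟩, ⟨?_, ?_⟩, ⟨?_, ?_⟩, ⟨?_, ?_⟩, ⟨?_, trivial⟩, ?_, ?_⟩ <;> omega
  · simp only [logStrings] at h_log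
    simp [setParams, Cmd.eval, Op.eval, h_log, mul_comm ℓ]

theorem runs_setUp (hB : (A + D + p + q + 10) * (n.size + 3) ^ 2 ≤ B) (h0 : s.reg 0 = n)
    (h_log : s.reg logStrings = 0) (ht : (n.size + 3) * p / q = t) :
    Runs B inp (setUp A D p q) s
      (4 + ((5 * n.size + 1) + (14 + ((4 * (n.size + 3) + 4) +
        (2 ^ (n.size + 3) * (14 * (n.size + 3) + 18) + 3))))) fun s' =>
      SearchState n (n.size + 3) (A * n.size) (D * n.size) (lightWords (n.size + 3) t).card s' ∧
      Enumerates s'.mem (lightWords (n.size + 3) t) ∧ s'.reg blocks = 5 * n.size := by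
  have := searchParameters_le hB
  have hk : n.size + 3 + 2 ≤ B := by nlinarith
  refine Runs.eval_seq le_rfl (fun hbd => ?_) fun hF₁ => ?_
  · have := hbd.reg 0
    simp_all [Cmd.Safe, move, Cmd.eval]
  have h_strings : ((move strings 0 ;; move half 0).eval inp s).reg strings = n := by
    simp [move, Cmd.eval, Op.eval, h0]
  refine (runs_sizeLoop (n := n) (by omega) (by simp [move, Cmd.eval, Op.eval, h0])
    ((hF₁.reg logStrings rfl).trans h_log)).seq fun s₂ hF₂ h_log => ?_
  refine (runs_setParams hB h_log).seq fun s₃ hF₃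
    ⟨⟨h_len, h_compared, h_allowed⟩, h_blocks, h_radius, h_patterns, h_zero⟩ => ?_
  refine (runs_powTwo (by decide) (by decide) h_len hk).seq fun s₄ hF₄ h_base => ?_
  refine (runs_listPatterns (t := t) hk ((hF₄.reg len rfl).trans h_len) h_base
    ((hF₄.reg radius rfl).trans (h_radius.trans ht)) ((hF₄.reg zero rfl).trans h_zero)
    ((hF₄.reg patterns rfl).trans h_patterns)).mono le_rfl fun s₅ hF₅ ⟨h_card, h_list⟩ => ?_
  have reg_eq {r : ℕ} (h₄ : (powTwo base len).writes r = false)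
      (h₅ : listPatterns.writes r = false) : s₅.reg r = s₃.reg r :=
    (hF₅.reg r h₅).trans (hF₄.reg r h₄)
  refine ⟨⟨?_, (reg_eq rfl rfl).trans h_len, (hF₅.reg base rfl).trans h_base,
    (reg_eq rfl rfl).trans h_compared, (reg_eq rfl rfl).trans h_allowed, h_card,
    (reg_eq rfl rfl).trans h_zero⟩, h_list, (reg_eq rfl rfl).trans h_blocks⟩
  rw [reg_eq rfl rfl, hF₃.reg strings rfl, hF₂.reg strings rfl, h_strings]

theorem runs_searchBlocks {N : ℕ} (hinp : ∀ i k, inp i k ≤ 1) (hVB : V + 2 ≤ B) (hkB : k + 2 ≤ B)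
    (hN : N * k < 2 ^ B) (hs : SearchState n k V thr (lightWords k t).card s)
    (h_blocks : s.reg blocks = N) (hmem : Enumerates s.mem (lightWords k t)) :
    Runs B inp (move block blocks ;; countdown block searchBlock) s
      (2 + (N * ((n * (7 * k + 13) +
        n * ((lightWords k t).card * (28 * V + 14 * k + 52) + 7 * k + 12) + 7) + 3) + 1))
      fun s' => ∀ b < N, BlockDone inp n k V thr t (b * k) s' := by
  refine (Runs.eval_countdown (N := N) (fun j s' => Enumerates s'.mem (lightWords k t) ∧
    ∀ b < N, N - j ≤ b → BlockDone inp n k V thr t (b * k) s') (by omega) (le_refl 2)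
    (fun hbd => ?_) rfl (by decide) ?_ ?_
    (fun _ _ _ h => by simpa [BlockDone, Found] using h) fun j hj s' hF h_block h => ?_).mono le_rfl
    fun s' _ h b hb => h.2 b hb (by omega)
  · have := hbd.reg blocks
    simp only [blocks] at this
    simp [move, Cmd.Safe, Cmd.eval, this]
  · simp [move, Cmd.eval, Op.eval, h_blocks]
  · exact ⟨hmem, fun b hb hb' => by omega⟩
  · have h_off : (N - (j + 1)) * k + k ≤ N * k := by
      rw [← Nat.succ_mul]
      exact Nat.mul_le_mul_right k (by omega)
    refine (runs_searchBlock hinp hVB hkB (h_off.trans_lt hN) (hs.frame hF (by decide)) h_block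
      h.1).mono le_rfl fun s'' _ ⟨h_found, h_list, h_done⟩ => ⟨h_list, fun b hb hb' => ?_⟩
    rcases Nat.eq_or_lt_of_le hb' with rfl | hlt
    · exact h_done
    · exact (h.2 b hb (by omega)).mono h_found

/-- The number of steps of the search for `ℓ`-digit `n`, on which it compares `V` positions of
the strings, with `cnt` error patterns. -/
def searchSteps (ℓ n V cnt : ℕ) : ℕ :=
  5 * ℓ * (n * (7 * (ℓ + 3) + 13) + n * (cnt * (28 * V + 14 * (ℓ + 3) + 52) + 7 * (ℓ + 3) + 12) +
    10) + 2 ^ (ℓ + 3) * (14 * (ℓ + 3) + 18) + 9 * ℓ + 41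

theorem exec_search {L : ℕ} {mem : ℕ → ℕ} (hinp : ∀ i k, inp i k ≤ 1)
    (hB : (A + D + p + q + 10) * (n.size + 3) ^ 2 ≤ B) (hmem : ∀ a, mem a < 2 ^ B)
    (ht : (n.size + 3) * p / q = t) :
    ∃ (T : ℕ) (s' : State), Exec inp (search A D p q) (initState [n, L] mem) T s' ∧
      T ≤ 1 + searchSteps n.size n (A * n.size) (lightWords (n.size + 3) t).card * (2 * B + 1) ∧
      ∀ b < 5 * n.size, BlockDone inp n (n.size + 3) (A * n.size) (D * n.size) t
        (b * (n.size + 3)) s' := by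
  have h_params := searchParameters_le hB
  have hBB := Nat.lt_two_pow_self (n := B)
  set s₀ := (initState [n, L] mem).setReg 1 0 with hs₀
  have hbd : Bounded B s₀ := by
    refine ⟨fun r => ?_, hmem⟩
    rcases r with _ | _ | r
    · exact Nat.size_le.1 (by simp [hs₀, initState]; nlinarith)
    · simp [hs₀]
    · simp [hs₀, initState]
  obtain ⟨T, s', h_exec, h_le, -, h_done⟩ :=
    (runs_setUp (s := s₀) (inp := inp) hB (by simp [hs₀, initState]) (by simp [hs₀, initState])
      ht).seq (fun s₁ _ ⟨hs₁, h_list, h_blocks⟩ => runs_searchBlocks hinp (by nlinarith)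
        (by nlinarith) (by nlinarith) hs₁ h_blocks h_list) hbd
  refine ⟨_, s', .seq (.const _ 1 0) h_exec, ?_, h_done⟩
  refine (Nat.add_le_add_left h_le _).trans (le_of_eq ?_)
  rw [searchSteps, Nat.size_zero]
  ring

end

/-! ### The search succeeds with high probability -/

section Instances

variable {n L : ℕ}

/-- The positions `off, …, off + K - 1`. -/
def positions (L off K : ℕ) : Finset (Fin L) :=
  Finset.univ.filter fun q => off ≤ (q : ℕ) ∧ (q : ℕ) < off + K

theorem mem_positions {off K : ℕ} {q : Fin L} :
    q ∈ positions L off K ↔ off ≤ (q : ℕ) ∧ (q : ℕ) < off + K := by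
  simp only [positions, Finset.mem_filter, Finset.mem_univ, true_and]

theorem map_positions {off K : ℕ} (h : off + K ≤ L) :
    (positions L off K).map Fin.valEmbedding = (Finset.range K).map (addLeftEmbedding off) := by
  ext x
  simp only [Finset.mem_map, mem_positions, Fin.valEmbedding_apply, Finset.mem_range,
    addLeftEmbedding_apply]
  constructor
  · rintro ⟨q, hq, rfl⟩
    exact ⟨q - off, by omega, by omega⟩
  · rintro ⟨p, hp, rfl⟩
    exact ⟨⟨off + p, by omega⟩, ⟨by simp, by simpa using hp⟩, rfl⟩

theorem card_positions {off K : ℕ} (h : off + K ≤ L) : (positions L off K).card = K := by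
  rw [← Finset.card_map Fin.valEmbedding, map_positions h, Finset.card_map, Finset.card_range]

theorem Strings.input_le_one (X : Strings n L) (i k : ℕ) : X.input i k ≤ 1 := by
  unfold Strings.input
  split
  · exact Bool.toNat_le _
  · exact zero_le_one

theorem Strings.input_ne_input_iff (X : Strings n L) (i j : Fin n) (q : Fin L) :
    X.input i q ≠ X.input j q ↔ X q i ≠ X q j := by
  simp only [Strings.input, Fin.is_lt, and_self, dite_true, Fin.eta]
  cases X q i <;> cases X q j <;> decide

theorem mismatches_input (X : Strings n L) (i j : Fin n) {off K : ℕ} (h : off + K ≤ L) :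
    mismatches X.input i j off K = hits (positions L off K) (differ i j) X := by
  classical
  have shifted : mismatches X.input i j off K =
      (((Finset.range K).map (addLeftEmbedding off)).filter
        fun p => X.input i p ≠ X.input j p).card := by
    rw [Finset.filter_map, Finset.card_map]
    rfl
  rw [shifted, ← map_positions h, Finset.filter_map, Finset.card_map, hits]
  exact congrArg Finset.card (Finset.filter_congr fun q _ => X.input_ne_input_iff i j q)

/-- In the block at `off`, the strings `a` and `b` differ in at most `t` positions, and no other
string agrees with `b`: a hash table of the block leads from `a` or `b` to the other one. -/
def GoodBlock (a b : Fin n) (k t off : ℕ) (X : Strings n L) : Prop :=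
  mismatches X.input a b off k ≤ t ∧
    ∀ j : Fin n, j ≠ a → j ≠ b → mismatches X.input j b off k ≠ 0

/-- The first `V` positions tell `a` and `b` from all other pairs, and one of the first `N` blocks
of length `k` is good. -/
def GoodInstance (a b : Fin n) (V thr k t N : ℕ) (X : Strings n L) : Prop :=
  (∀ i j : Fin n, i ≠ j →
    (mismatches X.input i j 0 V ≤ thr ↔ (i = a ∧ j = b ∨ i = b ∧ j = a))) ∧
  ∃ β < N, GoodBlock a b k t (β * k) X

variable {a b : Fin n} {V thr k t N : ℕ} {X : Strings n L} {s : State}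

theorem GoodBlock.table_eq {off : ℕ} (hX : GoodBlock a b k t off X) {T : ℕ → ℕ}
    (hT : IsHashTable X.input n k off 0 T) :
    T (readBits X.input b off k) = a + 1 ∨ T (readBits X.input b off k) = b + 1 := by
  obtain ⟨y, hy, table_eq, block_eq⟩ := hT b (Nat.zero_le _) b.2
  lift y to Fin n using hy
  have agree : mismatches X.input y b off k = 0 := by
    rw [← wt_xor_readBits X.input_le_one, block_eq, Nat.xor_self, wt_zero_right]
  by_cases hya : y = a
  · exact Or.inl (hya ▸ table_eq)
  · by_cases hyb : y = b
    · exact Or.inr (hyb ▸ table_eq)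
    · exact absurd agree (hX.2 y hya hyb)

theorem GoodBlock.found {off : ℕ} (hX : GoodBlock a b k t off X)
    (hab : Similar X.input n V thr a b) (hba : Similar X.input n V thr b a)
    (hs : BlockDone X.input n k V thr t off s) : Found X.input n V thr s := by
  obtain ⟨T, hT, lookup⟩ := hs
  have block_lt (i : ℕ) : readBits X.input i off k < 2 ^ k := readBits_lt X.input_le_one i off k
  rcases hX.table_eq hT with h | h
  · refine lookup b b.2 0 (mem_lightWords.2 ⟨by positivity, by simp [wt_zero_right]⟩) ?_
    simpa only [Nat.xor_zero, h, Nat.add_sub_cancel] using hba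
  · refine lookup a a.2 (readBits X.input a off k ^^^ readBits X.input b off k)
      (mem_lightWords.2 ⟨Nat.xor_lt_two_pow (block_lt a) (block_lt b), ?_⟩) ?_
    · rw [wt_xor_readBits X.input_le_one]
      exact hX.1
    · simpa only [← Nat.xor_assoc, Nat.xor_self, Nat.zero_xor, h, Nat.add_sub_cancel] using hab

theorem GoodInstance.output (hab : a ≠ b) (hX : GoodInstance a b V thr k t N X)
    (hs : ∀ β < N, BlockDone X.input n k V thr t (β * k) s) :
    (s.reg 0 = a ∧ s.reg 1 = b) ∨ (s.reg 0 = b ∧ s.reg 1 = a) := by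
  obtain ⟨judged, β, hβ, good⟩ := hX
  have hab' : (a : ℕ) ≠ b := Fin.val_ne_of_ne hab
  obtain ⟨h0, h1, hne, hm⟩ := good.found
    ⟨a.2, b.2, hab', (judged a b hab).2 (Or.inl ⟨rfl, rfl⟩)⟩
    ⟨b.2, a.2, hab'.symm, (judged b a hab.symm).2 (Or.inr ⟨rfl, rfl⟩)⟩ (hs β hβ)
  have := (judged ⟨s.reg 0, h0⟩ ⟨s.reg 1, h1⟩ fun e => hne (congrArg Fin.val e)).1 hm
  simpa only [Fin.ext_iff] using this

theorem dependsOn_goodBlock (a b : Fin n) (k t : ℕ) {off : ℕ} (h : off + k ≤ L) :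
    DependsOn (GoodBlock (L := L) a b k t off) (positions L off k) := by
  intro (X : Strings n L) (Y : Strings n L) hXY
  have congr (i j : Fin n) : mismatches X.input i j off k = mismatches Y.input i j off k := by
    rw [mismatches_input X i j h, mismatches_input Y i j h]
    exact hits_congr hXY _
  simp only [GoodBlock, congr]

end Instances

section Probability

variable {ρ : ℝ} {n L : ℕ} {a b : Fin n}

theorem measureReal_lt_mismatches_le (h0 : 0 ≤ ρ) (h1 : ρ ≤ 1) (hab : a ≠ b) {k t off : ℕ}
    (hL : off + k ≤ L) (ht : (1 - ρ) * k ≤ t + 1) :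
    (instanceLaw ρ a b L).real {X | t < mismatches X.input a b off k} ≤ 1 / 2 := by
  have := isProbabilityMeasure_columnLaw h0 h1 a b
  have markov := mul_measureReal_le_hits_le (columnLaw ρ a b) (E := differ a b) .of_discrete
    (positions L off k) (t + 1)
  rw [columnLaw_real_differ_pair h0 h1 hab, card_positions hL] at markov
  have hset : {X : Strings n L | t < mismatches X.input a b off k} =
      {X | (t : ℝ) + 1 ≤ hits (positions L off k) (differ a b) X} := by
    ext X
    rw [Set.mem_ofPred_eq, Set.mem_ofPred_eq, mismatches_input X a b hL]
    exact_mod_cast Nat.lt_iff_add_one_le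
  rw [hset, instanceLaw]
  have ht0 : (0 : ℝ) < t + 1 := by positivity
  refine le_of_mul_le_mul_left ?_ ht0
  linarith

theorem measureReal_mismatches_eq_zero (h0 : 0 ≤ ρ) (h1 : ρ ≤ 1) {k off : ℕ}
    (hL : off + k ≤ L) {j : Fin n} (hja : j ≠ a) (hjb : j ≠ b) :
    (instanceLaw ρ a b L).real {X | mismatches X.input j b off k = 0} = (1 / 2) ^ k := by
  have := isProbabilityMeasure_columnLaw h0 h1 a b
  simp only [mismatches_input _ _ _ hL, hits_eq_zero_iff, instanceLaw]
  rw [measureReal_pi_forall_mem, card_positions hL, probReal_compl_eq_one_sub .of_discrete,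
    columnLaw_real_differ_other h0 h1 hjb (by tauto)]
  norm_num

theorem measureReal_not_goodBlock_le (h0 : 0 ≤ ρ) (h1 : ρ ≤ 1) (hab : a ≠ b) {k t off : ℕ}
    (hL : off + k ≤ L) (ht : (1 - ρ) * k ≤ t + 1) (hk : 8 * n ≤ 2 ^ k) :
    (instanceLaw ρ a b L).real {X | ¬ GoodBlock a b k t off X} ≤ 5 / 8 := by
  classical
  have := isProbabilityMeasure_instanceLaw h0 h1 a b L
  set others := Finset.univ.filter fun j => j ≠ a ∧ j ≠ b
  have cover : {X : Strings n L | ¬ GoodBlock a b k t off X} ⊆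
      {X | t < mismatches X.input a b off k} ∪
        ⋃ j ∈ others, {X | mismatches X.input j b off k = 0} := by
    intro X hX
    simpa [GoodBlock, others, imp_iff_not_or, and_assoc] using hX
  have others_le : others.card * (1 / 2 : ℝ) ^ k ≤ 1 / 8 := by
    have h_card : others.card ≤ n := (Finset.card_filter_le _ _).trans_eq (Finset.card_fin n)
    have h_pow : (8 * others.card : ℝ) ≤ 2 ^ k := by exact_mod_cast (by omega : _ ≤ _).trans hk
    rw [one_div, inv_pow, ← div_eq_mul_inv, div_le_iff₀ (by positivity)]
    linarith
  calc (instanceLaw ρ a b L).real {X | ¬ GoodBlock a b k t off X}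
      ≤ (instanceLaw ρ a b L).real {X | t < mismatches X.input a b off k} +
          ∑ j ∈ others, (instanceLaw ρ a b L).real {X | mismatches X.input j b off k = 0} :=
        (measureReal_mono cover).trans <| (measureReal_union_le _ _).trans <|
          add_le_add_right (measureReal_biUnion_finset_le _ _) _
    _ ≤ 1 / 2 + others.card * (1 / 2 : ℝ) ^ k := by
        rw [← nsmul_eq_mul, ← Finset.sum_const]
        refine add_le_add (measureReal_lt_mismatches_le h0 h1 hab hL ht)
          (Finset.sum_le_sum fun j hj => ?_)
        obtain ⟨hja, hjb⟩ := (Finset.mem_filter.1 hj).2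
        exact (measureReal_mismatches_eq_zero h0 h1 hL hja hjb).le
    _ ≤ 5 / 8 := by linarith

theorem measureReal_no_goodBlock_le (h0 : 0 ≤ ρ) (h1 : ρ ≤ 1) (hab : a ≠ b) {k t : ℕ}
    (ht : (1 - ρ) * k ≤ t + 1) (hk : 8 * n ≤ 2 ^ k) (N : ℕ) (hL : N * k ≤ L) :
    (instanceLaw ρ a b L).real {X | ∀ β < N, ¬ GoodBlock a b k t (β * k) X} ≤ (5 / 8) ^ N := by
  have := isProbabilityMeasure_columnLaw h0 h1 a b
  have := isProbabilityMeasure_instanceLaw h0 h1 a b L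
  induction N with
  | zero => simp
  | succ N ih =>
    rw [Nat.succ_mul] at hL
    have disjoint : Disjoint (positions L 0 (N * k)) (positions L (N * k) k) := by
      simp only [Finset.disjoint_left, mem_positions]
      omega
    have earlier : DependsOn (· ∈ {X : Strings n L | ∀ β < N, ¬ GoodBlock a b k t (β * k) X})
        (positions L 0 (N * k)) := by
      intro X Y hXY
      refine propext (forall₂_congr fun β hβ => not_congr (Eq.to_iff ?_))
      have hβ' : (β + 1) * k ≤ N * k := Nat.mul_le_mul_right k hβ
      rw [Nat.succ_mul] at hβ'
      refine dependsOn_goodBlock a b k t (by omega) fun q hq => hXY q ?_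
      simp only [Finset.mem_coe, mem_positions] at hq ⊢
      omega
    have last : DependsOn (· ∈ {X : Strings n L | ¬ GoodBlock a b k t (N * k) X})
        (positions L (N * k) k) := fun X Y hXY =>
      congrArg Not (dependsOn_goodBlock a b k t hL hXY)
    simp only [Nat.forall_lt_succ_right, Set.ofPred_and]
    rw [instanceLaw, measureReal_pi_inter_of_disjoint (columnLaw ρ a b) disjoint .of_discrete
      .of_discrete earlier last, pow_succ]
    exact mul_le_mul (ih (by omega)) (measureReal_not_goodBlock_le h0 h1 hab hL ht hk)
      measureReal_nonneg (by positivity)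

/-- The comparison of `i` and `j` on the first `V` positions gives the wrong result. -/
def Misjudged (a b i j : Fin n) (V thr : ℕ) (X : Strings n L) : Prop :=
  ¬ (mismatches X.input i j 0 V ≤ thr ↔ (i = a ∧ j = b ∨ i = b ∧ j = a))

theorem exp_deviation_le {A ℓ : ℕ} (hA : 0 < A) (hℓ : 0 < ℓ) {x : ℝ} (hx : √(2 * A) ≤ x) :
    Real.exp (-2 * (x * ℓ) ^ 2 / (A * ℓ : ℕ)) ≤ Real.exp (-4 * ℓ) := by
  have hx2 : (2 * A : ℝ) ≤ x ^ 2 := (Real.sqrt_le_left ((Real.sqrt_nonneg _).trans hx)).1 hx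
  refine Real.exp_le_exp.2 ?_
  push_cast
  rw [div_le_iff₀ (by positivity)]
  nlinarith [mul_le_mul_of_nonneg_right hx2 (sq_nonneg (ℓ : ℝ))]

variable {A D ℓ : ℕ}

theorem measureReal_misjudged_pair_le (h0 : 0 ≤ ρ) (h1 : ρ ≤ 1) (hab : a ≠ b) (hA : 0 < A)
    (hℓ : 0 < ℓ) (hD : √(2 * A) ≤ D - (1 - ρ) / 2 * A) (hL : A * ℓ ≤ L) {i j : Fin n}
    (hij : i = a ∧ j = b ∨ i = b ∧ j = a) :
    (instanceLaw ρ a b L).real {X | Misjudged a b i j (A * ℓ) (D * ℓ) X} ≤ Real.exp (-4 * ℓ) := by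
  have := isProbabilityMeasure_columnLaw h0 h1 a b
  have := isProbabilityMeasure_instanceLaw h0 h1 a b L
  have hL' : 0 + A * ℓ ≤ L := by omega
  have prob : (columnLaw ρ a b).real (differ i j) = (1 - ρ) / 2 := by
    rcases hij with ⟨rfl, rfl⟩ | ⟨rfl, rfl⟩
    · exact columnLaw_real_differ_pair h0 h1 hab
    · rw [differ_comm, columnLaw_real_differ_pair h0 h1 hab]
  have hoeffding := measureReal_add_le_hits_le_exp (columnLaw ρ a b) (E := differ i j) .of_discrete
    (positions L 0 (A * ℓ)) (ε := (D - (1 - ρ) / 2 * A) * ℓ)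
    (mul_nonneg ((Real.sqrt_nonneg _).trans hD) (Nat.cast_nonneg ℓ))
  rw [prob, card_positions hL'] at hoeffding
  refine (measureReal_mono fun X hX => ?_).trans (hoeffding.trans (exp_deviation_le hA hℓ hD))
  simp only [Misjudged, hij, iff_true, not_le, Set.mem_ofPred_eq, mismatches_input X i j hL'] at hX
  have hX' : (D * ℓ : ℝ) < hits (positions L 0 (A * ℓ)) (differ i j) X := by exact_mod_cast hX
  rw [Set.mem_ofPred_eq, Nat.cast_mul]
  linarith

theorem measureReal_misjudged_other_le (h0 : 0 ≤ ρ) (h1 : ρ ≤ 1) (hA : 0 < A)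
    (hℓ : 0 < ℓ) (hD : √(2 * A) ≤ A / 2 - D) (hL : A * ℓ ≤ L) {i j : Fin n} (hij : i ≠ j)
    (h : ¬ (i = a ∧ j = b ∨ i = b ∧ j = a)) :
    (instanceLaw ρ a b L).real {X | Misjudged a b i j (A * ℓ) (D * ℓ) X} ≤ Real.exp (-4 * ℓ) := by
  have := isProbabilityMeasure_columnLaw h0 h1 a b
  have := isProbabilityMeasure_instanceLaw h0 h1 a b L
  have hL' : 0 + A * ℓ ≤ L := by omega
  have hoeffding := measureReal_hits_add_le_le_exp (columnLaw ρ a b) (E := differ i j) .of_discrete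
    (positions L 0 (A * ℓ)) (ε := (A / 2 - D) * ℓ)
    (mul_nonneg ((Real.sqrt_nonneg _).trans hD) (Nat.cast_nonneg ℓ))
  rw [columnLaw_real_differ_other h0 h1 hij h, card_positions hL'] at hoeffding
  refine (measureReal_mono fun X hX => ?_).trans (hoeffding.trans (exp_deviation_le hA hℓ hD))
  simp only [Misjudged, h, iff_false, not_not, Set.mem_ofPred_eq, mismatches_input X i j hL'] at hX
  have hX' : (hits (positions L 0 (A * ℓ)) (differ i j) X : ℝ) ≤ D * ℓ := by exact_mod_cast hX
  rw [Set.mem_ofPred_eq, Nat.cast_mul]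
  linarith

theorem measureReal_misjudged_le (h0 : 0 ≤ ρ) (h1 : ρ ≤ 1) (hab : a ≠ b) (hA : 0 < A) (hℓ : 0 < ℓ)
    (hD : √(2 * A) ≤ D - (1 - ρ) / 2 * A) (hD' : √(2 * A) ≤ A / 2 - D) (hL : A * ℓ ≤ L)
    {i j : Fin n} (hij : i ≠ j) :
    (instanceLaw ρ a b L).real {X | Misjudged a b i j (A * ℓ) (D * ℓ) X} ≤ Real.exp (-4 * ℓ) := by
  by_cases h : i = a ∧ j = b ∨ i = b ∧ j = a
  · exact measureReal_misjudged_pair_le h0 h1 hab hA hℓ hD hL h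
  · exact measureReal_misjudged_other_le h0 h1 hA hℓ hD' hL hij h

theorem pow_mul_size_le {x : ℝ} {c : ℕ} (hx : 0 ≤ x) (hxc : x ≤ (1 / 2) ^ c) (hn : n ≠ 0) :
    x ^ n.size ≤ (1 / n : ℝ) ^ c := by
  have hn_lt : (n : ℝ) ≤ 2 ^ n.size := by exact_mod_cast (Nat.lt_size_self n).le
  have : (0 : ℝ) < n := by positivity
  calc x ^ n.size ≤ ((1 / 2) ^ c) ^ n.size := by gcongr
    _ = (1 / 2 ^ n.size) ^ c := by rw [← pow_mul, mul_comm, pow_mul, one_div_pow]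
    _ ≤ (1 / n : ℝ) ^ c := by gcongr

theorem exp_neg_four_le : Real.exp (-4) ≤ (1 / 2) ^ 5 := by
  have h : (2.7 : ℝ) ^ 4 ≤ Real.exp 1 ^ 4 :=
    pow_le_pow_left₀ (by norm_num) (by linarith [Real.exp_one_gt_d9]) 4
  rw [← Real.exp_nat_mul, Nat.cast_ofNat, mul_one] at h
  rw [Real.exp_neg, inv_le_comm₀ (Real.exp_pos _) (by norm_num)]
  norm_num at h ⊢
  linarith

theorem exp_neg_four_mul_size_le (hn : n ≠ 0) :
    Real.exp (-4 * n.size) ≤ (1 / n : ℝ) ^ 5 := by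
  rw [mul_comm, Real.exp_nat_mul]
  exact pow_mul_size_le (Real.exp_nonneg _) exp_neg_four_le hn

theorem five_eighths_pow_size_le (hn : n ≠ 0) :
    (5 / 8 : ℝ) ^ (5 * n.size) ≤ (1 / n : ℝ) ^ 3 := by
  rw [pow_mul]
  exact pow_mul_size_le (by positivity) (by norm_num) hn

theorem one_sub_le_measureReal_goodInstance (h0 : 0 ≤ ρ) (h1 : ρ ≤ 1) (hn : 2 ≤ n) (hab : a ≠ b)
    {k t : ℕ} (hA : 0 < A) (hD : √(2 * A) ≤ D - (1 - ρ) / 2 * A) (hD' : √(2 * A) ≤ A / 2 - D)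
    (ht : (1 - ρ) * k ≤ t + 1) (hk : 8 * n ≤ 2 ^ k)
    (hL : A * n.size ≤ L) (hL' : 5 * n.size * k ≤ L) :
    1 - 1 / (n : ℝ) ^ 2 ≤ (instanceLaw ρ a b L).real
      {X | GoodInstance a b (A * n.size) (D * n.size) k t (5 * n.size) X} := by
  classical
  have := isProbabilityMeasure_instanceLaw h0 h1 a b L
  have hn0 : n ≠ 0 := by omega
  set μ := instanceLaw ρ a b L
  set good := {X : Strings n L | GoodInstance a b (A * n.size) (D * n.size) k t (5 * n.size) X}
    with good_def
  set pairs := (Finset.univ : Finset (Fin n)).offDiag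
  have cover : goodᶜ ⊆ (⋃ p ∈ pairs, {X | Misjudged a b p.1 p.2 (A * n.size) (D * n.size) X}) ∪
      {X | ∀ β < 5 * n.size, ¬ GoodBlock a b k t (β * k) X} := by
    intro X hX
    simpa [good_def, pairs, GoodInstance, Misjudged, imp_iff_not_or] using hX
  have pairs_le : (pairs.card : ℝ) ≤ n ^ 2 := by
    simp only [pairs, Finset.offDiag_card, Finset.card_univ, Fintype.card_fin]
    exact_mod_cast (Nat.sub_le _ _).trans_eq (sq n).symm
  have bad_le : μ.real goodᶜ ≤ 1 / (n : ℝ) ^ 2 := by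
    calc μ.real goodᶜ
        ≤ ∑ p ∈ pairs, μ.real {X | Misjudged a b p.1 p.2 (A * n.size) (D * n.size) X} +
            μ.real {X | ∀ β < 5 * n.size, ¬ GoodBlock a b k t (β * k) X} :=
          (measureReal_mono cover).trans <| (measureReal_union_le _ _).trans <|
            add_le_add_left (measureReal_biUnion_finset_le _ _) _
      _ ≤ ∑ _p ∈ pairs, Real.exp (-4 * n.size) + (5 / 8) ^ (5 * n.size) :=
          add_le_add (Finset.sum_le_sum fun p hp => measureReal_misjudged_le h0 h1 hab hA
            (Nat.size_pos.2 (by omega)) hD hD' hL (Finset.mem_offDiag.1 hp).2.2)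
            (measureReal_no_goodBlock_le h0 h1 hab ht hk _ hL')
      _ ≤ (n : ℝ) ^ 2 * (1 / n) ^ 5 + (1 / n) ^ 3 := by
          rw [Finset.sum_const, nsmul_eq_mul]
          gcongr
          exacts [exp_neg_four_mul_size_le hn0, five_eighths_pow_size_le hn0]
      _ = 2 / n * (1 / (n : ℝ) ^ 2) := by field_simp; norm_num
      _ ≤ 1 / (n : ℝ) ^ 2 := mul_le_of_le_one_left (by positivity)
          ((div_le_one (by positivity)).2 (by exact_mod_cast hn))
  linarith [probReal_compl_eq_one_sub (μ := μ) (s := good) .of_discrete]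

end Probability

/-! ### The search solves the problem -/

section Search

theorem exists_threshold {ρ : ℝ} (h0 : 0 < ρ) (h1 : ρ ≤ 1) :
    ∃ A D : ℕ, 0 < A ∧ √(2 * A) ≤ D - (1 - ρ) / 2 * A ∧ √(2 * A) ≤ A / 2 - D := by
  set A := ⌈64 / ρ ^ 2⌉₊
  have hA : 64 ≤ A * ρ ^ 2 := (div_le_iff₀ (by positivity)).1 (Nat.le_ceil _)
  have hA0 : (0 : ℝ) < A := Nat.cast_pos.2 (Nat.ceil_pos.2 (by positivity))
  have margin : √(2 * A) ≤ ρ / 4 * A - 1 := by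
    refine Real.sqrt_le_iff.2 ⟨by nlinarith, ?_⟩
    nlinarith [mul_le_mul_of_nonneg_left hA hA0.le]
  have hD := Nat.le_ceil ((2 - ρ) / 4 * A)
  have hD' := Nat.ceil_lt_add_one (show 0 ≤ (2 - ρ) / 4 * A by nlinarith)
  exact ⟨A, ⌈(2 - ρ) / 4 * A⌉₊, Nat.cast_pos.1 hA0, by linarith, by linarith⟩

theorem exists_nat_mul_le_le_two_mul {x : ℝ} (hx : 0 ≤ x) :
    ∃ p q : ℕ, 0 < q ∧ x * q ≤ p ∧ p ≤ 2 * x * q := by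
  rcases hx.eq_or_lt with rfl | hx
  · exact ⟨0, 1, one_pos, by simp, by simp⟩
  · have hq : 1 ≤ x * ⌈1 / x⌉₊ := (div_le_iff₀' hx).1 (Nat.le_ceil _)
    have hp := Nat.ceil_lt_add_one (show 0 ≤ x * ⌈1 / x⌉₊ by positivity)
    exact ⟨⌈x * ⌈1 / x⌉₊⌉₊, ⌈1 / x⌉₊, Nat.ceil_pos.2 (by positivity), Nat.le_ceil _, by linarith⟩

theorem mul_size_le_of_mul_logb_sq_le {A n L : ℕ} (hn : 2 ≤ n)
    (hL : (2 * A + 50) * Real.logb 2 n ^ 2 ≤ L) :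
    A * n.size ≤ L ∧ 5 * n.size * (n.size + 3) ≤ L := by
  have h_log := one_le_logb hn
  have h_size := size_le_logb_add_one (show n ≠ 0 by omega)
  have h_log_sq : Real.logb 2 n ≤ Real.logb 2 n ^ 2 := le_self_pow₀ h_log two_ne_zero
  have hA : (A : ℝ) * n.size ≤ A * (2 * Real.logb 2 n ^ 2) := by gcongr; linarith
  have h_blocks : (n.size : ℝ) * (n.size + 3) ≤ 2 * Real.logb 2 n * (5 * Real.logb 2 n) := by
    gcongr <;> linarith
  have hA0 : 0 ≤ (A : ℝ) * Real.logb 2 n ^ 2 := by positivity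
  constructor <;> refine Nat.cast_le (α := ℝ).1 ?_ <;> push_cast <;>
    linarith [sq_nonneg (Real.logb 2 n)]

theorem searchSteps_le {ℓ n A cnt : ℕ} (hn : n ≠ 0) (h : 2 ^ (ℓ + 3) ≤ 16 * n) :
    searchSteps ℓ n (A * ℓ) cnt ≤ (140 * A + 700) * (ℓ + 3) ^ 2 * (n * (cnt + 1)) := by
  obtain ⟨k, hk⟩ : ∃ k, k = ℓ + 3 := ⟨_, rfl⟩
  have hℓ : ℓ ≤ k := by omega
  have hn1 : 1 ≤ n := Nat.one_le_iff_ne_zero.2 hn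
  have block_le : n * (7 * k + 13) + n * (cnt * (28 * (A * ℓ) + 14 * k + 52) + 7 * k + 12) + 10 ≤
      (28 * A + 60) * k * (n * (cnt + 1)) := by
    have per_pattern : 28 * (A * ℓ) + 14 * k + 52 ≤ (28 * A + 60) * k := by nlinarith
    have per_string : 14 * k + 35 ≤ (28 * A + 60) * k := by nlinarith
    calc n * (7 * k + 13) + n * (cnt * (28 * (A * ℓ) + 14 * k + 52) + 7 * k + 12) + 10
        ≤ n * cnt * (28 * (A * ℓ) + 14 * k + 52) + n * (14 * k + 35) := by nlinarith
      _ ≤ n * cnt * ((28 * A + 60) * k) + n * ((28 * A + 60) * k) := by gcongr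
      _ = (28 * A + 60) * k * (n * (cnt + 1)) := by ring
  have tail_le : 9 * ℓ + 41 ≤ 14 * k * n := by nlinarith
  rw [searchSteps, ← hk]
  rw [← hk] at h
  calc _ ≤ 5 * k * ((28 * A + 60) * k * (n * (cnt + 1))) + 16 * n * (14 * k + 18) + 14 * k * n := by
        rw [add_assoc _ (9 * ℓ)]
        gcongr
    _ ≤ 5 * k * ((28 * A + 60) * k * (n * (cnt + 1))) + 400 * k ^ 2 * (n * (cnt + 1)) := by
        rw [add_assoc]
        gcongr
        have : 16 * (14 * k + 18) + 14 * k ≤ 400 * k ^ 2 := by nlinarith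
        nlinarith [Nat.mul_le_mul_left n this, Nat.zero_le (400 * k ^ 2 * (n * cnt))]
    _ = (140 * A + 700) * k ^ 2 * (n * (cnt + 1)) := by ring

theorem search_time_le {A W n cnt T : ℕ} (hn : 2 ≤ n)
    (hT : T ≤ 1 + searchSteps n.size n (A * n.size) cnt * (2 * (W * (n.size + 3) ^ 2) + 1))
    {E : ℝ} (h_cnt : (cnt : ℝ) + 1 ≤ 17 * E) :
    (T : ℝ) ≤ (140 * A + 700) * (2 * W + 2) * 5 ^ 4 * 17 * (n * Real.logb 2 n ^ 4) * E := by
  have hn0 : n ≠ 0 := by omega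
  obtain ⟨k, hk⟩ : ∃ k, k = n.size + 3 := ⟨_, rfl⟩
  have h_pow : 2 ^ (n.size + 3) ≤ 16 * n := by
    have := two_pow_size_le hn0
    rw [pow_add]
    omega
  have h_steps := searchSteps_le (A := A) (cnt := cnt) hn0 h_pow
  rw [← hk] at h_steps hT
  have h_logk : (k : ℝ) ≤ 5 * Real.logb 2 n := by
    have := one_le_logb hn
    have := size_le_logb_add_one hn0
    rw [hk, Nat.cast_add, Nat.cast_ofNat]
    linarith
  have hk1 : 1 ≤ k ^ 2 := Nat.one_le_pow _ _ (by omega)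
  have h_nat : T ≤ (140 * A + 700) * (2 * W + 2) * k ^ 4 * (n * (cnt + 1)) := by
    have h_one : 1 ≤ (140 * A + 700) * k ^ 2 * (n * (cnt + 1)) :=
      Nat.one_le_iff_ne_zero.2 (by positivity)
    calc T ≤ (140 * A + 700) * k ^ 2 * (n * (cnt + 1)) +
            (140 * A + 700) * k ^ 2 * (n * (cnt + 1)) * (2 * (W * k ^ 2) + 1) :=
          hT.trans (by gcongr)
      _ = (140 * A + 700) * k ^ 2 * (n * (cnt + 1)) * (2 * (W * k ^ 2) + 2 * 1) := by ring
      _ ≤ (140 * A + 700) * k ^ 2 * (n * (cnt + 1)) * (2 * (W * k ^ 2) + 2 * k ^ 2) := by gcongr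
      _ = (140 * A + 700) * (2 * W + 2) * k ^ 4 * (n * (cnt + 1)) := by ring
  calc (T : ℝ) ≤ (140 * A + 700) * (2 * W + 2) * (k : ℝ) ^ 4 * (n * (cnt + 1)) := by
        exact_mod_cast h_nat
    _ ≤ (140 * A + 700) * (2 * W + 2) * (5 * Real.logb 2 n) ^ 4 * (n * (17 * E)) := by gcongr
    _ = _ := by ring

variable {ρ e : ℝ} {A D p q W n L : ℕ} {mem : ℕ → ℕ}

theorem card_lightWords_add_one_le (h0 : 0 ≤ ρ) (h1 : ρ ≤ 1)
    (he : min 1 (4 * H2 ((1 - ρ) / 2)) ≤ e * (4 * Real.log 2 / ρ ^ 2)) (hn : 2 ≤ n) {t : ℕ}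
    (ht : (t : ℝ) ≤ 2 * (1 - ρ) * (n.size + 3)) :
    ((lightWords (n.size + 3) t).card : ℝ) + 1 ≤
      17 * (2 : ℝ) ^ (e * (4 * Real.log 2 * Real.logb 2 n / ρ ^ 2)) := by
  have hδ0 : 0 ≤ (1 - ρ) / 2 := by linarith
  have hδ1 : (1 - ρ) / 2 ≤ 1 / 2 := by linarith
  have h_log : 0 ≤ Real.logb 2 n := zero_le_one.trans (one_le_logb hn)
  set θ := min 1 (4 * H2 ((1 - ρ) / 2))
  have hθ : 0 ≤ θ := le_min zero_le_one (by linarith [H2_nonneg hδ0 (by linarith)])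
  have exponent_le :
      θ * Real.logb 2 n ≤ e * (4 * Real.log 2 * Real.logb 2 n / ρ ^ 2) := by
    exact (mul_le_mul_of_nonneg_right he h_log).trans_eq (by ring)
  have one_le : (1 : ℝ) ≤ 2 ^ (e * (4 * Real.log 2 * Real.logb 2 n / ρ ^ 2)) :=
    Real.one_le_rpow one_le_two ((mul_nonneg hθ h_log).trans exponent_le)
  have card_le : ((lightWords (n.size + 3) t).card : ℝ) ≤
      16 * 2 ^ (e * (4 * Real.log 2 * Real.logb 2 n / ρ ^ 2)) := by
    calc ((lightWords (n.size + 3) t).card : ℝ) ≤ 2 ^ (θ * ((n.size + 3 : ℕ) : ℝ)) :=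
          card_lightWords_le_two_rpow_min (by norm_num) hδ0 hδ1
            (ht.trans_eq (by push_cast; ring))
      _ = 2 ^ (θ * (n.size + 3)) := by push_cast; rfl
      _ ≤ 16 * 2 ^ (θ * Real.logb 2 n) :=
          two_rpow_mul_size_add_three_le hθ (min_le_left _ _) (by omega)
      _ ≤ 16 * 2 ^ (e * (4 * Real.log 2 * Real.logb 2 n / ρ ^ 2)) := by
          gcongr
          exact one_le_two
  linarith

theorem search_halts (h0 : 0 < ρ) (h1 : ρ ≤ 1) (hn : 2 ≤ n) (hp : (p : ℝ) ≤ 2 * (1 - ρ) * q)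
    (hq : 0 < q) (he : min 1 (4 * H2 ((1 - ρ) / 2)) ≤ e * (4 * Real.log 2 / ρ ^ 2))
    (hW : A + D + p + q + 10 ≤ W) (hmem : ∀ x, mem x < 2 ^ (W * (n.size + 3) ^ 2))
    (X : Strings n L) :
    ∃ (T : ℕ) (s : State), Exec X.input (search A D p q) (initState [n, L] mem) T s ∧
      (T : ℝ) ≤ timeBound ρ e ((140 * A + 700) * (2 * W + 2) * 5 ^ 4 * 17) 4 0 n := by
  obtain ⟨T, s, h_exec, hT, -⟩ := exec_search (L := L) X.input_le_one
    (Nat.mul_le_mul_right _ hW) hmem rfl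
  refine ⟨T, s, h_exec, ?_⟩
  rw [timeBound, add_zero, mul_one]
  refine search_time_le hn hT (card_lightWords_add_one_le h0.le h1 he hn ?_)
  refine Nat.cast_div_le.trans ((div_le_iff₀ (by positivity)).2 ?_)
  push_cast
  nlinarith [mul_le_mul_of_nonneg_left hp (show (0 : ℝ) ≤ n.size + 3 by positivity)]

theorem search_succeeds (h0 : 0 ≤ ρ) (h1 : ρ ≤ 1) (hn : 2 ≤ n) (hA : 0 < A)
    (hD : √(2 * A) ≤ D - (1 - ρ) / 2 * A) (hD' : √(2 * A) ≤ A / 2 - D) (hq : 0 < q)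
    (hp : (1 - ρ) * q ≤ p) (hW : A + D + p + q + 10 ≤ W)
    (hmem : ∀ x, mem x < 2 ^ (W * (n.size + 3) ^ 2))
    (hL : (2 * A + 50) * Real.logb 2 n ^ 2 ≤ L) {a b : Fin n} (hab : a ≠ b) :
    1 - 1 / (n : ℝ) ^ 2 ≤
      (instanceLaw ρ a b L).real {X | FindsPair (search A D p q) mem X a b} := by
  have := isProbabilityMeasure_instanceLaw h0 h1 a b L
  obtain ⟨hL₁, hL₂⟩ := mul_size_le_of_mul_logb_sq_le hn hL
  have radius_large : (1 - ρ) * (n.size + 3 : ℕ) ≤ ((n.size + 3) * p / q : ℕ) + 1 := by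
    have h_div : (((n.size + 3) * p : ℕ) : ℝ) < q * (((n.size + 3) * p / q : ℕ) + 1) := by
      exact_mod_cast Nat.lt_mul_div_succ ((n.size + 3) * p) hq
    refine le_of_mul_le_mul_right ?_ (Nat.cast_pos (α := ℝ).2 hq)
    rw [Nat.cast_mul] at h_div
    nlinarith [mul_le_mul_of_nonneg_left hp (Nat.cast_nonneg (α := ℝ) (n.size + 3))]
  have block_long : 8 * n ≤ 2 ^ (n.size + 3) := by
    have := (Nat.lt_size_self n).le
    rw [pow_add]
    omega
  refine (one_sub_le_measureReal_goodInstance h0 h1 hn hab hA hD hD' radius_large block_long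
    hL₁ hL₂).trans (measureReal_mono fun X hX => ?_)
  obtain ⟨T, s, h_exec, -, h_done⟩ := exec_search (L := L) X.input_le_one
    (Nat.mul_le_mul_right _ hW) hmem rfl
  exact ⟨T, s, h_exec, hX.output hab h_done⟩

theorem exists_search_solves (h0 : 0 < ρ) (h1 : ρ ≤ 1)
    (he : min 1 (4 * H2 ((1 - ρ) / 2)) ≤ e * (4 * Real.log 2 / ρ ^ 2)) (W : ℕ) :
    ∃ (Q : Cmd) (C c : ℝ), ∀ n : ℕ, 2 ≤ n → ∀ mem : ℕ → ℕ,
      (∀ x, mem x < 2 ^ (W * (n.size + 3) ^ 2)) → ∀ L : ℕ, c * Real.logb 2 n ^ 2 ≤ L →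
        Solves Q mem ρ n L (timeBound ρ e C 4 0 n) := by
  obtain ⟨A, D, hA, hD, hD'⟩ := exists_threshold h0 h1
  obtain ⟨p, q, hq, hp, hp'⟩ := exists_nat_mul_le_le_two_mul (sub_nonneg.2 h1)
  set W' := W + (A + D + p + q + 10)
  refine ⟨search A D p q, (140 * A + 700) * (2 * W' + 2) * 5 ^ 4 * 17, 2 * A + 50,
    fun n hn mem hmem L hL => ?_⟩
  have hW : A + D + p + q + 10 ≤ W' := Nat.le_add_left _ _
  have hmem' : ∀ x, mem x < 2 ^ (W' * (n.size + 3) ^ 2) := fun x => (hmem x).trans_le <|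
    Nat.pow_le_pow_right two_pos (Nat.mul_le_mul_right _ (Nat.le_add_right _ _))
  exact ⟨search_halts h0 h1 hn hp' hq he hW hmem',
    fun a b hab => search_succeeds h0.le h1 hn hA hD hD' hq hp hW hmem' hL hab⟩

end Search

/-! ### The cost of the preprocessing -/

section Preprocess

theorem logb_pow_le {γ : ℝ} (hγ : 0 < γ) {j : ℕ} (hj : j ≠ 0) (n : ℕ) :
    Real.logb 2 n ^ j ≤ (j / (γ * Real.log 2)) ^ j * (n : ℝ) ^ γ := by
  have h_log2 := Real.log_pos one_lt_two
  have hj0 : (0 : ℝ) < j := by positivity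
  have hn : (0 : ℝ) ≤ n := Nat.cast_nonneg n
  have root_le : Real.logb 2 n ≤ j / (γ * Real.log 2) * (n : ℝ) ^ (γ / j) := by
    rw [Real.logb, div_le_iff₀ h_log2]
    refine (Real.log_le_rpow_div hn (show 0 < γ / j by positivity)).trans_eq ?_
    field_simp
  have h_nonneg : 0 ≤ Real.logb 2 n := div_nonneg (Real.log_natCast_nonneg n) h_log2.le
  calc Real.logb 2 n ^ j ≤ (j / (γ * Real.log 2) * (n : ℝ) ^ (γ / j)) ^ j := by gcongr
    _ = (j / (γ * Real.log 2)) ^ j * (n : ℝ) ^ γ := by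
      rw [mul_pow, ← Real.rpow_mul_natCast hn, div_mul_cancel₀ γ hj0.ne']

variable {ρ : ℝ} {n : ℕ}

theorem blockLength_le_mul_add_one (ρ : ℝ) (n : ℕ) :
    (blockLength ρ n : ℝ) ≤ 4 * Real.log 2 / ρ ^ 2 * Real.logb 2 n + 1 := by
  have h_log2 := Real.log_pos one_lt_two
  have h_nonneg : 0 ≤ Real.logb 2 n := div_nonneg (Real.log_natCast_nonneg n) h_log2.le
  rw [blockLength, mul_div_right_comm]
  exact (Nat.ceil_lt_add_one (by positivity)).le

theorem codeDistance_le_blockLength (h : -1 ≤ ρ) (n : ℕ) :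
    codeDistance ρ n ≤ blockLength ρ n := by
  refine Nat.ceil_le.2 ?_
  nlinarith [Nat.cast_nonneg (α := ℝ) (blockLength ρ n)]

theorem two_pow_blockLength_le (ρ : ℝ) (hn : n ≠ 0) :
    (2 : ℝ) ^ blockLength ρ n ≤ 2 * (n : ℝ) ^ (4 * Real.log 2 / ρ ^ 2) := by
  calc (2 : ℝ) ^ blockLength ρ n = (2 : ℝ) ^ (blockLength ρ n : ℝ) := (Real.rpow_natCast _ _).symm
    _ ≤ (2 : ℝ) ^ (Real.logb 2 n * (4 * Real.log 2 / ρ ^ 2) + 1) :=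
      Real.rpow_le_rpow_of_exponent_le one_le_two
        ((blockLength_le_mul_add_one ρ n).trans_eq (by ring))
    _ = 2 * (n : ℝ) ^ (4 * Real.log 2 / ρ ^ 2) := by
      rw [Real.rpow_add two_pos, Real.rpow_mul two_pos.le,
        Real.rpow_logb two_pos (by norm_num) (by positivity), Real.rpow_one, mul_comm]

theorem blockLength_add_two_le {W : ℕ} (hW : 4 * Real.log 2 / ρ ^ 2 + 3 ≤ W) (hn : n ≠ 0) :
    blockLength ρ n + 2 ≤ W * (n.size + 3) ^ 2 := by
  have hK : 0 ≤ 4 * Real.log 2 / ρ ^ 2 := by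
    have := Real.log_pos one_lt_two
    positivity
  have h_size : (1 : ℝ) ≤ n.size := Nat.one_le_cast.2 (Nat.size_pos.2 (Nat.pos_of_ne_zero hn))
  refine Nat.cast_le (α := ℝ).1 ?_
  push_cast
  calc (blockLength ρ n : ℝ) + 2 ≤ 4 * Real.log 2 / ρ ^ 2 * n.size + 3 := by
        linarith [blockLength_le_mul_add_one ρ n, mul_le_mul_of_nonneg_left (logb_le_size hn) hK]
    _ ≤ (4 * Real.log 2 / ρ ^ 2 + 3) * n.size := by linarith
    _ ≤ W * ((n.size : ℝ) + 3) ^ 2 := mul_le_mul hW (by nlinarith) (by linarith) (by linarith)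

theorem bounded_initState {B : ℕ} {args : List ℕ} (h : ∀ x ∈ args, x < 2 ^ B) :
    Bounded B (initState args fun _ => 0) := by
  refine ⟨fun r => ?_, fun _ => Nat.two_pow_pos B⟩
  change args.getD r 0 < 2 ^ B
  rw [List.getD_eq_getElem?_getD]
  rcases lt_or_ge r args.length with hr | hr
  · rw [List.getElem?_eq_getElem hr]
    exact h _ (List.getElem_mem hr)
  · rw [List.getElem?_eq_none hr]
    exact Nat.two_pow_pos B

theorem preprocess_time_le {T W : ℕ} (hn : 2 ≤ n)
    (hT : T ≤ 2 ^ blockLength ρ n * (300 * (blockLength ρ n + 1) ^ 2) *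
      (2 * (W * (n.size + 3) ^ 2) + 1)) :
    (T : ℝ) ≤ 600 * (4 * Real.log 2 / ρ ^ 2 + 2) ^ 2 * (50 * W + 1) *
      (n : ℝ) ^ (4 * Real.log 2 / ρ ^ 2) * Real.logb 2 n ^ 4 := by
  have h_log := one_le_logb hn
  have h_size := size_le_logb_add_one (show n ≠ 0 by omega)
  set K := 4 * Real.log 2 / ρ ^ 2
  have h_code : (2 : ℝ) ^ blockLength ρ n ≤ 2 * (n : ℝ) ^ K := two_pow_blockLength_le ρ (by omega)
  have h_length : (blockLength ρ n : ℝ) + 1 ≤ (K + 2) * Real.logb 2 n := by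
    linarith [blockLength_le_mul_add_one ρ n]
  have h_word : 2 * (W * ((n.size : ℝ) + 3) ^ 2) + 1 ≤ (50 * W + 1) * Real.logb 2 n ^ 2 := by
    have : ((n.size : ℝ) + 3) ^ 2 ≤ (5 * Real.logb 2 n) ^ 2 := by gcongr; linarith
    nlinarith [mul_le_mul_of_nonneg_left this (Nat.cast_nonneg (α := ℝ) W)]
  calc (T : ℝ) ≤ 2 ^ blockLength ρ n * (300 * ((blockLength ρ n : ℝ) + 1) ^ 2) *
          (2 * (W * ((n.size : ℝ) + 3) ^ 2) + 1) := by exact_mod_cast hT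
    _ ≤ (2 * (n : ℝ) ^ K) * (300 * ((K + 2) * Real.logb 2 n) ^ 2) *
          ((50 * W + 1) * Real.logb 2 n ^ 2) := by gcongr
    _ = _ := by ring

theorem exists_preprocess (h0 : 0 < ρ) :
    ∃ (W : ℕ) (C : ℝ), ∀ n : ℕ, 2 ≤ n → ∃ (t : ℕ) (s : State),
      Exec (fun _ _ => 0) preprocess
        (initState [n, blockLength ρ n, codeDistance ρ n] (fun _ => 0)) t s ∧
      (t : ℝ) ≤ C * (n : ℝ) ^ (2.773 / ρ ^ 2) ∧
      (∃ K : Set (Fin (blockLength ρ n) → Bool),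
        IsGilbertCode (blockLength ρ n) (codeDistance ρ n) K ∧
        IsDecodingTable (blockLength ρ n) (codeDistance ρ n) K s.mem) ∧
      ∀ x, s.mem x < 2 ^ (W * (n.size + 3) ^ 2) := by
  obtain ⟨W, hW⟩ := exists_nat_ge (4 * Real.log 2 / ρ ^ 2 + 3)
  set K := 4 * Real.log 2 / ρ ^ 2 with hK
  -- `4 ln 2 < 2.773` leaves room for the logarithmic factors.
  have slack : 0 < 2.773 / ρ ^ 2 - K := by
    rw [hK, ← sub_div]
    exact div_pos (by linarith [Real.log_two_lt_d9]) (by positivity)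
  set γ := 2.773 / ρ ^ 2 - K with hγ
  refine ⟨W, 600 * (K + 2) ^ 2 * (50 * W + 1) * ((4 : ℕ) / (γ * Real.log 2)) ^ 4, fun n hn => ?_⟩
  have hn0 : n ≠ 0 := by omega
  set B := W * (n.size + 3) ^ 2
  have h_block : blockLength ρ n + 2 ≤ B := blockLength_add_two_le hW hn0
  have h_dist := codeDistance_le_blockLength (show -1 ≤ ρ by linarith) n
  have h_size : n.size ≤ B := by
    have hW1 : 0 < W := Nat.pos_of_ne_zero fun h => by simp [B, h] at h_block
    calc n.size ≤ (n.size + 3) ^ 2 := by nlinarith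
      _ ≤ B := Nat.le_mul_of_pos_left _ hW1
  have hB := Nat.lt_two_pow_self (n := B)
  obtain ⟨t, s, h_exec, ht, h_bounded, h_code⟩ := runs_preprocess (inp := fun _ _ => 0)
    (s := initState [n, blockLength ρ n, codeDistance ρ n] fun _ => 0) h_block rfl rfl
    (fun _ => rfl) (bounded_initState (by simpa using
      ⟨Nat.size_le.1 h_size, by omega, by omega⟩))
  refine ⟨t, s, h_exec, ?_, h_code, h_bounded.mem⟩
  calc (t : ℝ) ≤ 600 * (K + 2) ^ 2 * (50 * W + 1) * (n : ℝ) ^ K * Real.logb 2 n ^ 4 :=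
        preprocess_time_le hn ht
    _ ≤ 600 * (K + 2) ^ 2 * (50 * W + 1) * (n : ℝ) ^ K *
        (((4 : ℕ) / (γ * Real.log 2)) ^ 4 * (n : ℝ) ^ γ) := by
      gcongr
      exact logb_pow_le slack four_ne_zero n
    _ = 600 * (K + 2) ^ 2 * (50 * W + 1) * ((4 : ℕ) / (γ * Real.log 2)) ^ 4 *
        (n : ℝ) ^ (K + γ) := by
      rw [Real.rpow_add (by positivity)]
      ring
    _ = _ := by rw [hγ, add_sub_cancel]

end Preprocess

theorem timeBound_mono {ρ e C C' : ℝ} (h : C ≤ C') (k : ℕ) (ε : ℝ) (n : ℕ) :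
    timeBound ρ e C k ε n ≤ timeBound ρ e C' k ε n := by
  have : 0 ≤ Real.logb 2 n :=
    div_nonneg (Real.log_natCast_nonneg n) (Real.log_pos one_lt_two).le
  unfold timeBound
  gcongr

theorem Solves.mono {Q : Cmd} {mem : ℕ → ℕ} {ρ : ℝ} {n L : ℕ} {T T' : ℝ}
    (h : Solves Q mem ρ n L T) (hT : T ≤ T') : Solves Q mem ρ n L T' :=
  ⟨fun X => (h.1 X).imp fun _ h => h.imp fun _ h => ⟨h.1, h.2.trans hT⟩, h.2⟩

theorem four_mul_le_mul {ρ x e : ℝ} (h0 : 0 < ρ) (h1 : ρ ≤ 1) (hx : 0 ≤ x) (h : 2 * x ≤ e) :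
    4 * x ≤ e * (4 * Real.log 2 / ρ ^ 2) := by
  have : 2 ≤ 4 * Real.log 2 / ρ ^ 2 := by
    rw [le_div_iff₀ (by positivity)]
    nlinarith [Real.log_two_gt_d9]
  nlinarith

variable {ρ : ℝ} (h0 : 0 < ρ) (h1 : ρ ≤ 1)
include h0 h1

theorem min_le_H2_one_sub_kappaZ_mul
    (h : 1 / 2 ≤ kappaZ ((1 - ρ) / 2) ∨
      1 ≤ H2 (1 - kappaZ ((1 - ρ) / 2)) * (4 * Real.log 2 / ρ ^ 2)) :
    min 1 (4 * H2 ((1 - ρ) / 2)) ≤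
      H2 (1 - kappaZ ((1 - ρ) / 2)) * (4 * Real.log 2 / ρ ^ 2) := by
  refine h.elim (fun h => min_le_of_right_le ?_) min_le_of_left_le
  have hH0 := H2_nonneg (x := (1 - ρ) / 2) (by linarith) (by linarith)
  have hκ := kappaZ_le_one_sub_H2 (δ := (1 - ρ) / 2) (by linarith) (by linarith)
  have hκ2 := two_mul_le_H2 (x := 1 - kappaZ ((1 - ρ) / 2)) (by linarith) (by linarith)
  exact four_mul_le_mul h0 h1 hH0 (by linarith)

theorem min_le_H2_H2_mul :
    min 1 (4 * H2 ((1 - ρ) / 2)) ≤ H2 (H2 ((1 - ρ) / 2)) * (4 * Real.log 2 / ρ ^ 2) := by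
  have hH0 := H2_nonneg (x := (1 - ρ) / 2) (by linarith) (by linarith)
  rcases le_total (H2 ((1 - ρ) / 2)) (1 / 2) with h | h
  · exact min_le_of_right_le (four_mul_le_mul h0 h1 hH0 (two_mul_le_H2 hH0 h))
  · exact min_le_of_left_le (one_le_H2_H2_mul h0 h1 h)

end LightBulb

open LightBulb Filter Topology in
theorem mainTheorem7 (ρ : ℝ) (hρ0 : 0 < ρ) (hρ1 : ρ ≤ 1) :
    ((1 / 2 ≤ kappaZ ((1 - ρ) / 2) ∨
        1 ≤ H2 (1 - kappaZ ((1 - ρ) / 2)) * (4 * Real.log 2 / ρ ^ 2)) →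
      ∃ (Q : Cmd) (C c : ℝ) (k : ℕ) (ε : ℕ → ℝ), Tendsto ε atTop (𝓝 0) ∧
        ∀ n : ℕ, 2 ≤ n → ∀ L : ℕ, c * Real.logb 2 n ^ 2 ≤ L →
          Solves Q (fun _ => 0) ρ n L
            (timeBound ρ (H2 (1 - kappaZ ((1 - ρ) / 2))) C k (ε n) n)) ∧
    ∃ (P Q : Cmd) (C c : ℝ) (k : ℕ) (ε : ℕ → ℝ), Tendsto ε atTop (𝓝 0) ∧
      ∀ n : ℕ, 2 ≤ n → ∃ (t : ℕ) (s : State),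
        Exec (fun _ _ => 0) P
          (initState [n, blockLength ρ n, codeDistance ρ n] (fun _ => 0)) t s ∧
        (t : ℝ) ≤ C * (n : ℝ) ^ (2.773 / ρ ^ 2) ∧
        (∃ K : Set (Fin (blockLength ρ n) → Bool),
          IsGilbertCode (blockLength ρ n) (codeDistance ρ n) K ∧
          IsDecodingTable (blockLength ρ n) (codeDistance ρ n) K s.mem) ∧
        ∀ L : ℕ, c * Real.logb 2 n ^ 2 ≤ L →
          Solves Q s.mem ρ n L
            (timeBound ρ (H2 (H2 ((1 - ρ) / 2))) C k (ε n) n) := by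
  constructor
  · intro h
    obtain ⟨Q, C, c, hQ⟩ := exists_search_solves hρ0 hρ1 (min_le_H2_one_sub_kappaZ_mul hρ0 hρ1 h) 0
    exact ⟨Q, C, c, 4, fun _ => 0, tendsto_const_nhds, fun n hn L hL =>
      hQ n hn _ (fun _ => by positivity) L hL⟩
  · obtain ⟨W, C₁, hP⟩ := exists_preprocess hρ0
    obtain ⟨Q, C₂, c, hQ⟩ := exists_search_solves hρ0 hρ1 (min_le_H2_H2_mul hρ0 hρ1) W
    refine ⟨preprocess, Q, max C₁ C₂, c, 4, fun _ => 0, tendsto_const_nhds, fun n hn => ?_⟩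
    obtain ⟨t, s, h_exec, ht, h_table, h_mem⟩ := hP n hn
    refine ⟨t, s, h_exec, ht.trans (by gcongr; exact le_max_left _ _), h_table, fun L hL => ?_⟩
    exact (hQ n hn s.mem h_mem L hL).mono (timeBound_mono (le_max_right _ _) 4 0 n)
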